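/- \textbf{Theorem (Learning to predict an unknown observable).} Notation: an $n$-qubit observable is a Hermitian operator $O$ on $(\mathbb C^2)^{\otimes n}$, with Pauli expansion $O=\sum_{P\in\{I,X,Y,Z\}^{\otimes n}}\alpha_P P$, $\alpha_P=\mathrm{Tr}(PO)/2^n$; $|P|$ is the number of qubits on which $P$ acts nontrivially, $\|\cdot\|$ is the spectral norm and $\log$ is the natural logarithm. A probability distribution $\mathcal D$ over $n$-qubit states (density matrices) is invariant under a unitary $U$ if $U\rho U^\dagger$ is distributed as $\mathcal D$ whenever $\rho\sim\mathcal D$. There is an absolute constant $C>0$ with the following property. Let $n\ge 2$ be an integer, let $0<\varepsilon<1$, $\varepsilon'>0$, $\delta>0$, and let $N$ be any nonnegative integer with $$N\ \ge\ \log\!\Big(\frac n\delta\Big)\,\min\Big(2^{\,C\log(1/\varepsilon)\,\left(\log\log(1/\varepsilon)+\log(1/\varepsilon')\right)},\ 2^{\,C\log(1/\varepsilon)\log n}\Big).$$ Put $k=\lceil\log_{1.5}(1/\varepsilon)\rceil$ and $r=\frac{2k}{k+1}\in[1,2)$. Then there is a learning rule, depending only on $n,\varepsilon,\varepsilon',\delta,N$,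 that maps training data $(\rho_\ell,y_\ell)_{\ell=1}^N$ of $n$-qubit states and real numbers to a pair $(\hat O,\hat\Theta)$ of an $n$-qubit observable and a real number, and thereby to the function $$h(\rho)=\max\big(-\hat\Theta,\min(\hat\Theta,\mathrm{Tr}(\hat O\rho))\big),$$ such that the following holds for every $n$-qubit observable $O=\sum_P\alpha_P P$ and every probability distribution $\mathcal D$ over $n$-qubit states that is invariant under the Hadamard gate $H$ and the phase gate $S=\mathrm{diag}(1,i)$ on each single qubit. If $\rho_1,\dots,\rho_N$ are drawn independently from $\mathcal D$ and $y_\ell=\mathrm{Tr}(O\rho_\ell)$, then with probability at least $1-\delta$ over the training data $$\mathbb E_{\rho\sim\mathcal D}\big|h(\rho)-\mathrm{Tr}(O\rho)\big|^2\ \le\ \Big(\varepsilon+\varepsilon'\Big[1+\Big(\frac{\|O^{(\mathrm{low})}\|}{\|O\|}\Big)^{r}\Big]\Big)\|O\|^2,\qquad O^{(\mathrm{low})}=\sum_{|P|\le k}\alpha_P P,$$ where the right-hand side is read as $0$ if $O=0$. -/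

import Mathlib

open MeasureTheory
open scoped ComplexOrder

noncomputable section

/-- Operators on `n` qubits, as complex matrices in the computational basis. -/
abbrev QubitOp (n : ℕ) : Type := Matrix (Fin n → Fin 2) (Fin n → Fin 2) ℂ

instance instMeasurableSpaceQubitOp (n : ℕ) : MeasurableSpace (QubitOp n) := borel _

instance instBorelSpaceQubitOp (n : ℕ) : BorelSpace (QubitOp n) := ⟨rfl⟩

/-- `n`-qubit observables: Hermitian operators. -/
abbrev Observable (n : ℕ) : Type := {O : QubitOp n // O.IsHermitian}

/-- `n`-qubit states: density matrices, with the Borel σ-algebra. -/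
abbrev QState (n : ℕ) : Type := {ρ : QubitOp n // ρ.PosSemidef ∧ ρ.trace = 1}

/-- The tensor product `U 0 ⊗ U 1 ⊗ ⋯` of single-qubit operators. -/
def tensorOp {n : ℕ} (U : Fin n → Matrix (Fin 2) (Fin 2) ℂ) : QubitOp n :=
  Matrix.of fun a b => ∏ i, U i (a i) (b i)

/-- The single-qubit operator `u` acting on qubit `i`, and the identity on all others. -/
def onQubit {n : ℕ} (i : Fin n) (u : Matrix (Fin 2) (Fin 2) ℂ) : QubitOp n :=
  tensorOp fun j => if j = i then u else 1

/-- The Hadamard gate. -/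
def gateH : Matrix (Fin 2) (Fin 2) ℂ := ((1 / Real.sqrt 2 : ℝ) : ℂ) • !![1, 1; 1, -1]

/-- The phase gate. -/
def gateS : Matrix (Fin 2) (Fin 2) ℂ := !![1, 0; 0, Complex.I]

/-- The single-qubit Pauli matrices `I, X, Y, Z`. -/
def pauliMatrix : Fin 4 → Matrix (Fin 2) (Fin 2) ℂ :=
  ![1, !![0, 1; 1, 0], !![0, -Complex.I; Complex.I, 0], !![1, 0; 0, -1]]

/-- The Pauli observable `P 0 ⊗ P 1 ⊗ ⋯`. -/
def pauliOp {n : ℕ} (P : Fin n → Fin 4) : QubitOp n :=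
  tensorOp fun i => pauliMatrix (P i)

/-- The weight `|P|`: the number of qubits on which `P` acts nontrivially. -/
def pauliWeight {n : ℕ} (P : Fin n → Fin 4) : ℕ :=
  (Finset.univ.filter fun i => P i ≠ 0).card

/-- The coefficient `α_P = Tr(P O) / 2 ^ n` in the Pauli expansion `O = ∑ P, α_P P`. -/
def pauliCoeff {n : ℕ} (O : QubitOp n) (P : Fin n → Fin 4) : ℂ :=
  (pauliOp P * O).trace / 2 ^ n

/-- The weight-`k` truncation `∑_{|P| ≤ k} α_P P` of `O`. -/
def lowDegree {n : ℕ} (k : ℕ) (O : QubitOp n) : QubitOp n :=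
  ∑ P : Fin n → Fin 4 with pauliWeight P ≤ k, pauliCoeff O P • pauliOp P

/-- The spectral (ℓ² operator) norm. -/
def specNorm {n : ℕ} (O : QubitOp n) : ℝ := ‖Matrix.toEuclideanCLM (𝕜 := ℂ) O‖

/-- The expectation value `Tr(O ρ)`, which is real for an observable and a state. -/
def expVal {n : ℕ} (O : Observable n) (ρ : QState n) : ℝ := (O.1 * ρ.1).trace.re

/-- If `ρ` is distributed as `D`, then `U ρ U†` is distributed as `D`. -/
def InvariantUnder {n : ℕ} (D : Measure (QState n)) (U : QubitOp n) : Prop :=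
  D.map (fun ρ : QState n => U * ρ.1 * U.conjTranspose) = D.map (fun ρ : QState n => ρ.1)

/-- Invariance under the `H` and `S` gates on each single qubit. -/
def InvariantUnderHS {n : ℕ} (D : Measure (QState n)) : Prop :=
  ∀ i : Fin n, InvariantUnder D (onQubit i gateH) ∧ InvariantUnder D (onQubit i gateS)

/-- The clipped linear predictor `h(ρ) = max(-Θ, min(Θ, Tr(Ô ρ)))` of the model `(Ô, Θ)`. -/
def predict {n : ℕ} (m : Observable n × ℝ) (ρ : QState n) : ℝ :=
  max (-m.2) (min m.2 (expVal m.1 ρ))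

/-- The training data `(ρ_ℓ, Tr(O ρ_ℓ))`, `ℓ = 1, …, N`. -/
def trainingData {n N : ℕ} (O : Observable n) (ρs : Fin N → QState n) :
    Fin N → QState n × ℝ :=
  fun l => (ρs l, expVal O (ρs l))

/-- The mean squared prediction error `E_{ρ ∼ D} |h(ρ) - Tr(O ρ)|²` of the model `m`. -/
def predictionError {n : ℕ} (D : Measure (QState n)) (O : Observable n)
    (m : Observable n × ℝ) : ℝ :=
  ∫ ρ, |predict m ρ - expVal O ρ| ^ 2 ∂D

/-- The truncation weight `k = ⌈log_{1.5}(1/ε)⌉`. -/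
def truncWeight (ε : ℝ) : ℕ := ⌈Real.logb 1.5 (1 / ε)⌉₊

/-- The exponent `r = 2k/(k+1)`. -/
def bhExponent (k : ℕ) : ℝ := 2 * (k : ℝ) / ((k : ℝ) + 1)

end

/-!
The second moments of the Pauli expectation values `t_P(ρ) = Tr(P ρ)` under a distribution invariant
under single-qubit `H` and `S` gates are diagonal (`pauliMoment_eq_zero`), so the mean squared error
of `∑ â_P P` is `∑ (â_P - α_P)² w_P` with `w_P = E t_P²`. Moreover `w_P ≤ (2/3) ^ |P|`
(`pauliMoment_self_le`), because `w_P` depends only on the support of `P` and the purity of reduced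
states bounds the sum over a support. Hence weights above `k` cost at most
`(2/3) ^ (k + 1) ‖O‖² ≤ (2/3) ε ‖O‖²`. The correlations `E Tr(O ρ) t_P = α_P w_P` and the moments
`w_P` of all operators of weight at most `d` are estimated simultaneously from `O(log (n / δ))`
samples up to a factor that depends on the accuracy and on `d` (`measure_inaccurate_le`).

Keeping all these estimates gives the sample size with `log (1 / ε) log n` in the exponent
(`exists_learner_of_dimension_bound`). For a sample size in which `n` occurs only in `log (n / δ)`,
only the `K` largest estimates are kept (`sparseCoeff`); ranking instead of thresholding makes the
rule independent of the unknown `‖O‖`. What is left out are coefficients of size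
`O(‖O‖ / √K)`, and their total `ℓ²` weight is controlled by a dimension-free inequality that takes
the place of a Bohnenblust-Hille inequality. On product states the truncated observable is a
multilinear polynomial of degree at most `k` in the Bloch vectors, bounded by its spectral norm. At
every point the `ℓ¹` norm of its gradient is at most `2 ^ O(k)` times that norm, since it is a
directional derivative of a bounded polynomial (`abs_coeff_one_le`), and hypercontractivity turns
this into a bound for the sum of the square roots of the influences (`sum_sqrtInfluence_le`).
Therefore the variables of small influence carry little weight, and the few remaining variables
support few monomials of degree at most `d`, whose small coefficients also carry little weight
(`sum_small_coeff_sq_le`). The exponent `r = 2k/(k+1)` arises from balancing the two contributions.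
Choosing the degree cutoff `d` as the minimum of `k` and `O(log (1 / ε'))` keeps the sample size
within the required bound (`exists_learner_of_sparsity_bound`).

When `ε + ε' ≥ 1` the zero predictor suffices. When `ε` is close to `1` the sample size may be as
small as `log (n / δ)`, and a constant predictor, the mean of the labels multiplied by a small
constant, improves on the trivial error by a constant factor (`meanLearner_guarantee`).
-/

/-! ### Tensor products and Pauli operators -/

section TensorAlgebra

variable {n : ℕ}

lemma sum_pi_prod {κ R : Type*} [Fintype κ] [CommSemiring R] (f : Fin n → κ → R) :
    ∑ c : Fin n → κ, ∏ i, f i (c i) = ∏ i, ∑ q, f i q := by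
  classical
  rw [Finset.prod_univ_sum, Fintype.piFinset_univ]

lemma tensorOp_mul (A B : Fin n → Matrix (Fin 2) (Fin 2) ℂ) :
    tensorOp A * tensorOp B = tensorOp fun i => A i * B i := by
  ext a b
  simp only [tensorOp, Matrix.mul_apply, Matrix.of_apply, ← Finset.prod_mul_distrib]
  exact sum_pi_prod fun i c => A i (a i) c * B i c (b i)

lemma tensorOp_conjTranspose (A : Fin n → Matrix (Fin 2) (Fin 2) ℂ) :
    (tensorOp A).conjTranspose = tensorOp fun i => (A i).conjTranspose := by
  ext a b
  simp [tensorOp, Matrix.conjTranspose_apply]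

lemma tensorOp_one : tensorOp (fun _ : Fin n => (1 : Matrix (Fin 2) (Fin 2) ℂ)) = 1 := by
  ext a b
  simp only [tensorOp, Matrix.of_apply, Matrix.one_apply]
  by_cases h : a = b
  · simp [h]
  · obtain ⟨i, hi⟩ := Function.ne_iff.mp h
    rw [if_neg h]
    exact Finset.prod_eq_zero (Finset.mem_univ i) (if_neg hi)

lemma trace_tensorOp (A : Fin n → Matrix (Fin 2) (Fin 2) ℂ) :
    (tensorOp A).trace = ∏ i, (A i).trace := by
  simp only [tensorOp, Matrix.trace, Matrix.diag_apply, Matrix.of_apply]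
  exact sum_pi_prod fun i c => A i c c

lemma Matrix.PosSemidef.exists_eq_conjTranspose_mul_self {ι : Type*} [Fintype ι] [DecidableEq ι]
    {A : Matrix ι ι ℂ} (h : A.PosSemidef) : ∃ B : Matrix ι ι ℂ, A = B.conjTranspose * B := by
  open scoped MatrixOrder Matrix.Norms.L2Operator in
  exact CStarAlgebra.nonneg_iff_eq_star_mul_self.mp h.nonneg

lemma tensorOp_posSemidef {A : Fin n → Matrix (Fin 2) (Fin 2) ℂ} (h : ∀ i, (A i).PosSemidef) :
    (tensorOp A).PosSemidef := by
  have h' : ∀ i, ∃ B : Matrix (Fin 2) (Fin 2) ℂ, A i = B.conjTranspose * B :=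
    fun i => (h i).exists_eq_conjTranspose_mul_self
  choose B hB using h'
  have : tensorOp A = (tensorOp B).conjTranspose * tensorOp B := by
    rw [tensorOp_conjTranspose, tensorOp_mul]
    congr 1
    funext i
    exact hB i
  rw [this]
  exact Matrix.posSemidef_conjTranspose_mul_self _

lemma pauliMatrix_conjTranspose (q : Fin 4) : (pauliMatrix q).conjTranspose = pauliMatrix q := by
  fin_cases q <;> ext a b <;> fin_cases a <;> fin_cases b <;>
    simp [pauliMatrix, Matrix.conjTranspose_apply]

lemma pauliMatrix_mul_self (q : Fin 4) : pauliMatrix q * pauliMatrix q = 1 := by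
  fin_cases q <;> ext a b <;> fin_cases a <;> fin_cases b <;>
    simp [pauliMatrix, Matrix.mul_apply, Fin.sum_univ_two]

lemma pauliOp_isHermitian (P : Fin n → Fin 4) : (pauliOp P).IsHermitian := by
  simp only [Matrix.IsHermitian, pauliOp, tensorOp_conjTranspose, pauliMatrix_conjTranspose]

lemma pauliOp_mul_self (P : Fin n → Fin 4) : pauliOp P * pauliOp P = 1 := by
  simp only [pauliOp, tensorOp_mul, pauliMatrix_mul_self, tensorOp_one]

/-- The single-qubit swap identity `∑_σ σ ⊗ σ = 2 • SWAP`, entrywise. -/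
lemma sum_pauliMatrix_mul (a b c d : Fin 2) :
    ∑ q : Fin 4, pauliMatrix q a b * pauliMatrix q c d = if a = d ∧ b = c then 2 else 0 := by
  fin_cases a <;> fin_cases b <;> fin_cases c <;> fin_cases d <;>
    simp [Fin.sum_univ_four, pauliMatrix] <;> norm_num

/-- The swap identity on a subset of the qubits, entrywise. -/
lemma sum_pauliOp_mul (S : Finset (Fin n)) (a b c d : Fin n → Fin 2) :
    ∑ Q ∈ Fintype.piFinset fun i => if i ∈ S then Finset.univ else {(0 : Fin 4)},
        pauliOp Q a b * pauliOp Q c d =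
      if a = (fun i => if i ∈ S then d i else b i) ∧ c = (fun i => if i ∈ S then b i else d i)
        then 2 ^ S.card else 0 := by
  have h1 : ∀ i, (∑ q ∈ (if i ∈ S then Finset.univ else {(0 : Fin 4)}),
      pauliMatrix q (a i) (b i) * pauliMatrix q (c i) (d i)) =
      if a i = (if i ∈ S then d i else b i) ∧ c i = (if i ∈ S then b i else d i) then
        (if i ∈ S then 2 else 1) else 0 := by
    intro i
    by_cases hi : i ∈ S
    · simp only [hi, if_true, sum_pauliMatrix_mul]
      simp only [eq_comm (a := b i)]
    · simp only [hi, if_false, Finset.sum_singleton]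
      simp only [pauliMatrix, Matrix.cons_val_zero, Matrix.one_apply]
      by_cases h2 : a i = b i <;> by_cases h3 : c i = d i <;> simp [h2, h3]
  simp only [pauliOp, tensorOp, Matrix.of_apply, ← Finset.prod_mul_distrib]
  rw [← Finset.prod_univ_sum (fun i => if i ∈ S then Finset.univ else {(0 : Fin 4)})
    (fun i q => pauliMatrix q (a i) (b i) * pauliMatrix q (c i) (d i))]
  simp only [h1]
  split_ifs with h
  · obtain ⟨ha, hc⟩ := h
    have : ∀ i, a i = (if i ∈ S then d i else b i) ∧ c i = (if i ∈ S then b i else d i) :=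
      fun i => ⟨congrFun ha i, congrFun hc i⟩
    simp only [this, and_self, if_true]
    rw [Finset.prod_ite]
    simp
  · have : ∃ i, ¬ (a i = (if i ∈ S then d i else b i) ∧ c i = (if i ∈ S then b i else d i)) := by
      by_contra! hcon
      exact h ⟨funext fun i => (hcon i).1, funext fun i => (hcon i).2⟩
    obtain ⟨i, hi⟩ := this
    exact Finset.prod_eq_zero (Finset.mem_univ i) (if_neg hi)

/-- The Pauli expansion of an operator. -/
lemma sum_pauliCoeff_smul (O : QubitOp n) : ∑ P, pauliCoeff O P • pauliOp P = O := by
  ext a b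
  have key : ∀ c d : Fin n → Fin 2, ∑ Q : Fin n → Fin 4, pauliOp Q a b * pauliOp Q c d =
      if a = d ∧ c = b then 2 ^ n else 0 := by
    intro c d
    have := sum_pauliOp_mul Finset.univ a b c d
    simpa using this
  simp only [Matrix.sum_apply, Matrix.smul_apply, smul_eq_mul, pauliCoeff, Matrix.trace,
    Matrix.diag_apply, Matrix.mul_apply]
  have h2 : (2 : ℂ) ^ n ≠ 0 := by positivity
  calc ∑ P : Fin n → Fin 4, (∑ c, ∑ d, pauliOp P c d * O d c) / 2 ^ n * pauliOp P a b
      = ∑ c, ∑ d, (∑ P : Fin n → Fin 4, pauliOp P a b * pauliOp P c d) * O d c / 2 ^ n := by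
        simp only [Finset.sum_div, Finset.sum_mul]
        rw [Finset.sum_comm]
        refine Finset.sum_congr rfl fun c _ => ?_
        rw [Finset.sum_comm]
        refine Finset.sum_congr rfl fun d _ => Finset.sum_congr rfl fun P _ => ?_
        ring
    _ = O a b := by
        simp only [key, ite_and, ite_mul, zero_mul]
        simp [Finset.sum_ite_eq, h2, ite_div]

/-- `Tr(P O)` and `Tr(P ρ)` are real for Hermitian arguments. -/
lemma pauliOp_trace_im {A : QubitOp n} (hA : A.IsHermitian) (P : Fin n → Fin 4) :
    (pauliOp P * A).trace.im = 0 := by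
  have h : star (pauliOp P * A).trace = (pauliOp P * A).trace := by
    rw [← Matrix.trace_conjTranspose, Matrix.conjTranspose_mul, hA.eq,
      (pauliOp_isHermitian P).eq, Matrix.trace_mul_comm]
  exact Complex.conj_eq_iff_im.mp h

end TensorAlgebra

/-! ### Bounds by the spectral norm -/

section SpectralNorm

variable {n : ℕ}

lemma specNorm_nonneg (O : QubitOp n) : 0 ≤ specNorm O := norm_nonneg _

lemma norm_toLp_mulVec_le (O : QubitOp n) (v : (Fin n → Fin 2) → ℂ) :
    ‖WithLp.toLp 2 (O.mulVec v)‖ ≤ specNorm O * ‖WithLp.toLp 2 v‖ := by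
  rw [← Matrix.toEuclideanCLM_toLp]
  exact ContinuousLinearMap.le_opNorm _ _

lemma specNorm_pauliOp_le (P : Fin n → Fin 4) : specNorm (pauliOp P) ≤ 1 := by
  have h : ‖Matrix.toEuclideanCLM (𝕜 := ℂ) (pauliOp P)‖ *
      ‖Matrix.toEuclideanCLM (𝕜 := ℂ) (pauliOp P)‖ = 1 := by
    rw [← CStarRing.norm_star_mul_self, ← map_star, ← map_mul, Matrix.star_eq_conjTranspose,
      (pauliOp_isHermitian P).eq, pauliOp_mul_self, map_one, norm_one]
  have := specNorm_nonneg (pauliOp P)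
  unfold specNorm at *
  nlinarith

/-- `|Tr(O ρ)| ≤ ‖O‖ Tr ρ` for positive semidefinite `ρ`. -/
lemma norm_trace_mul_le (O : QubitOp n) {ρ : QubitOp n} (hρ : ρ.PosSemidef) :
    ‖(O * ρ).trace‖ ≤ specNorm O * ρ.trace.re := by
  obtain ⟨B, hB⟩ := hρ.exists_eq_conjTranspose_mul_self
  let v : (Fin n → Fin 2) → (Fin n → Fin 2) → ℂ := fun i j => star (B i j)
  have h1 : (O * ρ).trace =
      ∑ i, inner ℂ (WithLp.toLp 2 (v i)) (WithLp.toLp 2 (O.mulVec (v i))) := by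
    rw [hB, ← mul_assoc, Matrix.trace_mul_comm]
    refine Finset.sum_congr rfl fun i _ => ?_
    rw [EuclideanSpace.inner_eq_star_dotProduct]
    simp only [Matrix.diag_apply, Matrix.mul_apply, dotProduct, Matrix.mulVec, v,
      Matrix.conjTranspose_apply, Pi.star_apply, star_star]
    refine Finset.sum_congr rfl fun j _ => ?_
    rw [mul_comm]
  have h2 : ρ.trace.re = ∑ i, ‖WithLp.toLp 2 (v i)‖ ^ 2 := by
    rw [hB, Matrix.trace_mul_comm]
    simp only [Matrix.trace, Matrix.diag_apply, Matrix.mul_apply, Matrix.conjTranspose_apply,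
      Complex.re_sum, EuclideanSpace.norm_sq_eq, v]
    refine Finset.sum_congr rfl fun i _ => Finset.sum_congr rfl fun j _ => ?_
    rw [norm_star, Complex.star_def, Complex.mul_conj, Complex.normSq_eq_norm_sq,
      Complex.ofReal_re]
  rw [h1, h2, Finset.mul_sum]
  refine (norm_sum_le _ _).trans (Finset.sum_le_sum fun i _ => ?_)
  refine (norm_inner_le_norm _ _).trans ?_
  have := norm_toLp_mulVec_le O (v i)
  nlinarith [norm_nonneg (WithLp.toLp 2 (v i))]

lemma abs_re_trace_mul_le (O : QubitOp n) (ρ : QState n) : |(O * ρ.1).trace.re| ≤ specNorm O := by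
  refine (Complex.abs_re_le_norm _).trans ?_
  simpa [ρ.2.2] using norm_trace_mul_le O ρ.2.1

lemma abs_expVal_le (O : Observable n) (ρ : QState n) : |expVal O ρ| ≤ specNorm O.1 :=
  abs_re_trace_mul_le O.1 ρ

/-- The real Pauli coefficients of an observable. -/
noncomputable def realCoeff (O : QubitOp n) (P : Fin n → Fin 4) : ℝ := (pauliCoeff O P).re

/-- The Pauli expectation value `Tr(P ρ)` of a state. -/
noncomputable def pauliVal (P : Fin n → Fin 4) (ρ : QState n) : ℝ := (pauliOp P * ρ.1).trace.re

lemma abs_pauliVal_le (P : Fin n → Fin 4) (ρ : QState n) : |pauliVal P ρ| ≤ 1 :=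
  (abs_re_trace_mul_le _ ρ).trans (specNorm_pauliOp_le P)

lemma pauliCoeff_eq_realCoeff {O : QubitOp n} (hO : O.IsHermitian) (P : Fin n → Fin 4) :
    pauliCoeff O P = (realCoeff O P : ℂ) := by
  have h : (pauliCoeff O P).im = 0 := by
    have h2 : (2 : ℂ) ^ n = ((2 ^ n : ℝ) : ℂ) := by push_cast; rfl
    rw [pauliCoeff, h2, Complex.div_ofReal_im, pauliOp_trace_im hO, zero_div]
  apply Complex.ext <;> simp [realCoeff, h]

lemma expVal_eq_sum (O : Observable n) (ρ : QState n) :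
    expVal O ρ = ∑ P, realCoeff O.1 P * pauliVal P ρ := by
  rw [expVal]
  conv_lhs => rw [← sum_pauliCoeff_smul O.1]
  rw [Finset.sum_mul, Matrix.trace_sum, Complex.re_sum]
  refine Finset.sum_congr rfl fun P _ => ?_
  rw [pauliCoeff_eq_realCoeff O.2, Matrix.smul_mul, Matrix.trace_smul, smul_eq_mul,
    Complex.re_ofReal_mul, pauliVal]

/-- Parseval: the squared Pauli coefficients sum to the normalized Hilbert-Schmidt norm, which is
at most the squared spectral norm. -/
lemma sum_realCoeff_sq_le {O : QubitOp n} (hO : O.IsHermitian) :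
    ∑ P, realCoeff O P ^ 2 ≤ specNorm O ^ 2 := by
  have h2 : (0 : ℝ) < 2 ^ n := by positivity
  have h1 : (∑ P, realCoeff O P ^ 2) * 2 ^ n = (O * O).trace.re := by
    conv_rhs => rw [← sum_pauliCoeff_smul O]
    conv_rhs => enter [1, 1, 2]; rw [sum_pauliCoeff_smul O]
    rw [Finset.sum_mul, Finset.sum_mul, Matrix.trace_sum, Complex.re_sum]
    refine Finset.sum_congr rfl fun P _ => ?_
    have h3 : (pauliOp P * O).trace = (realCoeff O P : ℂ) * 2 ^ n := by
      rw [← pauliCoeff_eq_realCoeff hO, pauliCoeff, div_mul_cancel₀]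
      positivity
    rw [Matrix.smul_mul, Matrix.trace_smul, smul_eq_mul, pauliCoeff_eq_realCoeff hO, h3]
    have h4 : (2 : ℂ) ^ n = ((2 ^ n : ℝ) : ℂ) := by push_cast; rfl
    rw [h4, ← Complex.ofReal_mul, ← Complex.ofReal_mul, Complex.ofReal_re]
    ring
  have h3 : (O * O).trace.re ≤ 2 ^ n * specNorm O ^ 2 := by
    have h4 : ∀ a, (O * O).diag a = ((‖WithLp.toLp 2 (O.mulVec (Pi.single a 1))‖ ^ 2 : ℝ) : ℂ) := by
      intro a
      simp only [Matrix.diag_apply, Matrix.mul_apply, EuclideanSpace.norm_sq_eq]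
      push_cast
      refine Finset.sum_congr rfl fun b _ => ?_
      rw [Matrix.mulVec_single_one, Matrix.col_apply, ← hO.apply a b, Complex.star_def,
        Complex.conj_mul']
    have h5 : ∀ a, ‖WithLp.toLp 2 (O.mulVec (Pi.single a 1))‖ ^ 2 ≤ specNorm O ^ 2 := by
      intro a
      have := norm_toLp_mulVec_le O (Pi.single a 1)
      have h6 : ‖WithLp.toLp 2 (Pi.single a 1 : (Fin n → Fin 2) → ℂ)‖ = 1 := by
        simp
      rw [h6, mul_one] at this
      gcongr
    rw [Matrix.trace, Complex.re_sum]
    calc ∑ a, ((O * O).diag a).re ≤ ∑ _a : Fin n → Fin 2, specNorm O ^ 2 :=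
          Finset.sum_le_sum fun a _ => by rw [h4, Complex.ofReal_re]; exact h5 a
      _ = 2 ^ n * specNorm O ^ 2 := by simp
  nlinarith

/-- Cauchy-Schwarz for the entries of a positive semidefinite matrix. -/
lemma norm_sq_entry_le {ρ : QubitOp n} (hρ : ρ.PosSemidef) (x z : Fin n → Fin 2) :
    ‖ρ x z‖ ^ 2 ≤ (ρ x x).re * (ρ z z).re := by
  obtain ⟨B, hB⟩ := hρ.exists_eq_conjTranspose_mul_self
  have h1 : ∀ x z, ρ x z = inner ℂ (WithLp.toLp 2 (B.col x)) (WithLp.toLp 2 (B.col z)) := by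
    intro x z
    rw [EuclideanSpace.inner_eq_star_dotProduct, hB]
    simp only [Matrix.mul_apply, dotProduct, Matrix.conjTranspose_apply, Matrix.col_apply,
      Pi.star_apply]
    exact Finset.sum_congr rfl fun j _ => mul_comm _ _
  have h2 : ∀ x, (ρ x x).re = ‖WithLp.toLp 2 (B.col x)‖ ^ 2 := by
    intro x
    rw [h1, inner_self_eq_norm_sq_to_K]
    norm_cast
  rw [h1, h2, h2, ← mul_pow]
  gcongr
  exact norm_inner_le_norm _ _

/-- The purity bound: the Pauli expectation values of a state over the Pauli operators supported
in `S` have squares summing to at most `2 ^ |S|`. By the swap identity the sum is `2 ^ |S|` times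
the overlap of two copies of the state with a partial swap. -/
lemma sum_pauliVal_sq_le (S : Finset (Fin n)) (ρ : QState n) :
    ∑ Q ∈ Fintype.piFinset fun i => if i ∈ S then Finset.univ else {(0 : Fin 4)},
      pauliVal Q ρ ^ 2 ≤ 2 ^ S.card := by
  classical
  let mix : (Fin n → Fin 2) → (Fin n → Fin 2) → (Fin n → Fin 2) :=
    fun x y i => if i ∈ S then y i else x i
  set I := Fintype.piFinset fun i => if i ∈ S then Finset.univ else {(0 : Fin 4)}
  have hmix : ∀ x y, mix (mix x y) (mix y x) = x := by
    intro x y; funext i; by_cases hi : i ∈ S <;> simp [mix, hi]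
  -- the swap of the `S`-parts of two configurations
  let e : ((Fin n → Fin 2) × (Fin n → Fin 2)) ≃ ((Fin n → Fin 2) × (Fin n → Fin 2)) :=
    { toFun := fun p => (mix p.1 p.2, mix p.2 p.1)
      invFun := fun p => (mix p.1 p.2, mix p.2 p.1)
      left_inv := fun p => by simp [hmix]
      right_inv := fun p => by simp [hmix] }
  have h1 : ∑ Q ∈ I, pauliVal Q ρ ^ 2 = (∑ Q ∈ I, (pauliOp Q * ρ.1).trace ^ 2).re := by
    rw [Complex.re_sum]
    refine Finset.sum_congr rfl fun Q _ => ?_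
    have : (pauliOp Q * ρ.1).trace = (pauliVal Q ρ : ℂ) := by
      apply Complex.ext <;> simp [pauliVal, pauliOp_trace_im ρ.2.1.isHermitian]
    rw [this, ← Complex.ofReal_pow, Complex.ofReal_re]
  have h2 : ∑ Q ∈ I, (pauliOp Q * ρ.1).trace ^ 2 =
      ∑ p : (Fin n → Fin 2) × (Fin n → Fin 2),
        2 ^ S.card * (ρ.1 p.1 (mix p.1 p.2) * ρ.1 p.2 (mix p.2 p.1)) := by
    calc ∑ Q ∈ I, (pauliOp Q * ρ.1).trace ^ 2
        = ∑ Q ∈ I, ∑ b, ∑ d, ∑ a, ∑ c,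
            (pauliOp Q a b * pauliOp Q c d) * (ρ.1 b a * ρ.1 d c) := by
          refine Finset.sum_congr rfl fun Q _ => ?_
          have : (pauliOp Q * ρ.1).trace = ∑ b, ∑ a, pauliOp Q a b * ρ.1 b a := by
            simp only [Matrix.trace, Matrix.diag_apply, Matrix.mul_apply]
            exact Finset.sum_comm
          rw [this, sq, Finset.sum_mul_sum]
          refine Finset.sum_congr rfl fun b _ => Finset.sum_congr rfl fun d _ => ?_
          rw [Finset.sum_mul_sum]
          refine Finset.sum_congr rfl fun a _ => Finset.sum_congr rfl fun c _ => ?_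
          ring
      _ = ∑ b, ∑ d, ∑ a, ∑ c,
            (∑ Q ∈ I, pauliOp Q a b * pauliOp Q c d) * (ρ.1 b a * ρ.1 d c) := by
          rw [Finset.sum_comm]
          refine Finset.sum_congr rfl fun b _ => ?_
          rw [Finset.sum_comm]
          refine Finset.sum_congr rfl fun d _ => ?_
          rw [Finset.sum_comm]
          refine Finset.sum_congr rfl fun a _ => ?_
          rw [Finset.sum_comm]
          refine Finset.sum_congr rfl fun c _ => ?_
          rw [Finset.sum_mul]
      _ = _ := by
          rw [Fintype.sum_prod_type]
          refine Finset.sum_congr rfl fun b _ => Finset.sum_congr rfl fun d _ => ?_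
          simp only [I, sum_pauliOp_mul, ite_and, ite_mul, zero_mul]
          simp [mix]
  have h3 : ∑ p : (Fin n → Fin 2) × (Fin n → Fin 2), (ρ.1 p.1 p.1).re * (ρ.1 p.2 p.2).re = 1 := by
    rw [Fintype.sum_prod_type]
    have : ∑ x, (ρ.1 x x).re = 1 := by
      have := congrArg Complex.re ρ.2.2
      simpa [Matrix.trace] using this
    simp only [← Finset.mul_sum, this, mul_one]
  have h4 : ∑ p : (Fin n → Fin 2) × (Fin n → Fin 2),
      (ρ.1 (mix p.1 p.2) (mix p.1 p.2)).re * (ρ.1 (mix p.2 p.1) (mix p.2 p.1)).re = 1 := by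
    rw [← h3]
    exact Equiv.sum_comp e fun p => (ρ.1 p.1 p.1).re * (ρ.1 p.2 p.2).re
  rw [h1, h2]
  refine (Complex.re_le_norm _).trans ((norm_sum_le _ _).trans ?_)
  have h5 : ∀ p : (Fin n → Fin 2) × (Fin n → Fin 2),
      ‖(2 : ℂ) ^ S.card * (ρ.1 p.1 (mix p.1 p.2) * ρ.1 p.2 (mix p.2 p.1))‖ ≤
      2 ^ S.card * (((ρ.1 p.1 p.1).re * (ρ.1 p.2 p.2).re +
        (ρ.1 (mix p.1 p.2) (mix p.1 p.2)).re * (ρ.1 (mix p.2 p.1) (mix p.2 p.1)).re) / 2) := by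
    intro p
    rw [norm_mul, norm_pow, norm_mul]
    have e1 := norm_sq_entry_le ρ.2.1 p.1 (mix p.1 p.2)
    have e2 := norm_sq_entry_le ρ.2.1 p.2 (mix p.2 p.1)
    have hd : ∀ x, 0 ≤ (ρ.1 x x).re := fun x => by
      have := ρ.2.1.diag_nonneg (i := x)
      exact (Complex.le_def.mp this).1
    have h2 : ‖(2 : ℂ)‖ = 2 := by simp
    rw [h2]
    refine mul_le_mul_of_nonneg_left ?_ (by positivity)
    have p1 := hd p.1
    have p2 := hd p.2
    have p3 := hd (mix p.1 p.2)
    have p4 := hd (mix p.2 p.1)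
    refine abs_le_of_sq_le_sq' ?_ (by positivity) |>.2
    have : (‖ρ.1 p.1 (mix p.1 p.2)‖ * ‖ρ.1 p.2 (mix p.2 p.1)‖) ^ 2 ≤
        ((ρ.1 p.1 p.1).re * (ρ.1 (mix p.1 p.2) (mix p.1 p.2)).re) *
          ((ρ.1 p.2 p.2).re * (ρ.1 (mix p.2 p.1) (mix p.2 p.1)).re) := by
      rw [mul_pow]
      gcongr
    refine this.trans ?_
    nlinarith [sq_nonneg ((ρ.1 p.1 p.1).re * (ρ.1 p.2 p.2).re -
      (ρ.1 (mix p.1 p.2) (mix p.1 p.2)).re * (ρ.1 (mix p.2 p.1) (mix p.2 p.1)).re)]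
  refine (Finset.sum_le_sum fun p _ => h5 p).trans ?_
  rw [← Finset.mul_sum, ← Finset.sum_div, Finset.sum_add_distrib, h3, h4]
  norm_num

end SpectralNorm

/-! ### Second moments of the Pauli expectation values -/

section Moments

variable {n : ℕ}

lemma measurable_pauliVal (P : Fin n → Fin 4) : Measurable (pauliVal (n := n) P) := by
  have h : Continuous fun A : QubitOp n => (pauliOp P * A).trace.re := by fun_prop
  exact h.measurable.comp measurable_subtype_coe

lemma measurable_expVal (O : Observable n) : Measurable (expVal O) := by
  have h : Continuous fun A : QubitOp n => (O.1 * A).trace.re := by fun_prop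
  exact h.measurable.comp measurable_subtype_coe

/-- The second moment `E Tr(P ρ) Tr(Q ρ)`. -/
noncomputable def pauliMoment (D : Measure (QState n)) (P Q : Fin n → Fin 4) : ℝ :=
  ∫ ρ, pauliVal P ρ * pauliVal Q ρ ∂D

lemma pauliMoment_comm (D : Measure (QState n)) (P Q : Fin n → Fin 4) :
    pauliMoment D P Q = pauliMoment D Q P := by
  simp only [pauliMoment, mul_comm]

lemma integrable_of_abs_le {Ω : Type*} [MeasurableSpace Ω] {μ : Measure Ω} [IsFiniteMeasure μ]
    {f : Ω → ℝ} (hf : Measurable f) (C : ℝ) (h : ∀ x, |f x| ≤ C) : Integrable f μ :=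
  Integrable.of_bound hf.aestronglyMeasurable C (Filter.Eventually.of_forall h)

lemma integrable_pauliVal_mul (D : Measure (QState n)) [IsFiniteMeasure D]
    (P Q : Fin n → Fin 4) : Integrable (fun ρ => pauliVal P ρ * pauliVal Q ρ) D := by
  refine integrable_of_abs_le ((measurable_pauliVal P).mul (measurable_pauliVal Q)) 1 fun ρ => ?_
  rw [abs_mul]
  exact mul_le_one₀ (abs_pauliVal_le P ρ) (abs_nonneg _) (abs_pauliVal_le Q ρ)

/-- A single-qubit gate that maps Pauli matrices to signed Pauli matrices does so on every qubit of
a Pauli operator. -/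
lemma onQubit_conj_pauliOp {u : Matrix (Fin 2) (Fin 2) ℂ} {s : Fin 4 → ℝ} {π : Fin 4 → Fin 4}
    (hu : ∀ q, u.conjTranspose * pauliMatrix q * u = (s q : ℂ) • pauliMatrix (π q))
    (i : Fin n) (P : Fin n → Fin 4) :
    (onQubit i u).conjTranspose * pauliOp P * onQubit i u =
      (s (P i) : ℂ) • pauliOp (Function.update P i (π (P i))) := by
  rw [onQubit, pauliOp, tensorOp_conjTranspose, tensorOp_mul, tensorOp_mul]
  ext a b
  simp only [tensorOp, Matrix.smul_apply, Matrix.of_apply, pauliOp, smul_eq_mul]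
  rw [← Finset.mul_prod_erase _ _ (Finset.mem_univ i), ← Finset.mul_prod_erase _ _
    (Finset.mem_univ i), ← mul_assoc]
  congr 1
  · simp [hu]
  · refine Finset.prod_congr rfl fun j hj => ?_
    have hji : j ≠ i := Finset.ne_of_mem_erase hj
    simp [hji]

/-- Invariance under a single-qubit gate that permutes the Pauli matrices up to signs. -/
lemma pauliMoment_eq_of_invariant {D : Measure (QState n)} {u : Matrix (Fin 2) (Fin 2) ℂ}
    {s : Fin 4 → ℝ} {π : Fin 4 → Fin 4}
    (hu : ∀ q, u.conjTranspose * pauliMatrix q * u = (s q : ℂ) • pauliMatrix (π q))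
    {i : Fin n} (hD : InvariantUnder D (onQubit i u)) (P Q : Fin n → Fin 4) :
    pauliMoment D P Q = s (P i) * s (Q i) *
      pauliMoment D (Function.update P i (π (P i))) (Function.update Q i (π (Q i))) := by
  let g : QubitOp n → ℝ := fun A => (pauliOp P * A).trace.re * (pauliOp Q * A).trace.re
  have hg : Continuous g := by fun_prop
  have hU : Continuous fun A : QubitOp n => onQubit i u * A * (onQubit i u).conjTranspose := by
    fun_prop
  have h1 : ∫ A, g A ∂(D.map fun ρ : QState n => ρ.1) = pauliMoment D P Q :=
    integral_map measurable_subtype_coe.aemeasurable hg.aestronglyMeasurable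
  have h2 : ∫ A, g A ∂(D.map fun ρ : QState n =>
      onQubit i u * ρ.1 * (onQubit i u).conjTranspose) =
      ∫ ρ : QState n, g (onQubit i u * ρ.1 * (onQubit i u).conjTranspose) ∂D :=
    integral_map (hU.measurable.comp measurable_subtype_coe).aemeasurable hg.aestronglyMeasurable
  rw [← h1, ← hD, h2, pauliMoment, ← integral_const_mul]
  refine integral_congr_ae (Filter.Eventually.of_forall fun ρ => ?_)
  have h3 : ∀ P : Fin n → Fin 4,
      (pauliOp P * (onQubit i u * ρ.1 * (onQubit i u).conjTranspose)).trace.re =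
      s (P i) * pauliVal (Function.update P i (π (P i))) ρ := by
    intro P
    rw [← mul_assoc, Matrix.trace_mul_comm, ← mul_assoc, ← mul_assoc, onQubit_conj_pauliOp hu,
      Matrix.smul_mul, Matrix.trace_smul, smul_eq_mul, Complex.re_ofReal_mul, pauliVal]
  simp only [g, h3]
  ring

/-- The sign picked up by a Pauli matrix when conjugated by the Hadamard gate. -/
def signH : Fin 4 → ℝ := ![1, 1, -1, 1]

/-- The permutation of the Pauli matrices induced by the Hadamard gate, up to signs. -/
def permH : Fin 4 → Fin 4 := ![0, 3, 2, 1]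

/-- The sign picked up by a Pauli matrix when conjugated by the inverse phase gate. -/
def signS : Fin 4 → ℝ := ![1, -1, 1, 1]

/-- The permutation of the Pauli matrices induced by the phase gate, up to signs. -/
def permS : Fin 4 → Fin 4 := ![0, 2, 1, 3]

lemma gateH_conj (q : Fin 4) : gateH.conjTranspose * pauliMatrix q * gateH =
    (signH q : ℂ) • pauliMatrix (permH q) := by
  have h2 : ((Real.sqrt 2 : ℝ) : ℂ) * (Real.sqrt 2 : ℝ) = 2 := by
    rw [← Complex.ofReal_mul, Real.mul_self_sqrt (by norm_num)]; norm_num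
  have h3 : ((Real.sqrt 2 : ℝ) : ℂ)⁻¹ * ((Real.sqrt 2 : ℝ) : ℂ)⁻¹ = 1 / 2 := by
    rw [← mul_inv, h2]; norm_num
  have hH : gateH.conjTranspose * pauliMatrix q * gateH =
      (1 / 2 : ℂ) • (!![1, 1; 1, -1] * pauliMatrix q * !![1, 1; 1, -1]) := by
    have hc : (!![1, 1; 1, -1] : Matrix (Fin 2) (Fin 2) ℂ).conjTranspose = !![1, 1; 1, -1] := by
      ext a b; fin_cases a <;> fin_cases b <;> simp [Matrix.conjTranspose_apply]
    rw [gateH, Matrix.conjTranspose_smul, hc, Matrix.smul_mul, Matrix.smul_mul, Matrix.mul_smul,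
      smul_smul, Complex.star_def, Complex.conj_ofReal]
    push_cast
    rw [one_div, h3]
  rw [hH]
  fin_cases q <;> ext a b <;> fin_cases a <;> fin_cases b <;>
    simp [pauliMatrix, signH, permH] <;> ring

lemma gateS_conj (q : Fin 4) : gateS.conjTranspose * pauliMatrix q * gateS =
    (signS q : ℂ) • pauliMatrix (permS q) := by
  fin_cases q <;> ext a b <;> fin_cases a <;> fin_cases b <;>
    simp [pauliMatrix, gateS, signS, permS, Matrix.mul_apply, Fin.sum_univ_two,
      Matrix.conjTranspose_apply]

/-- Distinct Pauli expectation values are uncorrelated: on a qubit where the two operators differ,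
`S²` flips the sign of exactly one of them, possibly after `H`. -/
lemma pauliMoment_eq_zero {D : Measure (QState n)} (hD : InvariantUnderHS D)
    {P Q : Fin n → Fin 4} (hPQ : P ≠ Q) : pauliMoment D P Q = 0 := by
  obtain ⟨i, hi⟩ := Function.ne_iff.mp hPQ
  have hS := fun P Q => pauliMoment_eq_of_invariant gateS_conj (hD i).2 P Q
  have hH := fun P Q => pauliMoment_eq_of_invariant gateH_conj (hD i).1 P Q
  -- conjugation by `S²` negates `X` and `Y` and fixes `I` and `Z`
  have hSS : ∀ P Q : Fin n → Fin 4, (P i = 0 ∨ P i = 3) → (Q i = 1 ∨ Q i = 2) →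
      pauliMoment D P Q = 0 := by
    intro P Q hP hQ
    have h1 := hS P Q
    rw [hS (Function.update P i (permS (P i)))] at h1
    have e : ∀ P : Fin n → Fin 4, Function.update (Function.update P i (permS (P i))) i
        (permS (Function.update P i (permS (P i)) i)) = P := by
      intro P
      have : permS (permS (P i)) = P i := by
        generalize P i = q
        fin_cases q <;> rfl
      simp [this]
    rw [e, e] at h1
    rcases hP with hP | hP <;> rcases hQ with hQ | hQ <;>
      simp [hP, hQ, permS, signS] at h1 <;> linarith
  have hboth : ∀ P Q : Fin n → Fin 4, (P i = 0 ∧ Q i = 3) ∨ (P i = 1 ∧ Q i = 2) →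
      pauliMoment D P Q = 0 := by
    rintro P Q (⟨hP, hQ⟩ | ⟨hP, hQ⟩)
    · rw [hH, hSS _ _ (Or.inl (by simp [hP, permH])) (Or.inl (by simp [hQ, permH])), mul_zero]
    · rw [hH, hSS _ _ (Or.inr (by simp [hP, permH])) (Or.inr (by simp [hQ, permH])), mul_zero]
  rcases (by decide : ∀ p q : Fin 4, p ≠ q →
      ((p = 0 ∨ p = 3) ∧ (q = 1 ∨ q = 2)) ∨ ((q = 0 ∨ q = 3) ∧ (p = 1 ∨ p = 2)) ∨
      ((p = 0 ∧ q = 3) ∨ (p = 1 ∧ q = 2)) ∨ ((q = 0 ∧ p = 3) ∨ (q = 1 ∧ p = 2)))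
      (P i) (Q i) hi with h | h | h | h
  · exact hSS P Q h.1 h.2
  · rw [pauliMoment_comm]; exact hSS Q P h.1 h.2
  · exact hboth P Q h
  · rw [pauliMoment_comm]; exact hboth Q P h

/-- The weight `E Tr(P ρ)²` depends only on the support of `P`. -/
lemma pauliMoment_self_eq_of_support {D : Measure (QState n)} (hD : InvariantUnderHS D)
    {P Q : Fin n → Fin 4} (h : ∀ i, P i = 0 ↔ Q i = 0) :
    pauliMoment D P P = pauliMoment D Q Q := by
  have hS : ∀ i P, pauliMoment D P P = pauliMoment D (Function.update P i (permS (P i)))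
      (Function.update P i (permS (P i))) := by
    intro i P
    rw [pauliMoment_eq_of_invariant gateS_conj (hD i).2 P P]
    have : signS (P i) * signS (P i) = 1 := by
      generalize P i = q
      fin_cases q <;> simp [signS]
    rw [this, one_mul]
  have hH : ∀ i P, pauliMoment D P P = pauliMoment D (Function.update P i (permH (P i)))
      (Function.update P i (permH (P i))) := by
    intro i P
    rw [pauliMoment_eq_of_invariant gateH_conj (hD i).1 P P]
    have : signH (P i) * signH (P i) = 1 := by
      generalize P i = q
      fin_cases q <;> simp [signH]
    rw [this, one_mul]
  have step : ∀ i P, ∀ q : Fin 4, (P i = 0 ↔ q = 0) →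
      pauliMoment D P P = pauliMoment D (Function.update P i q) (Function.update P i q) := by
    -- every nontrivial Pauli matrix is carried to `X` by `H` or `S`
    have toX : ∀ i P, P i ≠ 0 → pauliMoment D P P =
        pauliMoment D (Function.update P i 1) (Function.update P i 1) := by
      intro i P hP
      rcases (by decide : ∀ p : Fin 4, p ≠ 0 → p = 1 ∨ p = 2 ∨ p = 3) (P i) hP with h1 | h1 | h1
      · rw [← h1, Function.update_eq_self]
      · have := hS i P; rw [h1] at this; exact this
      · have := hH i P; rw [h1] at this; exact this
    intro i P q hq
    by_cases h0 : P i = 0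
    · rw [hq.mp h0, ← h0, Function.update_eq_self]
    · rw [toX i P h0, toX i (Function.update P i q) (by simpa using fun hq0 => h0 (hq.mpr hq0))]
      simp
  have key : ∀ s : Finset (Fin n), pauliMoment D P P =
      pauliMoment D (fun i => if i ∈ s then Q i else P i) (fun i => if i ∈ s then Q i else P i) := by
    intro s
    induction s using Finset.induction_on with
    | empty => simp
    | insert i s hi ih =>
      have e : (fun j => if j ∈ insert i s then Q j else P j) =
          Function.update (fun j => if j ∈ s then Q j else P j) i (Q i) := by
        funext j
        by_cases hj : j = i
        · subst hj; simp
        · simp [hj]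
      rw [e, ← step i _ (Q i) (by simpa [hi] using h i), ih]
  simpa using key Finset.univ

lemma pauliMoment_self_nonneg (D : Measure (QState n)) (P : Fin n → Fin 4) :
    0 ≤ pauliMoment D P P := integral_nonneg fun _ => mul_self_nonneg _

/-- `E Tr(P ρ)² ≤ (2/3) ^ |P|`: the `3 ^ |P|` operators with the support of `P` have the same
second moment, and by the purity bound these sum to at most `2 ^ |P|`. -/
lemma pauliMoment_self_le {D : Measure (QState n)} [IsProbabilityMeasure D]
    (hD : InvariantUnderHS D) (P : Fin n → Fin 4) :
    pauliMoment D P P ≤ (2 / 3 : ℝ) ^ pauliWeight P := by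
  classical
  set S := Finset.univ.filter fun i => P i ≠ 0 with hS
  set J := Fintype.piFinset fun i => if i ∈ S then ({1, 2, 3} : Finset (Fin 4)) else {0} with hJ
  set I := Fintype.piFinset fun i => if i ∈ S then Finset.univ else {(0 : Fin 4)} with hI
  have hJI : J ⊆ I := by
    refine Fintype.piFinset_subset _ _ fun i => ?_
    by_cases hi : i ∈ S <;> simp [hi]
  have hcard : (J.card : ℝ) = 3 ^ pauliWeight P := by
    rw [hJ, Fintype.card_piFinset]
    have : ∀ i, (if i ∈ S then ({1, 2, 3} : Finset (Fin 4)) else {0}).card =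
        if i ∈ S then 3 else 1 := by
      intro i; by_cases hi : i ∈ S <;> simp [hi]
    simp only [this, Finset.prod_ite]
    simp [hS, pauliWeight]
  have hw : ∀ Q ∈ J, pauliMoment D Q Q = pauliMoment D P P := by
    intro Q hQ
    refine pauliMoment_self_eq_of_support hD fun i => ?_
    have := Fintype.mem_piFinset.mp hQ i
    by_cases hi : i ∈ S
    · have h1 : P i ≠ 0 := by simpa [hS] using hi
      simp only [hi, if_true] at this
      have h2 : Q i ≠ 0 := by
        intro h0; rw [h0] at this; revert this; decide
      simp [h1, h2]
    · have h1 : P i = 0 := by simpa [hS] using hi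
      simp only [hi, if_false, Finset.mem_singleton] at this
      simp [h1, this]
  have h1 : (3 : ℝ) ^ pauliWeight P * pauliMoment D P P ≤ 2 ^ pauliWeight P := by
    calc (3 : ℝ) ^ pauliWeight P * pauliMoment D P P = ∑ Q ∈ J, pauliMoment D Q Q := by
          rw [Finset.sum_congr rfl hw, Finset.sum_const, nsmul_eq_mul, hcard]
      _ ≤ ∑ Q ∈ I, pauliMoment D Q Q :=
          Finset.sum_le_sum_of_subset_of_nonneg hJI fun Q _ _ => pauliMoment_self_nonneg D Q
      _ = ∫ ρ, ∑ Q ∈ I, pauliVal Q ρ * pauliVal Q ρ ∂D :=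
          (integral_finsetSum _ fun Q _ => integrable_pauliVal_mul D Q Q).symm
      _ ≤ ∫ _ρ : QState n, (2 : ℝ) ^ pauliWeight P ∂D := by
          refine integral_mono (integrable_finsetSum _ fun Q _ => integrable_pauliVal_mul D Q Q)
            (integrable_const _) fun ρ => ?_
          have := sum_pauliVal_sq_le S ρ
          simp only [sq] at this
          exact this
      _ = 2 ^ pauliWeight P := by simp
  rw [div_pow, le_div_iff₀ (by positivity)]
  linarith

lemma pauliMoment_self_le_one {D : Measure (QState n)} [IsProbabilityMeasure D]
    (hD : InvariantUnderHS D) (P : Fin n → Fin 4) : pauliMoment D P P ≤ 1 :=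
  (pauliMoment_self_le hD P).trans (pow_le_one₀ (by norm_num) (by norm_num))

lemma integral_sum_mul_sum {D : Measure (QState n)} [IsProbabilityMeasure D]
    (hD : InvariantUnderHS D) (a b : (Fin n → Fin 4) → ℝ) :
    ∫ ρ, (∑ P, a P * pauliVal P ρ) * (∑ P, b P * pauliVal P ρ) ∂D =
      ∑ P, a P * b P * pauliMoment D P P := by
  have h1 : ∀ ρ : QState n, (∑ P, a P * pauliVal P ρ) * (∑ P, b P * pauliVal P ρ) =
      ∑ P, ∑ Q, a P * b Q * (pauliVal P ρ * pauliVal Q ρ) := by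
    intro ρ
    rw [Finset.sum_mul_sum]
    exact Finset.sum_congr rfl fun P _ => Finset.sum_congr rfl fun Q _ => by ring
  simp only [h1]
  have hint : ∀ P Q : Fin n → Fin 4,
      Integrable (fun ρ => a P * b Q * (pauliVal P ρ * pauliVal Q ρ)) D :=
    fun P Q => (integrable_pauliVal_mul D P Q).const_mul _
  rw [integral_finsetSum _ fun P _ => integrable_finsetSum _ fun Q _ => hint P Q]
  refine Finset.sum_congr rfl fun P _ => ?_
  rw [integral_finsetSum _ fun Q _ => hint P Q, Finset.sum_eq_single P]
  · rw [integral_const_mul, pauliMoment]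
  · intro Q _ hQ
    rw [integral_const_mul]
    have := pauliMoment_eq_zero hD (Ne.symm hQ)
    rw [pauliMoment] at this
    rw [this, mul_zero]
  · simp

/-- The observable with prescribed real Pauli coefficients. -/
noncomputable def observableOfCoeff (a : (Fin n → Fin 4) → ℝ) : Observable n :=
  ⟨∑ P, (a P : ℂ) • pauliOp P, by
    simp only [Matrix.IsHermitian, Matrix.conjTranspose_sum, Matrix.conjTranspose_smul,
      (pauliOp_isHermitian _).eq, Complex.star_def, Complex.conj_ofReal]⟩

lemma expVal_observableOfCoeff (a : (Fin n → Fin 4) → ℝ) (ρ : QState n) :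
    expVal (observableOfCoeff a) ρ = ∑ P, a P * pauliVal P ρ := by
  simp only [expVal, observableOfCoeff, Finset.sum_mul, Matrix.trace_sum, Complex.re_sum,
    Matrix.smul_mul, Matrix.trace_smul, smul_eq_mul, Complex.re_ofReal_mul, pauliVal]

/-- The model with prescribed Pauli coefficients and a clipping level high enough to be inactive. -/
noncomputable def modelOfCoeff (a : (Fin n → Fin 4) → ℝ) : Observable n × ℝ :=
  (observableOfCoeff a, ∑ P, |a P|)

lemma predict_modelOfCoeff (a : (Fin n → Fin 4) → ℝ) (ρ : QState n) :
    predict (modelOfCoeff a) ρ = ∑ P, a P * pauliVal P ρ := by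
  have h : |∑ P, a P * pauliVal P ρ| ≤ ∑ P, |a P| := by
    refine (Finset.abs_sum_le_sum_abs _ _).trans (Finset.sum_le_sum fun P _ => ?_)
    rw [abs_mul]
    exact mul_le_of_le_one_right (abs_nonneg _) (abs_pauliVal_le P ρ)
  rw [predict, modelOfCoeff, expVal_observableOfCoeff, min_eq_right (abs_le.mp h).2,
    max_eq_right (abs_le.mp h).1]

/-- The prediction error is diagonal in the Pauli basis. -/
lemma predictionError_modelOfCoeff {D : Measure (QState n)} [IsProbabilityMeasure D]
    (hD : InvariantUnderHS D) (O : Observable n) (a : (Fin n → Fin 4) → ℝ) :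
    predictionError D O (modelOfCoeff a) =
      ∑ P, (a P - realCoeff O.1 P) ^ 2 * pauliMoment D P P := by
  simp only [predictionError, predict_modelOfCoeff, expVal_eq_sum, ← Finset.sum_sub_distrib,
    ← sub_mul, sq_abs]
  simp only [sq]
  exact integral_sum_mul_sum hD _ _

end Moments

/-! ### Hypercontractivity on the discrete cube -/

section Bonami

variable {ι κ : Type*} [DecidableEq ι]

/-- The Walsh monomial `∏_{i ∈ S} x_i` on the cube `{±1}^ι`. -/
def walsh (S : Finset ι) (x : ι → ℤˣ) : ℝ := ∏ i ∈ S, ((x i : ℤ) : ℝ)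

lemma unitsInt_sq (u : ℤˣ) : ((u : ℤ) : ℝ) ^ 2 = 1 := by
  rcases Int.units_eq_one_or u with h | h <;> simp [h]

lemma walsh_update {S : Finset ι} {i : ι} (hi : i ∉ S) (x : ι → ℤˣ) (u : ℤˣ) :
    walsh S (Function.update x i u) = walsh S x := by
  refine Finset.prod_congr rfl fun j hj => ?_
  rw [Function.update_of_ne (by rintro rfl; exact hi hj)]

lemma walsh_eq_mul_erase {S : Finset ι} {i : ι} (hi : i ∈ S) (x : ι → ℤˣ) :
    walsh S x = ((x i : ℤ) : ℝ) * walsh (S.erase i) x :=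
  (Finset.mul_prod_erase S _ hi).symm

variable [Fintype ι]

/-- A function that does not depend on `x_i` is orthogonal to `x_i`. -/
lemma sum_coord_mul_eq_zero (i : ι) (h : (ι → ℤˣ) → ℝ)
    (hh : ∀ x, h (Function.update x i (-x i)) = h x) :
    ∑ x : ι → ℤˣ, ((x i : ℤ) : ℝ) * h x = 0 := by
  let e : (ι → ℤˣ) ≃ (ι → ℤˣ) :=
    Function.Involutive.toPerm (fun x => Function.update x i (-x i)) fun x => by simp
  have h1 : ∑ x : ι → ℤˣ, ((x i : ℤ) : ℝ) * h x =
      ∑ x : ι → ℤˣ, (((e x) i : ℤ) : ℝ) * h (e x) :=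
    (Equiv.sum_comp e fun x => ((x i : ℤ) : ℝ) * h x).symm
  have h2 : ∀ x, (((e x) i : ℤ) : ℝ) * h (e x) = -(((x i : ℤ) : ℝ) * h x) := by
    intro x
    have : e x = Function.update x i (-x i) := rfl
    rw [this, hh]
    simp
  rw [Finset.sum_congr rfl fun x _ => h2 x, Finset.sum_neg_distrib] at h1
  linarith

lemma sum_walsh_mul (S T : Finset ι) :
    ∑ x : ι → ℤˣ, walsh S x * walsh T x = if S = T then 2 ^ Fintype.card ι else 0 := by
  split_ifs with h
  · subst h
    have : ∀ x : ι → ℤˣ, walsh S x * walsh S x = 1 := by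
      intro x
      rw [walsh, ← Finset.prod_mul_distrib]
      exact Finset.prod_eq_one fun i _ => by rw [← sq, unitsInt_sq]
    simp [this]
  · have key : ∀ S T : Finset ι, ∀ i ∈ S, i ∉ T →
        ∑ x : ι → ℤˣ, walsh S x * walsh T x = 0 := by
      intro S T i hiS hiT
      simp only [walsh_eq_mul_erase hiS, mul_assoc]
      refine sum_coord_mul_eq_zero i (fun x => walsh (S.erase i) x * walsh T x) fun x => ?_
      simp only [walsh_update (Finset.notMem_erase i S), walsh_update hiT]
    by_cases hST : S ⊆ T
    · obtain ⟨i, hiT, hiS⟩ := Finset.exists_of_ssubset (hST.ssubset_of_ne h)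
      simp only [mul_comm (walsh S _)]
      exact key T S i hiT hiS
    · obtain ⟨i, hiS, hiT⟩ := Finset.not_subset.mp hST
      exact key S T i hiS hiT

/-- The second moment of a Walsh polynomial. -/
lemma sum_walshPoly_sq (J : Finset κ) (S : κ → Finset ι) (hS : Set.InjOn S J) (c : κ → ℝ) :
    ∑ x : ι → ℤˣ, (∑ j ∈ J, c j * walsh (S j) x) ^ 2 = 2 ^ Fintype.card ι * ∑ j ∈ J, c j ^ 2 := by
  simp only [sq, Finset.sum_mul_sum]
  rw [Finset.sum_comm, Finset.mul_sum]
  refine Finset.sum_congr rfl fun j hj => ?_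
  rw [Finset.sum_comm, Finset.sum_eq_single j]
  · have : ∀ x : ι → ℤˣ, c j * walsh (S j) x * (c j * walsh (S j) x) =
        c j * c j * (walsh (S j) x * walsh (S j) x) := fun x => by ring
    simp only [this, ← Finset.mul_sum, sum_walsh_mul, if_true]
    ring
  · intro l hl hlj
    have : ∀ x : ι → ℤˣ, c j * walsh (S j) x * (c l * walsh (S l) x) =
        c j * c l * (walsh (S j) x * walsh (S l) x) := fun x => by ring
    simp only [this, ← Finset.mul_sum, sum_walsh_mul]
    rw [if_neg fun h => hlj (hS hl hj h.symm), mul_zero]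
  · exact fun h => absurd hj h

/-- The Bonami lemma: a Walsh polynomial of degree at most `k` has fourth moment at most `9 ^ k`
times the square of its second moment. Induction on the variables, splitting off one of them. -/
lemma sum_walshPoly_pow_four_le (V : Finset ι) : ∀ (J : Finset κ) (S : κ → Finset ι) (k : ℕ)
    (c : κ → ℝ), (∀ j ∈ J, S j ⊆ V) → Set.InjOn S J → (∀ j ∈ J, (S j).card ≤ k) →
    ∑ x : ι → ℤˣ, (∑ j ∈ J, c j * walsh (S j) x) ^ 4 ≤
      2 ^ Fintype.card ι * (9 ^ k * (∑ j ∈ J, c j ^ 2) ^ 2) := by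
  induction V using Finset.induction_on with
  | empty =>
    intro J S k c hV hinj _
    have hemp : ∀ j ∈ J, S j = ∅ := fun j hj => Finset.subset_empty.mp (hV j hj)
    have h9 : (1 : ℝ) ≤ 9 ^ k := one_le_pow₀ (by norm_num)
    rcases J.eq_empty_or_nonempty with h | ⟨a, haJ⟩
    · simp [h]
    · have h : J = {a} := Finset.eq_singleton_iff_unique_mem.mpr ⟨haJ, fun b hb =>
        hinj hb haJ (by rw [hemp a haJ, hemp b hb])⟩
      have hSa : S a = ∅ := hemp a (by simp [h])
      simp only [h, Finset.sum_singleton, hSa, walsh, Finset.prod_empty, mul_one,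
        Finset.sum_const, Finset.card_univ, Fintype.card_fun, Fintype.card_units_int, nsmul_eq_mul]
      push_cast
      refine mul_le_mul_of_nonneg_left ?_ (by positivity)
      nlinarith [sq_nonneg (c a ^ 2)]
  | insert i V hi ih =>
    intro J S k c hV hinj hk
    set J0 := J.filter fun j => i ∉ S j with hJ0
    set J1 := J.filter fun j => i ∈ S j with hJ1
    set A : (ι → ℤˣ) → ℝ := fun x => ∑ j ∈ J0, c j * walsh (S j) x with hA
    set B : (ι → ℤˣ) → ℝ := fun x => ∑ j ∈ J1, c j * walsh ((S j).erase i) x with hB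
    set a := ∑ j ∈ J0, c j ^ 2 with ha
    set b := ∑ j ∈ J1, c j ^ 2 with hb
    have ha0 : 0 ≤ a := Finset.sum_nonneg fun _ _ => sq_nonneg _
    have hb0 : 0 ≤ b := Finset.sum_nonneg fun _ _ => sq_nonneg _
    have hsplit : ∀ x, ∑ j ∈ J, c j * walsh (S j) x = A x + ((x i : ℤ) : ℝ) * B x := by
      intro x
      rw [← Finset.sum_filter_add_sum_filter_not J (fun j => i ∉ S j), hA, hB]
      simp only [not_not, Finset.mul_sum]
      congr 1
      refine Finset.sum_congr rfl fun j hj => ?_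
      rw [walsh_eq_mul_erase (Finset.mem_filter.mp hj).2]
      ring
    have hsum : ∑ j ∈ J, c j ^ 2 = a + b := by
      rw [← Finset.sum_filter_add_sum_filter_not J (fun j => i ∉ S j)]
      simp only [not_not, ha, hb, hJ0, hJ1]
    have hAi : ∀ x u, A (Function.update x i u) = A x := fun x u =>
      Finset.sum_congr rfl fun j hj => by rw [walsh_update (Finset.mem_filter.mp hj).2]
    have hBi : ∀ x u, B (Function.update x i u) = B x := fun x u =>
      Finset.sum_congr rfl fun j _ => by rw [walsh_update (Finset.notMem_erase i _)]
    have hA4 : ∑ x, A x ^ 4 ≤ 2 ^ Fintype.card ι * (9 ^ k * a ^ 2) := by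
      refine ih J0 S k c (fun j hj => ?_) (hinj.mono (Finset.filter_subset _ _)) fun j hj =>
        hk j (Finset.mem_filter.mp hj).1
      obtain ⟨h1, h2⟩ := Finset.mem_filter.mp hj
      exact (Finset.subset_insert_iff_of_notMem h2).mp (hV j h1)
    -- dividing by `x i` lowers the degree, which gains a factor `9`
    have hB4 : ∑ x, B x ^ 4 * 9 ≤ 2 ^ Fintype.card ι * (9 ^ k * b ^ 2) := by
      rcases J1.eq_empty_or_nonempty with h | ⟨j0, hj0⟩
      · simp [hB, h, hb]
      · have hk1 : 1 ≤ k := le_trans (Finset.card_pos.mpr ⟨i, (Finset.mem_filter.mp hj0).2⟩)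
          (hk j0 (Finset.mem_filter.mp hj0).1)
        have := ih J1 (fun j => (S j).erase i) (k - 1) c (fun j hj => ?_) ?_ fun j hj => ?_
        · rw [← Finset.sum_mul]
          calc (∑ x, B x ^ 4) * 9 ≤ 2 ^ Fintype.card ι * (9 ^ (k - 1) * b ^ 2) * 9 := by gcongr
            _ = 2 ^ Fintype.card ι * (9 ^ (k - 1 + 1) * b ^ 2) := by ring
            _ = _ := by rw [Nat.sub_add_cancel hk1]
        · obtain ⟨h1, h2⟩ := Finset.mem_filter.mp hj
          exact Finset.subset_insert_iff.mp (hV j h1)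
        · intro j hj l hl hjl
          have hj' := Finset.mem_filter.mp hj
          have hl' := Finset.mem_filter.mp hl
          refine hinj hj'.1 hl'.1 ?_
          rw [← Finset.insert_erase hj'.2, ← Finset.insert_erase hl'.2]
          exact congrArg (insert i) hjl
        · obtain ⟨h1, h2⟩ := Finset.mem_filter.mp hj
          rw [Finset.card_erase_of_mem h2]
          exact Nat.sub_le_sub_right (hk j h1) 1
    have hAB : ∑ x, A x ^ 2 * B x ^ 2 * 3 ≤ 2 ^ Fintype.card ι * (9 ^ k * (a * b)) := by
      rw [← Finset.sum_mul]
      have hcs := Finset.sum_mul_sq_le_sq_mul_sq Finset.univ (fun x => A x ^ 2) fun x => B x ^ 2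
      simp only [← pow_mul] at hcs
      norm_num at hcs
      refine abs_le_of_sq_le_sq' ?_ (by positivity) |>.2
      rw [← Finset.sum_mul] at hB4
      calc ((∑ x, A x ^ 2 * B x ^ 2) * 3) ^ 2 = (∑ x, A x ^ 2 * B x ^ 2) ^ 2 * 9 := by ring
        _ ≤ (∑ x, A x ^ 4) * ((∑ x, B x ^ 4) * 9) := by nlinarith
        _ ≤ (2 ^ Fintype.card ι * (9 ^ k * a ^ 2)) * (2 ^ Fintype.card ι * (9 ^ k * b ^ 2)) := by
            gcongr
        _ = _ := by ring
    -- the terms of odd degree in the sign `x i` cancel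
    have hodd : ∑ x : ι → ℤˣ, ((x i : ℤ) : ℝ) * (4 * A x ^ 3 * B x + 4 * A x * B x ^ 3) = 0 :=
      sum_coord_mul_eq_zero i (fun x => 4 * A x ^ 3 * B x + 4 * A x * B x ^ 3) fun x => by
        simp only [hAi, hBi]
    have hexp : ∀ x : ι → ℤˣ, (A x + ((x i : ℤ) : ℝ) * B x) ^ 4 =
        A x ^ 4 + 6 * (A x ^ 2 * B x ^ 2) + B x ^ 4 +
          ((x i : ℤ) : ℝ) * (4 * A x ^ 3 * B x + 4 * A x * B x ^ 3) := by
      intro x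
      have h2 := unitsInt_sq (x i)
      generalize ((x i : ℤ) : ℝ) = u at h2
      have h3 : u ^ 3 = u := by rw [pow_succ, h2, one_mul]
      have h4 : u ^ 4 = 1 := by rw [show u ^ 4 = (u ^ 2) ^ 2 by ring, h2, one_pow]
      linear_combination 6 * A x ^ 2 * B x ^ 2 * h2 + 4 * A x * B x ^ 3 * h3 + B x ^ 4 * h4
    simp only [hsplit, hexp, Finset.sum_add_distrib, hodd, add_zero, hsum]
    rw [← Finset.sum_mul] at hB4 hAB
    rw [← Finset.mul_sum]
    have hpos : (0 : ℝ) ≤ 2 ^ Fintype.card ι * (9 ^ k * b ^ 2) := by positivity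
    nlinarith [Finset.sum_nonneg fun x (_ : x ∈ Finset.univ) => (by positivity : 0 ≤ B x ^ 4)]

/-- The `L¹`-`L²` comparison for Walsh polynomials of degree at most `k`. -/
lemma sqrt_sum_sq_le_sum_abs_walshPoly (J : Finset κ) (S : κ → Finset ι) (k : ℕ) (c : κ → ℝ)
    (hS : Set.InjOn S J) (hk : ∀ j ∈ J, (S j).card ≤ k) :
    2 ^ Fintype.card ι * √(∑ j ∈ J, c j ^ 2) ≤
      3 ^ k * ∑ x : ι → ℤˣ, |∑ j ∈ J, c j * walsh (S j) x| := by
  set g : (ι → ℤˣ) → ℝ := fun x => ∑ j ∈ J, c j * walsh (S j) x with hg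
  set s := ∑ j ∈ J, c j ^ 2 with hs
  set m : ℝ := 2 ^ Fintype.card ι with hm
  have hm0 : 0 < m := by positivity
  have hs0 : 0 ≤ s := Finset.sum_nonneg fun _ _ => sq_nonneg _
  have h2 : ∑ x, g x ^ 2 = m * s := sum_walshPoly_sq J S hS c
  have h4 : ∑ x, g x ^ 4 ≤ m * (9 ^ k * s ^ 2) :=
    sum_walshPoly_pow_four_le Finset.univ J S k c (fun _ _ => Finset.subset_univ _) hS hk
  set E1 := ∑ x, |g x| with hE1
  have hE0 : 0 ≤ E1 := Finset.sum_nonneg fun _ _ => abs_nonneg _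
  rcases hs0.eq_or_lt with h0 | hspos
  · rw [← h0, Real.sqrt_zero, mul_zero]; positivity
  set E3 := ∑ x, |g x| ^ 3 with hE3
  have hE30 : 0 ≤ E3 := by positivity
  -- Cauchy-Schwarz twice: `(∑ g²)² ≤ ∑ |g| ∑ |g|³` and `(∑ |g|³)² ≤ ∑ g² ∑ g⁴`
  have c1 : (m * s) ^ 2 ≤ E1 * E3 := by
    have := Finset.sum_mul_sq_le_sq_mul_sq Finset.univ (fun x => √|g x|) fun x => √|g x| ^ 3
    have e1 : ∀ x, √|g x| * √|g x| ^ 3 = g x ^ 2 := by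
      intro x
      rw [← pow_succ', show 3 + 1 = 2 * 2 by norm_num, pow_mul, Real.sq_sqrt (abs_nonneg _),
        sq_abs]
    have e2 : ∀ x, √|g x| ^ 2 = |g x| := fun x => Real.sq_sqrt (abs_nonneg _)
    have e3 : ∀ x, (√|g x| ^ 3) ^ 2 = |g x| ^ 3 := fun x => by
      rw [← pow_mul, mul_comm, pow_mul, e2]
    simp only [e1, e2, e3, h2] at this
    exact this
  have c2 : E3 ^ 2 ≤ (m * s) * (m * (9 ^ k * s ^ 2)) := by
    have := Finset.sum_mul_sq_le_sq_mul_sq Finset.univ (fun x => |g x|) fun x => |g x| ^ 2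
    have e1 : ∀ x, |g x| * |g x| ^ 2 = |g x| ^ 3 := fun x => by ring
    have e2 : ∀ x, |g x| ^ 2 = g x ^ 2 := fun x => sq_abs _
    have e3 : ∀ x, (|g x| ^ 2) ^ 2 = g x ^ 4 := fun x => by rw [e2]; ring
    simp only [e1, e3] at this
    simp only [e2, h2] at this
    exact this.trans (by gcongr)
  have c3 : (m * s) ^ 4 ≤ E1 ^ 2 * ((m * s) * (m * (9 ^ k * s ^ 2))) := by
    calc (m * s) ^ 4 = ((m * s) ^ 2) ^ 2 := by ring
      _ ≤ (E1 * E3) ^ 2 := by gcongr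
      _ = E1 ^ 2 * E3 ^ 2 := by ring
      _ ≤ _ := by gcongr
  have c4 : m ^ 2 * s ≤ 9 ^ k * E1 ^ 2 := by
    have h : (m ^ 2 * s) * (m ^ 2 * s ^ 3) ≤ (9 ^ k * E1 ^ 2) * (m ^ 2 * s ^ 3) := by
      nlinarith
    exact le_of_mul_le_mul_right h (by positivity)
  refine abs_le_of_sq_le_sq' ?_ (by positivity) |>.2
  have h9 : ((3 : ℝ) ^ k) ^ 2 = 9 ^ k := by rw [← pow_mul, mul_comm, pow_mul]; norm_num
  rw [mul_pow, Real.sq_sqrt hs0, mul_pow, h9]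
  exact c4

end Bonami

/-! ### The linear coefficient of a bounded polynomial -/

/-- A polynomial of degree at most `k` bounded by `M` on `[-1, 1]` has linear coefficient at most
`2 * 5 ^ k * M`. The monomials of degree `j = k, …, 2` are eliminated one at a time by passing to
`(2 ^ j p(t / 2) - p(t)) / (2 ^ (j - 1) - 1)`, which keeps the linear coefficient. -/
lemma abs_coeff_one_le (k : ℕ) : ∀ (p : Polynomial ℝ) (M : ℝ), p.natDegree ≤ k →
    (∀ t : ℝ, |t| ≤ 1 → |p.eval t| ≤ M) → |p.coeff 1| ≤ 2 * 5 ^ k * M := by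
  have h01 : ∀ (p : Polynomial ℝ) (M : ℝ), p.natDegree ≤ 1 →
      (∀ t : ℝ, |t| ≤ 1 → |p.eval t| ≤ M) → |p.coeff 1| ≤ 2 * M := by
    intro p M hp hM
    have h0 := hM 0 (by simp)
    have h1 := hM 1 (by simp)
    rw [Polynomial.eq_X_add_C_of_natDegree_le_one hp] at h0 h1
    simp only [Polynomial.eval_add, Polynomial.eval_mul, Polynomial.eval_C, Polynomial.eval_X,
      mul_zero, mul_one, zero_add] at h0 h1
    rw [abs_le] at *
    constructor <;> linarith [h0.1, h0.2, h1.1, h1.2]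
  induction k with
  | zero =>
    intro p M hp hM
    have := h01 p M (hp.trans (by norm_num)) hM
    simpa using this
  | succ k ih =>
    intro p M hp hM
    have hM0 : 0 ≤ M := (abs_nonneg _).trans (hM 0 (by simp))
    rcases Nat.eq_zero_or_pos k with hk | hk
    · subst hk
      have := h01 p M hp hM
      norm_num
      linarith
    set w : ℝ := 2 ^ k with hw
    have hw2 : 2 ≤ w := by
      calc (2 : ℝ) = 2 ^ 1 := by norm_num
        _ ≤ 2 ^ k := pow_le_pow_right₀ (by norm_num) hk
    set q : Polynomial ℝ := Polynomial.C (w - 1)⁻¹ *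
      (Polynomial.C (2 * w) * p.comp (Polynomial.C (1 / 2) * Polynomial.X) - p) with hq
    have hcoef : ∀ j, q.coeff j = (w - 1)⁻¹ * (2 * w * (p.coeff j * (1 / 2) ^ j) - p.coeff j) := by
      intro j
      rw [hq, Polynomial.coeff_C_mul, Polynomial.coeff_sub, Polynomial.coeff_C_mul,
        Polynomial.comp_C_mul_X_coeff]
    have hdeg : q.natDegree ≤ k := by
      refine Polynomial.natDegree_le_iff_coeff_eq_zero.mpr fun j hj => ?_
      rw [hcoef]
      rcases (Nat.succ_le_of_lt hj).eq_or_lt with h | h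
      · rw [← h, pow_succ, ← mul_assoc, ← mul_assoc, div_pow, one_pow]
        have : w ≠ 0 := by linarith
        field_simp
        simp [hw]
      · rw [Polynomial.coeff_eq_zero_of_natDegree_lt (lt_of_le_of_lt hp h)]
        simp
    have hlin : q.coeff 1 = p.coeff 1 := by
      rw [hcoef]
      have : w - 1 ≠ 0 := by linarith
      field_simp
    have hbd : ∀ t : ℝ, |t| ≤ 1 → |q.eval t| ≤ 5 * M := by
      intro t ht
      have h1 := hM t ht
      have h2 := hM (1 / 2 * t) (by rw [abs_mul]; norm_num; linarith)
      simp only [hq, Polynomial.eval_mul, Polynomial.eval_C, Polynomial.eval_sub,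
        Polynomial.eval_comp, Polynomial.eval_X]
      rw [abs_mul, abs_inv, abs_of_pos (by linarith : 0 < w - 1), inv_mul_le_iff₀ (by linarith)]
      rw [abs_le] at *
      constructor <;> nlinarith [h1.1, h1.2, h2.1, h2.2]
    rw [← hlin, pow_succ]
    have := ih q (5 * M) hdeg hbd
    linarith

/-! ### Influences of a bounded low-degree observable -/

section Influence

variable {n : ℕ}

/-- The single-qubit operator `(1 + x₁ X + x₂ Y + x₃ Z) / 2` with Bloch vector `x`; the entry `x₀`
is ignored. -/
noncomputable def blochMatrix (x : Fin 4 → ℝ) : Matrix (Fin 2) (Fin 2) ℂ :=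
  (1 / 2 : ℝ) • (1 + (x 1 • pauliMatrix 1 + x 2 • pauliMatrix 2 + x 3 • pauliMatrix 3))

/-- The monomial attached to a Pauli operator: the value of `Tr(P ρ)` on the product state with
Bloch vectors `x i`. -/
def pauliMonomial (P : Fin n → Fin 4) (x : Fin n → Fin 4 → ℝ) : ℝ :=
  ∏ i, if P i = 0 then 1 else x i (P i)

lemma posSemidef_smul_one_add_smul_pauliMatrix (q : Fin 4) {c t : ℝ} (h : |t| ≤ c) :
    (c • (1 : Matrix (Fin 2) (Fin 2) ℂ) + t • pauliMatrix q).PosSemidef := by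
  have hp : ∀ A : Matrix (Fin 2) (Fin 2) ℂ, A.conjTranspose = A → A * A = (2 : ℝ) • A →
      A.PosSemidef := by
    intro A hA hAA
    have h1 := (Matrix.posSemidef_conjTranspose_mul_self A).smul (by norm_num : (0 : ℝ) ≤ 1 / 2)
    rw [hA, hAA, smul_smul] at h1
    simpa using h1
  have hplus : (1 + pauliMatrix q).PosSemidef := by
    refine hp _ (by rw [Matrix.conjTranspose_add, Matrix.conjTranspose_one,
      pauliMatrix_conjTranspose]) ?_
    rw [add_mul, mul_add, mul_add, pauliMatrix_mul_self, two_smul]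
    simp only [one_mul, mul_one]
    abel
  have hminus : (1 - pauliMatrix q).PosSemidef := by
    refine hp _ (by rw [Matrix.conjTranspose_sub, Matrix.conjTranspose_one,
      pauliMatrix_conjTranspose]) ?_
    rw [sub_mul, mul_sub, mul_sub, pauliMatrix_mul_self, two_smul]
    simp only [one_mul, mul_one]
    abel
  obtain ⟨h1, h2⟩ := abs_le.mp h
  have := (hplus.smul (by linarith : (0 : ℝ) ≤ (c + t) / 2)).add
    (hminus.smul (by linarith : (0 : ℝ) ≤ (c - t) / 2))
  convert this using 1
  module

lemma blochMatrix_posSemidef {x : Fin 4 → ℝ} (h : ∀ s, |x s| ≤ 1 / 3) :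
    (blochMatrix x).PosSemidef := by
  have h1 := ((posSemidef_smul_one_add_smul_pauliMatrix 1 (h 1)).add
    (posSemidef_smul_one_add_smul_pauliMatrix 2 (h 2))).add
    (posSemidef_smul_one_add_smul_pauliMatrix 3 (h 3))
  have h2 := h1.smul (by norm_num : (0 : ℝ) ≤ 1 / 2)
  convert h2 using 1
  rw [blochMatrix]
  module

lemma trace_pauliMatrix_mul_blochMatrix (q : Fin 4) (x : Fin 4 → ℝ) :
    (pauliMatrix q * blochMatrix x).trace = ((if q = 0 then 1 else x q : ℝ) : ℂ) := by
  have h : blochMatrix x = !![(1 + (x 3 : ℂ)) / 2, ((x 1 : ℂ) - x 2 * Complex.I) / 2;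
      ((x 1 : ℂ) + x 2 * Complex.I) / 2, (1 - (x 3 : ℂ)) / 2] := by
    ext a b
    fin_cases a <;> fin_cases b <;> simp [blochMatrix, pauliMatrix] <;> ring
  have hI := Complex.I_sq
  rw [h]
  fin_cases q <;> simp [pauliMatrix, Matrix.trace, Fin.sum_univ_two]
  · ring
  · ring
  · linear_combination -(x 2 : ℂ) * hI
  · ring

/-- The observable `∑_{|P| ≤ k} α_P P` evaluated on product states: a multilinear polynomial bounded
by its spectral norm. -/
lemma abs_sum_pauliMonomial_le {O : QubitOp n} (hO : O.IsHermitian) (k : ℕ)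
    {x : Fin n → Fin 4 → ℝ} (hx : ∀ i s, |x i s| ≤ 1 / 3) :
    |∑ P : Fin n → Fin 4 with pauliWeight P ≤ k, realCoeff O P * pauliMonomial P x| ≤
      specNorm (lowDegree k O) := by
  set ρ : QubitOp n := tensorOp fun i => blochMatrix (x i) with hρ
  have hpos : ρ.PosSemidef := tensorOp_posSemidef fun i => blochMatrix_posSemidef (hx i)
  have htr : ∀ P : Fin n → Fin 4, (pauliOp P * ρ).trace = (pauliMonomial P x : ℂ) := by
    intro P
    rw [hρ, pauliOp, tensorOp_mul, trace_tensorOp]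
    simp only [trace_pauliMatrix_mul_blochMatrix]
    rw [← Complex.ofReal_prod, pauliMonomial]
  have h1 : ρ.trace = 1 := by
    have := htr 0
    simpa [pauliOp, pauliMatrix, tensorOp_one, pauliMonomial] using this
  have h2 := norm_trace_mul_le (lowDegree k O) hpos
  rw [h1, Complex.one_re, mul_one] at h2
  have h3 : (lowDegree k O * ρ).trace =
      ((∑ P : Fin n → Fin 4 with pauliWeight P ≤ k, realCoeff O P * pauliMonomial P x : ℝ) : ℂ) := by
    rw [lowDegree, Finset.sum_mul, Matrix.trace_sum, Complex.ofReal_sum]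
    refine Finset.sum_congr rfl fun P _ => ?_
    rw [Matrix.smul_mul, Matrix.trace_smul, htr, pauliCoeff_eq_realCoeff hO, smul_eq_mul,
      Complex.ofReal_mul]
  rwa [h3, Complex.norm_real, Real.norm_eq_abs] at h2

/-- The partial derivative of `∑_{P ∈ J} a P * pauliMonomial P` in the variable `x i s`, for
`v = (i, s)` with `s ≠ 0`. -/
noncomputable def pauliPartial (J : Finset (Fin n → Fin 4)) (a : (Fin n → Fin 4) → ℝ)
    (v : Fin n × Fin 4) (u : Fin n → Fin 4 → ℝ) : ℝ :=
  ∑ P ∈ J with P v.1 = v.2 ∧ v.2 ≠ 0,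
    a P * ∏ j ∈ Finset.univ.erase v.1, if P j = 0 then 1 else u j (P j)

/-- Directional derivatives of a bounded polynomial of degree at most `k`. -/
lemma abs_sum_mul_pauliPartial_le {J : Finset (Fin n → Fin 4)} {a : (Fin n → Fin 4) → ℝ} {k : ℕ}
    {M : ℝ} (hJ : ∀ P ∈ J, pauliWeight P ≤ k)
    (hM : ∀ x : Fin n → Fin 4 → ℝ, (∀ i s, |x i s| ≤ 1 / 3) →
      |∑ P ∈ J, a P * pauliMonomial P x| ≤ M)
    {u y : Fin n → Fin 4 → ℝ} (hu : ∀ i s, |u i s| ≤ 1 / 6) (hy : ∀ i s, |y i s| ≤ 1 / 6) :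
    |∑ v : Fin n × Fin 4, y v.1 v.2 * pauliPartial J a v u| ≤ 2 * 5 ^ k * M := by
  set f : (Fin n → Fin 4) → Fin n → Polynomial ℝ := fun P i =>
    if P i = 0 then 1 else Polynomial.C (u i (P i)) + Polynomial.C (y i (P i)) * Polynomial.X
    with hf
  set p : Polynomial ℝ := ∑ P ∈ J, Polynomial.C (a P) * ∏ i, f P i with hp
  have hdeg : p.natDegree ≤ k := by
    refine Polynomial.natDegree_sum_le_of_forall_le _ _ fun P hP => ?_
    refine (Polynomial.natDegree_C_mul_le _ _).trans ((Polynomial.natDegree_prod_le _ _).trans ?_)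
    refine le_trans (Finset.sum_le_sum fun i _ => ?_ :
      _ ≤ ∑ i, if P i ≠ 0 then 1 else 0) ?_
    · simp only [hf]
      by_cases h1 : P i = 0
      · simp [h1]
      · rw [if_neg h1, if_pos h1, add_comm]; exact Polynomial.natDegree_linear_le
    · rw [← Finset.card_filter]; exact hJ P hP
  have heval : ∀ t, p.eval t =
      ∑ P ∈ J, a P * pauliMonomial P fun i s => u i s + y i s * t := by
    intro t
    simp only [hp, Polynomial.eval_finsetSum, Polynomial.eval_mul, Polynomial.eval_C,
      Polynomial.eval_prod, pauliMonomial]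
    refine Finset.sum_congr rfl fun P _ => ?_
    congr 1
    refine Finset.prod_congr rfl fun i _ => ?_
    simp only [hf]
    split_ifs <;> simp
  have hbd : ∀ t : ℝ, |t| ≤ 1 → |p.eval t| ≤ M := by
    intro t ht
    rw [heval]
    refine hM _ fun i s => (abs_add_le _ _).trans ?_
    rw [abs_mul]
    nlinarith [hu i s, hy i s, abs_nonneg (y i s), abs_nonneg t]
  have hc : p.coeff 1 = ∑ v : Fin n × Fin 4, y v.1 v.2 * pauliPartial J a v u := by
    have h1 : p.coeff 1 = (Polynomial.derivative p).eval 0 := by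
      rw [← Polynomial.coeff_zero_eq_eval_zero, Polynomial.coeff_derivative]
      simp
    have h2 : ∀ P i, (Polynomial.derivative (f P i)).eval 0 =
        if P i = 0 then 0 else y i (P i) := by
      intro P i
      simp only [hf]
      split_ifs <;> simp
    have h3 : ∀ P i, (f P i).eval 0 = if P i = 0 then 1 else u i (P i) := by
      intro P i
      simp only [hf]
      split_ifs <;> simp
    rw [h1, hp, Polynomial.derivative_sum, Polynomial.eval_finsetSum]
    simp only [Polynomial.derivative_C_mul, Polynomial.derivative_prod_finset, Polynomial.eval_mul,
      Polynomial.eval_C, Polynomial.eval_finsetSum, Polynomial.eval_prod, h2, h3]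
    rw [Fintype.sum_prod_type]
    simp only [pauliPartial, Finset.sum_filter, Finset.mul_sum]
    rw [Finset.sum_comm]
    refine Finset.sum_congr rfl fun i _ => ?_
    rw [Finset.sum_comm]
    refine Finset.sum_congr rfl fun P _ => ?_
    by_cases h0 : P i = 0
    · simp only [h0, if_true, mul_zero]
      refine (Finset.sum_eq_zero fun s _ => ?_).symm
      rw [if_neg (fun h => h.2 h.1.symm), mul_zero]
    · rw [Finset.sum_eq_single (P i)]
      · simp only [h0, if_false, ne_eq, not_false_eq_true, and_self, if_true]
        ring
      · intro s _ hs
        rw [if_neg (fun h => hs h.1.symm), mul_zero]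
      · simp
  rw [← hc]
  exact abs_coeff_one_le k p M hdeg hbd

/-- At each point of the cube the `ℓ¹` norm of the gradient is bounded independently of the number of
qubits. -/
lemma sum_abs_pauliPartial_le {J : Finset (Fin n → Fin 4)} {a : (Fin n → Fin 4) → ℝ} {k : ℕ}
    {M : ℝ} (hJ : ∀ P ∈ J, pauliWeight P ≤ k)
    (hM : ∀ x : Fin n → Fin 4 → ℝ, (∀ i s, |x i s| ≤ 1 / 3) →
      |∑ P ∈ J, a P * pauliMonomial P x| ≤ M)
    {u : Fin n → Fin 4 → ℝ} (hu : ∀ i s, |u i s| ≤ 1 / 6) :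
    ∑ v : Fin n × Fin 4, |pauliPartial J a v u| ≤ 12 * 5 ^ k * M := by
  -- the direction of the signs of the partial derivatives turns the directional derivative into
  -- their `ℓ¹` norm
  have h := abs_sum_mul_pauliPartial_le hJ hM hu
    (y := fun i s => (1 / 6) * SignType.sign (pauliPartial J a (i, s) u)) fun i s => by
      rw [abs_mul]
      rcases lt_trichotomy (pauliPartial J a (i, s) u) 0 with h | h | h <;> simp [h]
  have h1 : ∀ v : Fin n × Fin 4, 1 / 6 * (SignType.sign (pauliPartial J a (v.1, v.2) u) : ℝ) *
      pauliPartial J a v u = 1 / 6 * |pauliPartial J a v u| := by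
    intro v
    rw [mul_assoc, Prod.mk.eta, sign_mul_self]
  simp only [h1, ← Finset.mul_sum] at h
  have := (le_abs_self _).trans h
  linarith

/-- The square root of the influence of the variable `v = (i, s)`: the `ℓ²` norm of the
coefficients of the operators `P ∈ J` acting as the Pauli matrix `s ≠ 0` on qubit `i`. -/
noncomputable def sqrtInfluence (J : Finset (Fin n → Fin 4)) (a : (Fin n → Fin 4) → ℝ)
    (v : Fin n × Fin 4) : ℝ :=
  √(∑ P ∈ J with P v.1 = v.2 ∧ v.2 ≠ 0, a P ^ 2)

/-- The variables of the monomial of `P` away from qubit `i`. -/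
def pauliVars (i : Fin n) (P : Fin n → Fin 4) : Finset (Fin n × Fin 4) :=
  ((Finset.univ.erase i).filter fun j => P j ≠ 0).image fun j => (j, P j)

lemma mem_pauliVars {i : Fin n} {P : Fin n → Fin 4} {v : Fin n × Fin 4} :
    v ∈ pauliVars i P ↔ v.1 ≠ i ∧ v.2 ≠ 0 ∧ P v.1 = v.2 := by
  simp only [pauliVars, Finset.mem_image, Finset.mem_filter, Finset.mem_erase, Finset.mem_univ,
    and_true]
  constructor
  · rintro ⟨j, ⟨h1, h2⟩, rfl⟩
    exact ⟨h1, h2, rfl⟩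
  · rintro ⟨h1, h2, h3⟩
    exact ⟨v.1, ⟨h1, h3 ▸ h2⟩, by rw [h3]⟩

lemma card_pauliVars_le (i : Fin n) (P : Fin n → Fin 4) :
    (pauliVars i P).card ≤ pauliWeight P :=
  Finset.card_image_le.trans (Finset.card_le_card
    (Finset.filter_subset_filter _ (Finset.erase_subset _ _)))

lemma prod_erase_eq_walsh (i : Fin n) (P : Fin n → Fin 4) (x : Fin n × Fin 4 → ℤˣ) (c : ℝ) :
    (∏ j ∈ Finset.univ.erase i, if P j = 0 then 1 else c * ((x (j, P j) : ℤ) : ℝ)) =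
      c ^ (pauliVars i P).card * walsh (pauliVars i P) x := by
  have hinj : Set.InjOn (fun j => (j, P j))
      ((Finset.univ.erase i).filter fun j => P j ≠ 0 : Finset (Fin n)) :=
    fun j _ l _ h => (Prod.mk.inj h).1
  rw [walsh, pauliVars, Finset.prod_image hinj, Finset.card_image_of_injOn hinj,
    ← Finset.prod_const, ← Finset.prod_mul_distrib, Finset.prod_filter]
  refine Finset.prod_congr rfl fun j _ => ?_
  by_cases h : P j = 0 <;> simp [h]

/-- The square roots of the influences of a polynomial of degree at most `k` bounded by `M` sum to
at most `12 * 90 ^ k * M`: hypercontractivity reduces this to the `L¹` norms of the partial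
derivatives, whose sum is a directional derivative at each point. -/
lemma sum_sqrtInfluence_le {J : Finset (Fin n → Fin 4)} {a : (Fin n → Fin 4) → ℝ} {k : ℕ}
    {M : ℝ} (hJ : ∀ P ∈ J, pauliWeight P ≤ k)
    (hM : ∀ x : Fin n → Fin 4 → ℝ, (∀ i s, |x i s| ≤ 1 / 3) →
      |∑ P ∈ J, a P * pauliMonomial P x| ≤ M) :
    ∑ v, sqrtInfluence J a v ≤ 12 * 90 ^ k * M := by
  set m : ℝ := 2 ^ Fintype.card (Fin n × Fin 4) with hm
  have hm0 : 0 < m := by positivity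
  have hpt : ∀ x : Fin n × Fin 4 → ℤˣ,
      ∑ v, |pauliPartial J a v fun i s => 1 / 6 * ((x (i, s) : ℤ) : ℝ)| ≤ 12 * 5 ^ k * M := by
    intro x
    refine sum_abs_pauliPartial_le hJ hM fun i s => ?_
    rw [abs_mul]
    rcases Int.units_eq_one_or (x (i, s)) with h | h <;> simp [h]
  have hv : ∀ v, m * ((1 / 6) ^ k * sqrtInfluence J a v) ≤
      3 ^ k * ∑ x : Fin n × Fin 4 → ℤˣ,
        |pauliPartial J a v fun i s => 1 / 6 * ((x (i, s) : ℤ) : ℝ)| := by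
    intro v
    set Jv := J.filter fun P => P v.1 = v.2 ∧ v.2 ≠ 0 with hJv
    have hcard : ∀ P ∈ Jv, (pauliVars v.1 P).card ≤ k := fun P hP =>
      (card_pauliVars_le _ _).trans (hJ P (Finset.mem_filter.mp hP).1)
    have hinj : Set.InjOn (pauliVars v.1) Jv := by
      intro P hP Q hQ hPQ
      obtain ⟨-, hP1, hP2⟩ := Finset.mem_filter.mp hP
      obtain ⟨-, hQ1, -⟩ := Finset.mem_filter.mp hQ
      funext j
      by_cases hj : j = v.1
      · rw [hj, hP1, hQ1]
      by_cases hPj : P j = 0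
      · by_contra hne
        have h1 : (j, Q j) ∈ pauliVars v.1 Q :=
          mem_pauliVars.mpr ⟨hj, fun h => hne (hPj.trans h.symm), rfl⟩
        rw [← hPQ] at h1
        exact hne (mem_pauliVars.mp h1).2.2
      · have h1 : (j, P j) ∈ pauliVars v.1 P := mem_pauliVars.mpr ⟨hj, hPj, rfl⟩
        rw [hPQ] at h1
        exact (mem_pauliVars.mp h1).2.2.symm
    have h := sqrt_sum_sq_le_sum_abs_walshPoly Jv (pauliVars v.1) k
      (fun P => a P * (1 / 6) ^ (pauliVars v.1 P).card) hinj hcard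
    have h1 : ∀ x : Fin n × Fin 4 → ℤˣ,
        ∑ P ∈ Jv, a P * (1 / 6) ^ (pauliVars v.1 P).card * walsh (pauliVars v.1 P) x =
          pauliPartial J a v fun i s => 1 / 6 * ((x (i, s) : ℤ) : ℝ) := by
      intro x
      rw [pauliPartial]
      refine Finset.sum_congr rfl fun P _ => ?_
      rw [mul_assoc, ← prod_erase_eq_walsh]
    simp only [h1] at h
    refine le_trans ?_ h
    refine mul_le_mul_of_nonneg_left ?_ hm0.le
    rw [sqrtInfluence]
    refine Real.le_sqrt_of_sq_le ?_
    rw [mul_pow, Real.sq_sqrt (Finset.sum_nonneg fun _ _ => sq_nonneg _), Finset.mul_sum]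
    refine Finset.sum_le_sum fun P hP => ?_
    rw [mul_pow, mul_comm]
    refine mul_le_mul_of_nonneg_left ?_ (sq_nonneg _)
    exact pow_le_pow_left₀ (by positivity)
      (pow_le_pow_of_le_one (by norm_num) (by norm_num) (hcard P hP)) 2
  have hsum : m * ((1 / 6) ^ k * ∑ v, sqrtInfluence J a v) ≤ m * (3 ^ k * (12 * 5 ^ k * M)) := by
    calc m * ((1 / 6) ^ k * ∑ v, sqrtInfluence J a v)
        = ∑ v, m * ((1 / 6) ^ k * sqrtInfluence J a v) := by rw [Finset.mul_sum, Finset.mul_sum]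
      _ ≤ ∑ v, 3 ^ k * ∑ x : Fin n × Fin 4 → ℤˣ,
          |pauliPartial J a v fun i s => 1 / 6 * ((x (i, s) : ℤ) : ℝ)| :=
          Finset.sum_le_sum fun v _ => hv v
      _ = 3 ^ k * ∑ x : Fin n × Fin 4 → ℤˣ,
          ∑ v, |pauliPartial J a v fun i s => 1 / 6 * ((x (i, s) : ℤ) : ℝ)| := by
          rw [← Finset.mul_sum, Finset.sum_comm]
      _ ≤ 3 ^ k * ∑ _x : Fin n × Fin 4 → ℤˣ, 12 * 5 ^ k * M := by
          gcongr with x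
          exact hpt x
      _ = m * (3 ^ k * (12 * 5 ^ k * M)) := by
          rw [Finset.sum_const, Finset.card_univ, Fintype.card_fun, Fintype.card_units_int,
            nsmul_eq_mul]
          push_cast
          ring
  have h2 := le_of_mul_le_mul_left hsum hm0
  rw [one_div, inv_pow, inv_mul_le_iff₀ (by positivity)] at h2
  have h3 : (90 : ℝ) ^ k = 6 ^ k * (3 ^ k * 5 ^ k) := by
    rw [← mul_pow, ← mul_pow]; norm_num
  rw [h3]
  linarith

end Influence

/-! ### Small coefficients of a bounded low-degree observable -/

section SmallCoefficients

variable {n : ℕ}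

/-- Counting the operators of weight at most `d` built from a set `V` of single-qubit factors,
by the generating function `∑_P t ^ |P| = ∏_i (1 + t |V_i|) ≤ exp (t |V|)` at `t = 1 / |V|`. -/
lemma card_supported_le (V : Finset (Fin n × Fin 4)) (d : ℕ) {v : ℝ} (hv1 : 1 ≤ v)
    (hv : (V.card : ℝ) ≤ v) :
    ((Finset.univ.filter fun P : Fin n → Fin 4 =>
      pauliWeight P ≤ d ∧ ∀ i, P i ≠ 0 → (i, P i) ∈ V).card : ℝ) ≤ 3 * v ^ d := by
  set t : ℝ := v⁻¹ with ht
  have hv0 : 0 < v := by linarith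
  have ht0 : 0 < t := by positivity
  have ht1 : t ≤ 1 := inv_le_one_of_one_le₀ hv1
  set F := Finset.univ.filter fun P : Fin n → Fin 4 =>
      pauliWeight P ≤ d ∧ ∀ i, P i ≠ 0 → (i, P i) ∈ V with hF
  set w : Fin n → Fin 4 → ℝ := fun i q => if q = 0 then 1 else if (i, q) ∈ V then t else 0 with hw
  have hw0 : ∀ i q, 0 ≤ w i q := by
    intro i q; simp only [hw]; split_ifs <;> positivity
  have h1 : ∀ P ∈ F, t ^ d ≤ ∏ i, w i (P i) := by
    intro P hP
    obtain ⟨-, hP1, hP2⟩ := Finset.mem_filter.mp hP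
    have : ∏ i, w i (P i) = t ^ pauliWeight P := by
      rw [pauliWeight, ← Finset.prod_const, Finset.prod_filter]
      refine Finset.prod_congr rfl fun i _ => ?_
      by_cases h0 : P i = 0
      · simp [hw, h0]
      · simp [hw, h0, hP2 i h0]
    rw [this]
    exact pow_le_pow_of_le_one ht0.le ht1 hP1
  have h2 : ∏ i, ∑ q, w i q ≤ Real.exp 1 := by
    have e1 : ∀ i, ∑ q, w i q ≤ Real.exp (t * ∑ q : Fin 4, if (i, q) ∈ V then 1 else 0) := by
      intro i
      refine le_trans ?_ (Real.add_one_le_exp _)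
      rw [Fin.sum_univ_succ, Fin.sum_univ_succ (n := 3), add_comm, mul_add]
      have : ∀ q : Fin 3, w i q.succ = t * if (i, q.succ) ∈ V then 1 else 0 := by
        intro q; simp [hw, Fin.succ_ne_zero]
      simp only [this, ← Finset.mul_sum]
      have hnn : 0 ≤ t * (if (i, (0 : Fin 4)) ∈ V then 1 else 0) := by positivity
      simp only [hw, if_true]
      linarith
    calc ∏ i, ∑ q, w i q ≤ ∏ i, Real.exp (t * ∑ q : Fin 4, if (i, q) ∈ V then 1 else 0) :=
          Finset.prod_le_prod (fun i _ => Finset.sum_nonneg fun q _ => hw0 i q) fun i _ => e1 i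
      _ = Real.exp (t * V.card) := by
          rw [← Real.exp_sum, ← Finset.mul_sum, ← Fintype.sum_prod_type']
          congr 2
          simp
      _ ≤ Real.exp 1 := by
          refine Real.exp_le_exp.mpr ?_
          rw [ht, inv_mul_le_iff₀ hv0]
          linarith
  have h3 : (F.card : ℝ) * t ^ d ≤ 3 := by
    calc (F.card : ℝ) * t ^ d = ∑ _P ∈ F, t ^ d := by rw [Finset.sum_const, nsmul_eq_mul]
      _ ≤ ∑ P ∈ F, ∏ i, w i (P i) := Finset.sum_le_sum h1
      _ ≤ ∑ P : Fin n → Fin 4, ∏ i, w i (P i) := Finset.sum_le_sum_of_subset_of_nonneg (Finset.subset_univ _)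
          fun P _ _ => Finset.prod_nonneg fun i _ => hw0 i _
      _ = ∏ i, ∑ q, w i q := sum_pi_prod w
      _ ≤ Real.exp 1 := h2
      _ ≤ 3 := Real.exp_one_lt_three.le
  rw [ht, inv_pow, ← div_eq_mul_inv, div_le_iff₀ (by positivity)] at h3
  exact h3

lemma card_pauliWeight_le (hn : 1 ≤ n) (d : ℕ) :
    ((Finset.univ.filter fun P : Fin n → Fin 4 => pauliWeight P ≤ d).card : ℝ) ≤
      3 * (4 * n) ^ d := by
  have h := card_supported_le (n := n) Finset.univ d (v := 4 * n)
    (by have : (1 : ℝ) ≤ n := by exact_mod_cast hn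
        linarith) (by simp [mul_comm])
  simpa using h

/-- If the square roots of the influences sum to at most `S`, then the coefficients of weight at
most `d` and size at most `θ` carry little `ℓ²` weight: those involving a variable of influence
below `σ ^ 2` contribute at most `σ S`, and at most `S / σ` variables remain. -/
lemma sum_small_coeff_sq_le {J U : Finset (Fin n → Fin 4)} {a : (Fin n → Fin 4) → ℝ} {d : ℕ}
    {S σ v θ : ℝ} (hUJ : U ⊆ J) (hU : ∀ P ∈ U, pauliWeight P ≤ d)
    (hθ : ∀ P ∈ U, a P ^ 2 ≤ θ) (hθ0 : 0 ≤ θ) (hS : ∑ v, sqrtInfluence J a v ≤ S) (hσ : 0 < σ)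
    (hv1 : 1 ≤ v) (hv : S ≤ v * σ) :
    ∑ P ∈ U, a P ^ 2 ≤ σ * S + 3 * v ^ d * θ := by
  classical
  set V := Finset.univ.filter fun w => σ ≤ sqrtInfluence J a w with hV
  have hI0 : ∀ w, 0 ≤ sqrtInfluence J a w := fun w => Real.sqrt_nonneg _
  have hVcard : (V.card : ℝ) ≤ v := by
    have h1 : (V.card : ℝ) * σ ≤ S := by
      calc (V.card : ℝ) * σ = ∑ _w ∈ V, σ := by rw [Finset.sum_const, nsmul_eq_mul]
        _ ≤ ∑ w ∈ V, sqrtInfluence J a w :=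
            Finset.sum_le_sum fun w hw => (Finset.mem_filter.mp hw).2
        _ ≤ ∑ w, sqrtInfluence J a w :=
            Finset.sum_le_sum_of_subset_of_nonneg (Finset.subset_univ _) fun w _ _ => hI0 w
        _ ≤ S := hS
    exact le_of_mul_le_mul_right (h1.trans hv) hσ
  rw [← Finset.sum_filter_add_sum_filter_not U fun P => ∀ i, P i ≠ 0 → (i, P i) ∈ V, add_comm]
  refine add_le_add ?_ ?_
  · have h1 : ∑ P ∈ U with ¬ ∀ i, P i ≠ 0 → (i, P i) ∈ V, a P ^ 2 ≤
        ∑ w ∈ Vᶜ, ∑ P ∈ J with P w.1 = w.2 ∧ w.2 ≠ 0, a P ^ 2 := by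
      simp only [Finset.sum_filter (s := J)]
      rw [Finset.sum_comm]
      refine (Finset.sum_le_sum fun P hP => ?_).trans (Finset.sum_le_sum_of_subset_of_nonneg
        ((Finset.filter_subset _ U).trans hUJ) fun P _ _ => Finset.sum_nonneg fun w _ => ?_)
      · have hP2 := (Finset.mem_filter.mp hP).2
        push Not at hP2
        obtain ⟨i, hi0, hiV⟩ := hP2
        have h2 := Finset.single_le_sum
          (f := fun w : Fin n × Fin 4 => if P w.1 = w.2 ∧ w.2 ≠ 0 then a P ^ 2 else 0)
          (fun w _ => by split_ifs <;> positivity) (Finset.mem_compl.mpr hiV)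
        simpa [hi0] using h2
      · split_ifs <;> positivity
    refine h1.trans ?_
    calc ∑ w ∈ Vᶜ, ∑ P ∈ J with P w.1 = w.2 ∧ w.2 ≠ 0, a P ^ 2
        = ∑ w ∈ Vᶜ, sqrtInfluence J a w * sqrtInfluence J a w :=
          Finset.sum_congr rfl fun w _ =>
            (Real.mul_self_sqrt (Finset.sum_nonneg fun _ _ => sq_nonneg _)).symm
      _ ≤ ∑ w ∈ Vᶜ, σ * sqrtInfluence J a w := by
          refine Finset.sum_le_sum fun w hw => mul_le_mul_of_nonneg_right ?_ (hI0 w)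
          have : ¬ σ ≤ sqrtInfluence J a w := by simpa [hV] using hw
          exact (not_le.mp this).le
      _ ≤ ∑ w, σ * sqrtInfluence J a w :=
          Finset.sum_le_sum_of_subset_of_nonneg (Finset.subset_univ _) fun w _ _ =>
            mul_nonneg hσ.le (hI0 w)
      _ ≤ σ * S := by rw [← Finset.mul_sum]; gcongr
  · calc ∑ P ∈ U with ∀ i, P i ≠ 0 → (i, P i) ∈ V, a P ^ 2
        ≤ ∑ P ∈ U with ∀ i, P i ≠ 0 → (i, P i) ∈ V, θ :=
          Finset.sum_le_sum fun P hP => hθ P (Finset.mem_filter.mp hP).1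
      _ = ((U.filter fun P => ∀ i, P i ≠ 0 → (i, P i) ∈ V).card : ℝ) * θ := by
          rw [Finset.sum_const, nsmul_eq_mul]
      _ ≤ 3 * v ^ d * θ := by
          refine mul_le_mul_of_nonneg_right (le_trans ?_ (card_supported_le V d hv1 hVcard)) hθ0
          exact_mod_cast Finset.card_le_card fun P hP => by
            obtain ⟨h1, h2⟩ := Finset.mem_filter.mp hP
            exact Finset.mem_filter.mpr ⟨Finset.mem_univ _, hU P h1, h2⟩

end SmallCoefficients

/-! ### Concentration of empirical means -/

section Concentration

variable {Ω : Type*} [MeasurableSpace Ω]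

/-- Hoeffding's inequality for the empirical mean of a bounded function. -/
lemma measure_pi_abs_sum_sub_gt_le (D : Measure Ω) [IsProbabilityMeasure D] {f : Ω → ℝ}
    (hf : Measurable f) {b γ : ℝ} (hb : ∀ x, |f x| ≤ b) (hγ : 0 ≤ γ) (N : ℕ) :
    (Measure.pi fun _ : Fin N => D) {x | N * (γ * b) < |∑ l, f (x l) - N * ∫ y, f y ∂D|} ≤
      ENNReal.ofReal (2 * Real.exp (-(N * γ ^ 2 / 2))) := by
  obtain ⟨x0⟩ : Nonempty Ω := D.nonempty_of_neZero
  have hb0 : 0 ≤ b := (abs_nonneg _).trans (hb x0)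
  rcases hb0.eq_or_lt with h0 | hbpos
  · have hf0 : ∀ x, f x = 0 := fun x => abs_nonpos_iff.mp ((hb x).trans h0.symm.le)
    simp [hf0, ← h0]
  set μ := Measure.pi fun _ : Fin N => D
  have one : ∀ g : Ω → ℝ, Measurable g → (∀ x, |g x| ≤ b) →
      μ {x | N * (γ * b) ≤ ∑ l, (g (x l) - ∫ y, g y ∂D)} ≤
        ENNReal.ofReal (Real.exp (-(N * γ ^ 2 / 2))) := by
    intro g hg hgb
    have hind : ProbabilityTheory.iIndepFun (fun (l : Fin N) (x : Fin N → Ω) =>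
        g (x l) - ∫ y, g y ∂D) μ :=
      ProbabilityTheory.iIndepFun_pi (X := fun _ x => g x - ∫ y, g y ∂D) fun _ =>
        (hg.sub_const _).aemeasurable
    have hsub : ∀ l ∈ (Finset.univ : Finset (Fin N)), ProbabilityTheory.HasSubgaussianMGF
        (fun x : Fin N → Ω => g (x l) - ∫ y, g y ∂D) ((‖b - -b‖₊ / 2) ^ 2) μ := by
      intro l _
      have h1 := ProbabilityTheory.hasSubgaussianMGF_of_mem_Icc (μ := μ) (a := -b) (b := b)
        (X := fun x => g (x l)) (hg.comp (measurable_pi_apply l)).aemeasurable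
        (Filter.Eventually.of_forall fun x => abs_le.mp (hgb (x l)))
      have h2 : ∫ x, g (x l) ∂μ = ∫ y, g y ∂D :=
        integral_comp_eval (μ := fun _ : Fin N => D) hg.aestronglyMeasurable
      rwa [h2] at h1
    have h := ProbabilityTheory.HasSubgaussianMGF.measure_sum_ge_le_of_iIndepFun hind hsub
      (ε := N * (γ * b)) (by positivity)
    rw [← ofReal_measureReal]
    refine ENNReal.ofReal_le_ofReal (h.trans ?_)
    rw [Real.exp_le_exp]
    have hc : (((‖b - -b‖₊ / 2) ^ 2 : NNReal) : ℝ) = b ^ 2 := by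
      push_cast
      rw [Real.norm_eq_abs, sub_neg_eq_add, abs_of_pos (by linarith)]
      ring
    simp only [Finset.sum_const, Finset.card_univ, Fintype.card_fin, nsmul_eq_mul]
    push_cast
    push_cast at hc
    rw [hc]
    rcases Nat.eq_zero_or_pos N with hN | hN
    · simp [hN]
    · have hN' : (0 : ℝ) < N := by exact_mod_cast hN
      apply le_of_eq
      field_simp
  have h1 := one f hf hb
  have h2 := one (fun x => -f x) hf.neg fun x => by rw [abs_neg]; exact hb x
  calc μ {x | N * (γ * b) < |∑ l, f (x l) - N * ∫ y, f y ∂D|}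
      ≤ μ ({x | N * (γ * b) ≤ ∑ l, (f (x l) - ∫ y, f y ∂D)} ∪
          {x | N * (γ * b) ≤ ∑ l, (-f (x l) - ∫ y, -f y ∂D)}) := by
        refine measure_mono fun x hx => ?_
        simp only [Set.mem_ofPred_eq, Set.mem_union, Finset.sum_sub_distrib, Finset.sum_const,
          Finset.card_univ, Fintype.card_fin, nsmul_eq_mul, Finset.sum_neg_distrib,
          integral_neg] at hx ⊢
        rcases lt_abs.mp hx with h | h
        · exact Or.inl h.le
        · right; linarith
    _ ≤ _ := measure_union_le _ _
    _ ≤ ENNReal.ofReal (Real.exp (-(N * γ ^ 2 / 2))) +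
          ENNReal.ofReal (Real.exp (-(N * γ ^ 2 / 2))) := add_le_add h1 h2
    _ = _ := by
        rw [← ENNReal.ofReal_add (Real.exp_pos _).le (Real.exp_pos _).le, two_mul]

/-- The exponential Markov inequality for a sum of independent copies. -/
lemma measure_pi_sum_ge_le (D : Measure Ω) [IsProbabilityMeasure D] {f : Ω → ℝ}
    (hf : Measurable f) {b : ℝ} (hb : ∀ x, |f x| ≤ b) (N : ℕ) (c : ℝ) :
    (Measure.pi fun _ : Fin N => D) {x | c ≤ ∑ l, f (x l)} ≤
      ENNReal.ofReal (Real.exp (-c) * (∫ y, Real.exp (f y) ∂D) ^ N) := by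
  set μ := Measure.pi fun _ : Fin N => D
  have hint : Integrable (fun x : Fin N → Ω => ∏ l, Real.exp (f (x l))) μ := by
    refine integrable_of_abs_le ?_ (∏ _l : Fin N, Real.exp b) fun x => ?_
    · exact Finset.measurable_prod _ fun l _ =>
        Real.measurable_exp.comp (hf.comp (measurable_pi_apply l))
    · rw [Finset.abs_prod]
      refine Finset.prod_le_prod (fun _ _ => abs_nonneg _) fun l _ => ?_
      rw [abs_of_pos (Real.exp_pos _)]
      exact Real.exp_le_exp.mpr ((le_abs_self _).trans (hb _))
  have h := mul_meas_ge_le_integral_of_nonneg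
    (Filter.Eventually.of_forall fun x => Finset.prod_nonneg fun l _ => (Real.exp_pos _).le)
    hint (Real.exp c)
  rw [integral_fintype_prod_eq_pow (fun y => Real.exp (f y)), Fintype.card_fin] at h
  rw [← ofReal_measureReal]
  refine ENNReal.ofReal_le_ofReal ?_
  have hset : {x : Fin N → Ω | Real.exp c ≤ ∏ l, Real.exp (f (x l))} =
      {x | c ≤ ∑ l, f (x l)} := by
    ext x
    simp only [Set.mem_ofPred_eq, ← Real.exp_sum, Real.exp_le_exp]
  rw [hset] at h
  rw [Real.exp_neg, le_inv_mul_iff₀ (Real.exp_pos _)]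
  exact h

end Concentration

/-! ### Sparse estimation of the Pauli coefficients -/

section Estimator

/-- A set of `K` elements (or all of them, if there are fewer) with the largest scores. -/
lemma exists_largest_subset {κ : Type*} [DecidableEq κ] (F : Finset κ) (s : κ → ℝ) (K : ℕ) :
    ∃ T ⊆ F, T.card ≤ K ∧ ∀ Q ∈ F \ T, T.card = K ∧ ∀ P ∈ T, s Q ≤ s P := by
  have hne : (F.powersetCard (min K F.card)).Nonempty :=
    Finset.powersetCard_nonempty.mpr (min_le_right _ _)
  obtain ⟨T, hT, hmax⟩ := Finset.exists_max_image _ (fun T => ∑ P ∈ T, s P) hne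
  obtain ⟨hTF, hTc⟩ := Finset.mem_powersetCard.mp hT
  refine ⟨T, hTF, hTc ▸ min_le_left _ _, fun Q hQ => ?_⟩
  obtain ⟨hQF, hQT⟩ := Finset.mem_sdiff.mp hQ
  have hlt : T.card < F.card := Finset.card_lt_card
    (Finset.ssubset_iff_subset_ne.mpr ⟨hTF, fun h => hQT (h ▸ hQF)⟩)
  refine ⟨by omega, fun P hP => ?_⟩
  have hQ' : Q ∉ T.erase P := fun h => hQT (Finset.mem_of_mem_erase h)
  have h := hmax (insert Q (T.erase P)) (Finset.mem_powersetCard.mpr ⟨?_, ?_⟩)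
  · rw [Finset.sum_insert hQ', ← Finset.add_sum_erase T s hP] at h
    linarith
  · exact Finset.insert_subset hQF ((Finset.erase_subset _ _).trans hTF)
  · rw [Finset.card_insert_of_notMem hQ', Finset.card_erase_add_one hP, hTc]

variable {n : ℕ}

/-- The operators of weight at most `d` whose estimated second moment exceeds `τ`. -/
noncomputable def candidates (d : ℕ) (τ : ℝ) (w : (Fin n → Fin 4) → ℝ) : Finset (Fin n → Fin 4) :=
  Finset.univ.filter fun P => pauliWeight P ≤ d ∧ τ < w P

/-- The `K` candidates with the largest coefficient estimates `x P / w P` in absolute value. -/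
noncomputable def selected (d K : ℕ) (τ : ℝ) (x w : (Fin n → Fin 4) → ℝ) :
    Finset (Fin n → Fin 4) :=
  (exists_largest_subset (candidates d τ w) (fun P => (x P / w P) ^ 2) K).choose

/-- The sparse coefficient estimate: `x P / w P` on the selected operators and zero elsewhere.
Selecting by rank makes the estimate independent of the scale of the observable. -/
noncomputable def sparseCoeff (d K : ℕ) (τ : ℝ) (x w : (Fin n → Fin 4) → ℝ)
    (P : Fin n → Fin 4) : ℝ :=
  if P ∈ selected d K τ x w then x P / w P else 0

/-- The error of the sparse estimate, given estimates `x'` of `a P * w P` and `w'` of `w P`. The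
error splits into the operators of weight above `d`, those with small second moment, the selected
ones, and the candidates `U` that were not selected, whose coefficients are small. -/
lemma sparseCoeff_error {d K : ℕ} {τ γ B : ℝ} {a w x' w' : (Fin n → Fin 4) → ℝ} (hτ : 0 < τ)
    (hγ : 0 ≤ γ) (hB : 0 ≤ B) (ha : ∑ P, a P ^ 2 ≤ B ^ 2) (hw0 : ∀ P, 0 ≤ w P)
    (hw : ∀ P, w P ≤ (2 / 3 : ℝ) ^ pauliWeight P)
    (hx' : ∀ P, pauliWeight P ≤ d → |x' P - a P * w P| ≤ γ * B)
    (hw' : ∀ P, pauliWeight P ≤ d → |w' P - w P| ≤ γ) :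
    ∃ U : Finset (Fin n → Fin 4), (∀ P ∈ U, pauliWeight P ≤ d) ∧
      (∀ P ∈ U, K * a P ^ 2 ≤ (4 + 6 * K * (2 * γ / τ) ^ 2) * B ^ 2) ∧
      ((Finset.univ.filter fun P : Fin n → Fin 4 => pauliWeight P ≤ d).card ≤ K → U = ∅) ∧
      ∑ P, (sparseCoeff d K τ x' w' P - a P) ^ 2 * w P ≤
        ((2 / 3 : ℝ) ^ (d + 1) + (τ + γ) + K * (2 * γ / τ) ^ 2) * B ^ 2 + ∑ P ∈ U, a P ^ 2 := by
  classical
  set F := candidates d τ w' with hF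
  set T := selected d K τ x' w' with hT
  obtain ⟨hTF, hTK, hTU⟩ :=
    (exists_largest_subset F (fun P => (x' P / w' P) ^ 2) K).choose_spec
  change T ⊆ F at hTF
  change T.card ≤ K at hTK
  change ∀ Q ∈ F \ T, T.card = K ∧ ∀ P ∈ T, (x' Q / w' Q) ^ 2 ≤ (x' P / w' P) ^ 2 at hTU
  set η := 2 * γ / τ with hη
  have hη0 : 0 ≤ η := by positivity
  have hmemF : ∀ P ∈ F, pauliWeight P ≤ d ∧ τ < w' P := fun P hP => (Finset.mem_filter.mp hP).2
  have haB : ∀ P, |a P| ≤ B := fun P => by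
    refine abs_le_of_sq_le_sq ?_ hB
    exact (Finset.single_le_sum (f := fun P => a P ^ 2) (fun _ _ => sq_nonneg _)
      (Finset.mem_univ P)).trans ha
  have hest : ∀ P ∈ F, |x' P / w' P - a P| ≤ η * B := by
    intro P hP
    obtain ⟨hPd, hPτ⟩ := hmemF P hP
    have hw'0 : 0 < w' P := hτ.trans hPτ
    have e : x' P / w' P - a P = ((x' P - a P * w P) - a P * (w' P - w P)) / w' P := by
      field_simp
      ring
    rw [e, abs_div, abs_of_pos hw'0, div_le_iff₀ hw'0]
    have h1 : |x' P - a P * w P - a P * (w' P - w P)| ≤ γ * B + B * γ := by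
      refine (abs_sub _ _).trans (add_le_add (hx' P hPd) ?_)
      rw [abs_mul]
      exact mul_le_mul (haB P) (hw' P hPd) (abs_nonneg _) hB
    have h2 : η * B * τ ≤ η * B * w' P := mul_le_mul_of_nonneg_left hPτ.le (by positivity)
    have h3 : η * B * τ = 2 * γ * B := by rw [hη]; field_simp
    linarith
  refine ⟨F \ T, fun P hP => (hmemF P (Finset.mem_sdiff.mp hP).1).1, ?_, ?_, ?_⟩
  · intro Q hQ
    obtain ⟨hcard, hmin⟩ := hTU Q hQ
    have hQF := (Finset.mem_sdiff.mp hQ).1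
    have h1 : (K : ℝ) * (x' Q / w' Q) ^ 2 ≤ ∑ P ∈ T, (x' P / w' P) ^ 2 := by
      calc (K : ℝ) * (x' Q / w' Q) ^ 2 = ∑ _P ∈ T, (x' Q / w' Q) ^ 2 := by
            rw [Finset.sum_const, nsmul_eq_mul, hcard]
        _ ≤ _ := Finset.sum_le_sum hmin
    have h2 : ∑ P ∈ T, (x' P / w' P) ^ 2 ≤ 2 * B ^ 2 + 2 * (K * (η * B) ^ 2) := by
      calc ∑ P ∈ T, (x' P / w' P) ^ 2 ≤ ∑ P ∈ T, (2 * a P ^ 2 + 2 * (η * B) ^ 2) := by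
            refine Finset.sum_le_sum fun P hP => ?_
            have h3 := sq_le_sq' (abs_le.mp (hest P (hTF hP))).1 (abs_le.mp (hest P (hTF hP))).2
            nlinarith [sq_nonneg (x' P / w' P - a P - a P)]
        _ = 2 * ∑ P ∈ T, a P ^ 2 + 2 * (K * (η * B) ^ 2) := by
            rw [Finset.sum_add_distrib, ← Finset.mul_sum, Finset.sum_const, nsmul_eq_mul, hcard]
            ring
        _ ≤ 2 * B ^ 2 + 2 * (K * (η * B) ^ 2) := by
            have h3 : ∑ P ∈ T, a P ^ 2 ≤ ∑ P, a P ^ 2 :=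
              Finset.sum_le_sum_of_subset_of_nonneg (Finset.subset_univ _) fun _ _ _ => sq_nonneg _
            linarith
    have h3 : a Q ^ 2 ≤ 2 * (x' Q / w' Q) ^ 2 + 2 * (η * B) ^ 2 := by
      have h3 := sq_le_sq' (abs_le.mp (hest Q hQF)).1 (abs_le.mp (hest Q hQF)).2
      nlinarith [sq_nonneg (x' Q / w' Q + (x' Q / w' Q - a Q))]
    have hK0 : (0 : ℝ) ≤ K := Nat.cast_nonneg K
    calc (K : ℝ) * a Q ^ 2 ≤ K * (2 * (x' Q / w' Q) ^ 2 + 2 * (η * B) ^ 2) := by gcongr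
      _ ≤ (4 + 6 * K * η ^ 2) * B ^ 2 := by nlinarith
  · intro hK
    by_contra hne
    obtain ⟨Q, hQ⟩ := Finset.nonempty_iff_ne_empty.mpr hne
    have h1 := (hTU Q hQ).1
    obtain ⟨hQF, hQT⟩ := Finset.mem_sdiff.mp hQ
    have hlt : T.card < F.card := Finset.card_lt_card
      (Finset.ssubset_iff_subset_ne.mpr ⟨hTF, fun h => hQT (h ▸ hQF)⟩)
    have hle : F.card ≤ (Finset.univ.filter fun P : Fin n → Fin 4 => pauliWeight P ≤ d).card :=
      Finset.card_le_card fun P hP =>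
        Finset.mem_filter.mpr ⟨Finset.mem_univ _, (hmemF P hP).1⟩
    omega
  · have hw1 : ∀ P, w P ≤ 1 := fun P => (hw P).trans (pow_le_one₀ (by norm_num) (by norm_num))
    have hpt : ∀ P, (sparseCoeff d K τ x' w' P - a P) ^ 2 * w P ≤
        ((2 / 3 : ℝ) ^ (d + 1) + (τ + γ)) * a P ^ 2 + (if P ∈ T then (η * B) ^ 2 else 0) +
          (if P ∈ F \ T then a P ^ 2 else 0) := by
      intro P
      have hd0 : (0 : ℝ) ≤ (2 / 3) ^ (d + 1) := by positivity
      have ha0 : 0 ≤ a P ^ 2 := sq_nonneg _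
      by_cases hPT : P ∈ T
      · rw [sparseCoeff, if_pos hPT, if_pos hPT, if_neg (by simp [hPT])]
        have h3 := sq_le_sq' (abs_le.mp (hest P (hTF hPT))).1 (abs_le.mp (hest P (hTF hPT))).2
        have h4 : (x' P / w' P - a P) ^ 2 * w P ≤ (η * B) ^ 2 * 1 :=
          mul_le_mul h3 (hw1 P) (hw0 P) (sq_nonneg _)
        have : 0 ≤ ((2 / 3 : ℝ) ^ (d + 1) + (τ + γ)) * a P ^ 2 := by positivity
        linarith
      · rw [sparseCoeff, if_neg hPT, if_neg hPT, zero_sub, neg_sq]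
        by_cases hPF : P ∈ F
        · rw [if_pos (Finset.mem_sdiff.mpr ⟨hPF, hPT⟩)]
          have h4 : a P ^ 2 * w P ≤ a P ^ 2 * 1 := mul_le_mul_of_nonneg_left (hw1 P) ha0
          have : 0 ≤ ((2 / 3 : ℝ) ^ (d + 1) + (τ + γ)) * a P ^ 2 := by positivity
          linarith
        · rw [if_neg fun h => hPF (Finset.mem_sdiff.mp h).1, add_zero, add_zero, mul_comm]
          refine mul_le_mul_of_nonneg_right ?_ ha0
          by_cases hPd : pauliWeight P ≤ d
          · have h5 : w' P ≤ τ := by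
              by_contra hcon
              exact hPF (Finset.mem_filter.mpr ⟨Finset.mem_univ _, hPd, not_le.mp hcon⟩)
            have := (abs_le.mp (hw' P hPd)).1
            linarith
          · have h5 : w P ≤ (2 / 3 : ℝ) ^ (d + 1) :=
              (hw P).trans (pow_le_pow_of_le_one (by norm_num) (by norm_num) (by omega))
            linarith
    refine (Finset.sum_le_sum fun P _ => hpt P).trans ?_
    rw [Finset.sum_add_distrib, Finset.sum_add_distrib, ← Finset.mul_sum, Finset.sum_ite_mem,
      Finset.sum_ite_mem, Finset.univ_inter, Finset.univ_inter, Finset.sum_const, nsmul_eq_mul]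
    have h1 : ((2 / 3 : ℝ) ^ (d + 1) + (τ + γ)) * ∑ P, a P ^ 2 ≤
        ((2 / 3 : ℝ) ^ (d + 1) + (τ + γ)) * B ^ 2 := by gcongr
    have h2 : (T.card : ℝ) * (η * B) ^ 2 ≤ K * (η * B) ^ 2 := by gcongr
    have h3 : (K : ℝ) * (η * B) ^ 2 = K * η ^ 2 * B ^ 2 := by ring
    linarith

/-- The empirical mean of `y Tr(P ρ)` over the data. -/
noncomputable def empiricalCorrelation {N : ℕ} (data : Fin N → QState n × ℝ)
    (P : Fin n → Fin 4) : ℝ :=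
  (∑ l, (data l).2 * pauliVal P (data l).1) / N

/-- The empirical mean of `Tr(P ρ)²` over the data. -/
noncomputable def empiricalMoment {N : ℕ} (data : Fin N → QState n × ℝ)
    (P : Fin n → Fin 4) : ℝ :=
  (∑ l, pauliVal P (data l).1 ^ 2) / N

/-- The learning rule with degree cutoff `d`, sparsity `K` and moment threshold `τ`. -/
noncomputable def sparseLearner {N : ℕ} (d K : ℕ) (τ : ℝ) (data : Fin N → QState n × ℝ) :
    Observable n × ℝ :=
  modelOfCoeff (sparseCoeff d K τ (empiricalCorrelation data) (empiricalMoment data))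

lemma integral_expVal_mul_pauliVal {D : Measure (QState n)} [IsProbabilityMeasure D]
    (hD : InvariantUnderHS D) (O : Observable n) (P : Fin n → Fin 4) :
    ∫ ρ, expVal O ρ * pauliVal P ρ ∂D = realCoeff O.1 P * pauliMoment D P P := by
  have h := integral_sum_mul_sum hD (realCoeff O.1) (fun Q => if Q = P then 1 else 0)
  simp only [← expVal_eq_sum] at h
  simpa using h

/-- With high probability the empirical correlations and moments of all operators of weight at most
`d` are accurate. -/
lemma measure_inaccurate_le {D : Measure (QState n)} [IsProbabilityMeasure D]
    (hD : InvariantUnderHS D) (hn : 1 ≤ n) (O : Observable n) (d : ℕ) {γ : ℝ} (hγ : 0 ≤ γ)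
    {N : ℕ} (hN : 0 < N) :
    (Measure.pi fun _ : Fin N => D) {ρs | ¬ ∀ P, pauliWeight P ≤ d →
        |empiricalCorrelation (trainingData O ρs) P - realCoeff O.1 P * pauliMoment D P P| ≤
          γ * specNorm O.1 ∧
        |empiricalMoment (trainingData O ρs) P - pauliMoment D P P| ≤ γ} ≤
      ENNReal.ofReal (12 * (4 * n) ^ d * Real.exp (-(N * γ ^ 2 / 2))) := by
  have hN' : (0 : ℝ) < N := by exact_mod_cast hN
  set F := Finset.univ.filter fun P : Fin n → Fin 4 => pauliWeight P ≤ d with hF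
  set e := Real.exp (-(N * γ ^ 2 / 2)) with he
  have he0 : 0 < e := Real.exp_pos _
  set μ := Measure.pi fun _ : Fin N => D
  have hmean : ∀ s m b : ℝ, ¬ |s / N - m| ≤ b → N * b < |s - N * m| := by
    intro s m b h
    have e1 : s - N * m = N * (s / N - m) := by field_simp
    rw [e1, abs_mul, abs_of_pos hN']
    exact mul_lt_mul_of_pos_left (not_le.mp h) hN'
  set bad1 : (Fin n → Fin 4) → Set (Fin N → QState n) := fun P =>
    {ρs | N * (γ * specNorm O.1) < |∑ l, expVal O (ρs l) * pauliVal P (ρs l) -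
      N * ∫ ρ, expVal O ρ * pauliVal P ρ ∂D|} with hbad1
  set bad2 : (Fin n → Fin 4) → Set (Fin N → QState n) := fun P =>
    {ρs | N * (γ * 1) < |∑ l, pauliVal P (ρs l) * pauliVal P (ρs l) -
      N * ∫ ρ, pauliVal P ρ * pauliVal P ρ ∂D|} with hbad2
  have h1 : ∀ P, μ (bad1 P) ≤ ENNReal.ofReal (2 * e) := by
    intro P
    refine measure_pi_abs_sum_sub_gt_le D (f := fun ρ => expVal O ρ * pauliVal P ρ)
      ((measurable_expVal O).mul (measurable_pauliVal P)) (fun ρ => ?_) hγ N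
    rw [abs_mul]
    exact (mul_le_of_le_one_right (abs_nonneg _) (abs_pauliVal_le P ρ)).trans (abs_expVal_le O ρ)
  have h2 : ∀ P, μ (bad2 P) ≤ ENNReal.ofReal (2 * e) := by
    intro P
    refine measure_pi_abs_sum_sub_gt_le D (f := fun ρ => pauliVal P ρ * pauliVal P ρ)
      ((measurable_pauliVal P).mul (measurable_pauliVal P)) (fun ρ => ?_) hγ N
    rw [abs_mul]
    exact mul_le_one₀ (abs_pauliVal_le P ρ) (abs_nonneg _) (abs_pauliVal_le P ρ)
  calc μ {ρs | ¬ ∀ P, pauliWeight P ≤ d →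
        |empiricalCorrelation (trainingData O ρs) P - realCoeff O.1 P * pauliMoment D P P| ≤
          γ * specNorm O.1 ∧
        |empiricalMoment (trainingData O ρs) P - pauliMoment D P P| ≤ γ}
      ≤ μ (⋃ P ∈ F, (bad1 P ∪ bad2 P)) := by
        refine measure_mono fun ρs hρs => ?_
        simp only [Set.mem_ofPred_eq, not_forall] at hρs
        obtain ⟨P, hPd, hP⟩ := hρs
        refine Set.mem_biUnion (Finset.mem_filter.mpr ⟨Finset.mem_univ P, hPd⟩) ?_
        rcases not_and_or.mp hP with h | h
        · left
          have := hmean _ _ _ h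
          rw [← integral_expVal_mul_pauliVal hD] at this
          exact this
        · right
          have := hmean _ _ _ h
          simp only [hbad2, Set.mem_ofPred_eq, mul_one]
          simp only [sq] at this
          exact this
    _ ≤ ∑ P ∈ F, μ (bad1 P ∪ bad2 P) := measure_biUnion_finset_le _ _
    _ ≤ ∑ _P ∈ F, ENNReal.ofReal (4 * e) := by
        refine Finset.sum_le_sum fun P _ => (measure_union_le _ _).trans ?_
        refine (add_le_add (h1 P) (h2 P)).trans (le_of_eq ?_)
        rw [← ENNReal.ofReal_add (by positivity) (by positivity)]
        congr 1
        ring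
    _ = ENNReal.ofReal (F.card * (4 * e)) := by
        rw [Finset.sum_const, nsmul_eq_mul, ENNReal.ofReal_mul (Nat.cast_nonneg _),
          ENNReal.ofReal_natCast]
    _ ≤ _ := by
        refine ENNReal.ofReal_le_ofReal ?_
        have := card_pauliWeight_le hn d
        nlinarith

/-- The sample size that makes the union bound over the operators of weight at most `d` succeed;
`n ≥ 2` and `δ ≤ 1` let `log (n / δ)` absorb the constants. -/
lemma mul_exp_le_of_sample_size {n : ℕ} (hn : 2 ≤ n) {δ γ : ℝ} (hδ : 0 < δ) (hδ1 : δ ≤ 1)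
    (hγ : 0 < γ) (d : ℕ) {N : ℕ}
    (hN : Real.log (n / δ) * (2 * (5 + 3 * d) / γ ^ 2) ≤ N) :
    12 * (4 * (n : ℝ)) ^ d * Real.exp (-(N * γ ^ 2 / 2)) ≤ δ := by
  have hn0 : (2 : ℝ) ≤ n := by exact_mod_cast hn
  have hlogδ : 0 ≤ -Real.log δ := by
    have := Real.log_nonpos hδ.le hδ1; linarith
  have hlog : Real.log (n / δ) = Real.log n - Real.log δ := Real.log_div (by linarith) hδ.ne'
  have hlog2 : Real.log 2 ≤ Real.log n := Real.log_le_log (by norm_num) hn0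
  have h2 : 0 < Real.log 2 := Real.log_pos (by norm_num)
  have h12 : Real.log 12 ≤ 4 * Real.log 2 := by
    have : (4 : ℝ) * Real.log 2 = Real.log (2 ^ 4) := by rw [Real.log_pow]; norm_num
    rw [this]
    exact Real.log_le_log (by norm_num) (by norm_num)
  have h4n : Real.log (4 * n) ≤ 3 * Real.log n := by
    rw [Real.log_mul (by norm_num) (by linarith)]
    have : Real.log 4 = 2 * Real.log 2 := by
      rw [show (4 : ℝ) = 2 ^ 2 by norm_num, Real.log_pow]; norm_num
    linarith
  have h5 : Real.log (n / δ) * (5 + 3 * d) ≤ N * γ ^ 2 / 2 := by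
    rw [mul_div_assoc', div_le_iff₀ (by positivity)] at hN
    linarith
  have hpos : 0 < 12 * (4 * (n : ℝ)) ^ d := by positivity
  have h6 : Real.log (12 * (4 * (n : ℝ)) ^ d) ≤ Real.log δ + N * γ ^ 2 / 2 := by
    rw [Real.log_mul (by norm_num) (by positivity), Real.log_pow]
    have hd0 : (0 : ℝ) ≤ d := Nat.cast_nonneg d
    have h7 : (d : ℝ) * Real.log (4 * n) ≤ d * (3 * Real.log n) := by gcongr
    have h8 : Real.log (n / δ) * (5 + 3 * d) =
        5 * Real.log n + 3 * d * Real.log n + (5 + 3 * d) * -Real.log δ := by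
      rw [hlog]; ring
    nlinarith [mul_nonneg hd0 hlogδ]
  calc 12 * (4 * (n : ℝ)) ^ d * Real.exp (-(N * γ ^ 2 / 2))
      = Real.exp (Real.log (12 * (4 * (n : ℝ)) ^ d) + -(N * γ ^ 2 / 2)) := by
        rw [Real.exp_add, Real.exp_log hpos]
    _ ≤ Real.exp (Real.log δ) := Real.exp_le_exp.mpr (by linarith)
    _ = δ := Real.exp_log hδ

/-- The guarantee of the sparse learner, up to the contribution of the unselected candidates. -/
lemma sparseLearner_guarantee (hn : 2 ≤ n) {δ γ τ : ℝ} (hδ : 0 < δ) (hδ1 : δ ≤ 1) (hγ : 0 < γ)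
    (hτ : 0 < τ) (d K : ℕ) {N : ℕ}
    (hN : Real.log (n / δ) * (2 * (5 + 3 * d) / γ ^ 2) ≤ N) (O : Observable n)
    (D : Measure (QState n)) [IsProbabilityMeasure D] (hD : InvariantUnderHS D) (rhs : ℝ)
    (hrhs : ∀ U : Finset (Fin n → Fin 4), (∀ P ∈ U, pauliWeight P ≤ d) →
      (∀ P ∈ U, K * realCoeff O.1 P ^ 2 ≤
        (4 + 6 * K * (2 * γ / τ) ^ 2) * specNorm O.1 ^ 2) →
      ((Finset.univ.filter fun P : Fin n → Fin 4 => pauliWeight P ≤ d).card ≤ K → U = ∅) →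
      ((2 / 3 : ℝ) ^ (d + 1) + (τ + γ) + K * (2 * γ / τ) ^ 2) * specNorm O.1 ^ 2 +
        ∑ P ∈ U, realCoeff O.1 P ^ 2 ≤ rhs) :
    (Measure.pi fun _ : Fin N => D) {ρs : Fin N → QState n |
        ¬ predictionError D O (sparseLearner d K τ (trainingData O ρs)) ≤ rhs} ≤
      ENNReal.ofReal δ := by
  have hN0 : 0 < N := by
    have hn0 : (2 : ℝ) ≤ n := by exact_mod_cast hn
    have h1 : 0 < Real.log (n / δ) := Real.log_pos (by rw [lt_div_iff₀ hδ]; linarith)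
    have : (0 : ℝ) < N := lt_of_lt_of_le (by positivity) hN
    exact_mod_cast this
  refine le_trans (measure_mono ?_) ((measure_inaccurate_le hD (by omega) O d hγ.le hN0).trans
    (ENNReal.ofReal_le_ofReal (mul_exp_le_of_sample_size hn hδ hδ1 hγ d hN)))
  intro ρs hρs
  simp only [Set.mem_ofPred_eq] at hρs ⊢
  refine fun hgood => hρs ?_
  obtain ⟨U, hU1, hU2, hU3, hU4⟩ := sparseCoeff_error (K := K) hτ hγ.le (specNorm_nonneg O.1)
    (sum_realCoeff_sq_le O.2) (pauliMoment_self_nonneg D) (pauliMoment_self_le hD)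
    (fun P hP => (hgood P hP).1) (fun P hP => (hgood P hP).2)
  rw [sparseLearner, predictionError_modelOfCoeff hD]
  exact hU4.trans (hrhs U hU1 hU2 hU3)

end Estimator

/-! ### Shrunken estimation of the mean -/

section MeanLearner

variable {n : ℕ}

lemma pauliVal_zero (ρ : QState n) : pauliVal 0 ρ = 1 := by
  have : pauliOp (0 : Fin n → Fin 4) = 1 := by
    simp [pauliOp, pauliMatrix, tensorOp_one]
  rw [pauliVal, this, one_mul, ρ.2.2, Complex.one_re]

lemma integral_expVal {D : Measure (QState n)} [IsProbabilityMeasure D]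
    (hD : InvariantUnderHS D) (O : Observable n) : ∫ ρ, expVal O ρ ∂D = realCoeff O.1 0 := by
  have h := integral_expVal_mul_pauliVal hD O 0
  simpa [pauliMoment, pauliVal_zero] using h

/-- The learning rule that predicts the constant `β` times the mean of the labels. -/
noncomputable def meanLearner {N : ℕ} (β : ℝ) (data : Fin N → QState n × ℝ) : Observable n × ℝ :=
  modelOfCoeff fun P => if P = 0 then β * ((∑ l, (data l).2) / N) else 0

lemma predictionError_meanLearner_le {D : Measure (QState n)} [IsProbabilityMeasure D]
    (hD : InvariantUnderHS D) (O : Observable n) (β : ℝ) {N : ℕ} (data : Fin N → QState n × ℝ) :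
    predictionError D O (meanLearner β data) ≤
      (β * ((∑ l, (data l).2) / N) - realCoeff O.1 0) ^ 2 +
        2 / 3 * (specNorm O.1 ^ 2 - realCoeff O.1 0 ^ 2) := by
  rw [meanLearner, predictionError_modelOfCoeff hD, ← Finset.add_sum_erase _ _
    (Finset.mem_univ (0 : Fin n → Fin 4)), if_pos rfl]
  refine add_le_add (mul_le_of_le_one_right (sq_nonneg _) (pauliMoment_self_le_one hD 0)) ?_
  have h1 : ∑ P ∈ Finset.univ.erase (0 : Fin n → Fin 4), realCoeff O.1 P ^ 2 ≤
      specNorm O.1 ^ 2 - realCoeff O.1 0 ^ 2 := by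
    have := sum_realCoeff_sq_le O.2
    rw [← Finset.add_sum_erase _ _ (Finset.mem_univ (0 : Fin n → Fin 4))] at this
    linarith
  refine le_trans ?_ (mul_le_mul_of_nonneg_left h1 (by norm_num))
  rw [Finset.mul_sum]
  refine Finset.sum_le_sum fun P hP => ?_
  have hP0 : P ≠ 0 := Finset.ne_of_mem_erase hP
  have hw : pauliMoment D P P ≤ 2 / 3 := by
    refine (pauliMoment_self_le hD P).trans ?_
    obtain ⟨i, hi⟩ := Function.ne_iff.mp hP0
    have h2 : 1 ≤ pauliWeight P :=
      Finset.card_pos.mpr ⟨i, Finset.mem_filter.mpr ⟨Finset.mem_univ _, hi⟩⟩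
    calc (2 / 3 : ℝ) ^ pauliWeight P ≤ (2 / 3) ^ 1 :=
          pow_le_pow_of_le_one (by norm_num) (by norm_num) h2
      _ = 2 / 3 := pow_one _
  rw [if_neg hP0, zero_sub, neg_sq, mul_comm]
  exact mul_le_mul_of_nonneg_right hw (sq_nonneg _)

lemma exp_le_chord {y : ℝ} (h0 : 0 ≤ y) (h8 : y ≤ 8) :
    Real.exp y ≤ 1 + y / 8 * Real.exp 8 := by
  have h := convexOn_exp.2 (Set.mem_univ 0) (Set.mem_univ 8)
    (by linarith : 0 ≤ 1 - y / 8) (by linarith : 0 ≤ y / 8) (by ring)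
  simp only [smul_eq_mul, mul_zero, zero_add, Real.exp_zero, mul_one] at h
  have e : y / 8 * 8 = y := by ring
  rw [e] at h
  linarith

/-- If the mean of `g` is within a factor `1 - e⁻⁸` of its upper bound, then `N` independent copies
have mean at most half that bound with probability at most `e⁻ᴺ`. -/
lemma measure_pi_sum_lt_half_le {Ω : Type*} [MeasurableSpace Ω] (D : Measure Ω)
    [IsProbabilityMeasure D] {g : Ω → ℝ} (hg : Measurable g) {B : ℝ} (hB : 0 < B)
    (hgB : ∀ x, |g x| ≤ B) (hmean : (1 - Real.exp (-8)) * B ≤ ∫ x, g x ∂D) (N : ℕ) :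
    (Measure.pi fun _ : Fin N => D) {x | ∑ l, g (x l) < N * (B / 2)} ≤
      ENNReal.ofReal (Real.exp (-N)) := by
  -- `f` takes values in `[0, 8]` and has mean at most `4 e⁻⁸`, so `E exp f ≤ 3 / 2`
  set f : Ω → ℝ := fun x => 4 * (1 - g x / B) with hf
  have hfm : Measurable f := by fun_prop
  have hf0 : ∀ x, 0 ≤ f x ∧ f x ≤ 8 := by
    intro x
    have h1 : g x / B ≤ 1 := (div_le_one hB).mpr (abs_le.mp (hgB x)).2
    have h2 : -1 ≤ g x / B := by
      rw [le_div_iff₀ hB]; linarith [(abs_le.mp (hgB x)).1]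
    constructor <;> simp only [hf] <;> linarith
  have hint : Integrable g D := integrable_of_abs_le hg B hgB
  have hfint : Integrable f D := integrable_of_abs_le hfm 8 fun x => by
    rw [abs_of_nonneg (hf0 x).1]; exact (hf0 x).2
  have hmeanf : ∫ x, f x ∂D ≤ 4 * Real.exp (-8) := by
    have : ∫ x, f x ∂D = 4 * (1 - (∫ x, g x ∂D) / B) := by
      simp only [hf]
      rw [integral_const_mul, integral_sub (integrable_const _) (hint.div_const B),
        integral_div]
      simp
    rw [this]
    have h1 : 1 - Real.exp (-8) ≤ (∫ x, g x ∂D) / B := by rwa [le_div_iff₀ hB]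
    linarith
  have hexp : ∫ x, Real.exp (f x) ∂D ≤ Real.exp (1 / 2) := by
    calc ∫ x, Real.exp (f x) ∂D ≤ ∫ x, (1 + f x * (Real.exp 8 / 8)) ∂D := by
          refine integral_mono ?_ ((integrable_const _).add (hfint.mul_const _)) fun x => ?_
          · refine integrable_of_abs_le (Real.measurable_exp.comp hfm) (Real.exp 8) fun x => ?_
            rw [abs_of_pos (Real.exp_pos _)]
            exact Real.exp_le_exp.mpr (hf0 x).2
          · have := exp_le_chord (hf0 x).1 (hf0 x).2
            simp only
            linarith
      _ = 1 + (∫ x, f x ∂D) * (Real.exp 8 / 8) := by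
          rw [integral_add (integrable_const _) (hfint.mul_const _), integral_mul_const]
          simp
      _ ≤ 1 + 4 * Real.exp (-8) * (Real.exp 8 / 8) := by gcongr
      _ = 1 / 2 + 1 := by
          have : Real.exp (-8) * Real.exp 8 = 1 := by rw [← Real.exp_add]; norm_num
          linear_combination this / 2
      _ ≤ Real.exp (1 / 2) := Real.add_one_le_exp _
  refine (measure_mono ?_).trans ((measure_pi_sum_ge_le D hfm (b := 8) (fun x => by
    rw [abs_of_nonneg (hf0 x).1]; exact (hf0 x).2) N (2 * N)).trans
    (ENNReal.ofReal_le_ofReal ?_))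
  · intro x hx
    simp only [Set.mem_ofPred_eq] at hx ⊢
    simp only [hf, ← Finset.mul_sum, Finset.sum_sub_distrib, ← Finset.sum_div, Finset.sum_const,
      Finset.card_univ, Fintype.card_fin, nsmul_eq_mul, mul_one]
    have : (∑ l, g (x l)) / B ≤ N / 2 := by
      rw [div_le_iff₀ hB]; linarith
    linarith
  · have h0 : 0 ≤ ∫ y, Real.exp (f y) ∂D := integral_nonneg fun _ => (Real.exp_pos _).le
    calc Real.exp (-(2 * N)) * (∫ y, Real.exp (f y) ∂D) ^ N
        ≤ Real.exp (-(2 * N)) * Real.exp (1 / 2) ^ N := by gcongr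
      _ = Real.exp (-(2 * N) + N * (1 / 2)) := by rw [← Real.exp_nat_mul, Real.exp_add]
      _ ≤ Real.exp (-N) := by
          refine Real.exp_le_exp.mpr ?_
          have : (0 : ℝ) ≤ N := Nat.cast_nonneg N
          linarith

/-- The gain of the shrunken mean over the trivial predictor. -/
noncomputable def meanGain : ℝ := Real.exp (-8) / 40

lemma meanGain_pos : 0 < meanGain := by unfold meanGain; positivity

lemma exp_neg_eight_le : Real.exp (-8) ≤ 1 / 8 := by
  have h : (8 : ℝ) ≤ Real.exp 8 := by linarith [Real.add_one_le_exp 8]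
  rw [Real.exp_neg, one_div]
  exact inv_anti₀ (by norm_num) h

lemma meanGain_le : meanGain ≤ 1 / 8 := by
  have := exp_neg_eight_le
  have := Real.exp_pos (-8)
  unfold meanGain; linarith

/-- With only `N ≥ log (n / δ)` samples the trivial error bound `‖O‖²` is improved by a constant
factor. If `Tr(O ρ)` has mean well below `‖O‖`, then it has second moment well below `‖O‖²`;
otherwise the labels have the sign of their mean with overwhelming probability. -/
lemma meanLearner_guarantee (hn : 2 ≤ n) {δ : ℝ} (hδ : 0 < δ) (hδ1 : δ ≤ 1) {N : ℕ}
    (hN : Real.log (n / δ) ≤ N) (O : Observable n) (D : Measure (QState n))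
    [IsProbabilityMeasure D] (hD : InvariantUnderHS D) (rhs : ℝ)
    (hrhs : (1 - meanGain) * specNorm O.1 ^ 2 ≤ rhs) :
    (Measure.pi fun _ : Fin N => D) {ρs : Fin N → QState n |
        ¬ predictionError D O (meanLearner (Real.exp (-8) / 20) (trainingData O ρs)) ≤ rhs} ≤
      ENNReal.ofReal δ := by
  have hn0 : (2 : ℝ) ≤ n := by exact_mod_cast hn
  have hN0 : (0 : ℝ) < N :=
    lt_of_lt_of_le (Real.log_pos (by rw [lt_div_iff₀ hδ]; linarith)) hN
  set B := specNorm O.1 with hB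
  set a := realCoeff O.1 0 with ha
  have hB0 : 0 ≤ B := specNorm_nonneg _
  have hτ0 := Real.exp_pos (-8)
  have hτ1 := exp_neg_eight_le
  have hgain : meanGain = Real.exp (-8) / 40 := rfl
  set τ := Real.exp (-8) with hτ
  set m : (Fin N → QState n) → ℝ := fun ρs => (∑ l, expVal O (ρs l)) / N with hm
  have hmB : ∀ ρs, |m ρs| ≤ B := by
    intro ρs
    simp only [hm]
    rw [abs_div, abs_of_pos hN0, div_le_iff₀ hN0]
    refine (Finset.abs_sum_le_sum_abs _ _).trans ?_
    refine (Finset.sum_le_sum fun l _ => abs_expVal_le O (ρs l)).trans (le_of_eq ?_)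
    rw [Finset.sum_const, Finset.card_univ, Fintype.card_fin, nsmul_eq_mul, mul_comm]
  have haB : |a| ≤ B := by
    refine abs_le_of_sq_le_sq ?_ hB0
    exact (Finset.single_le_sum (f := fun P => realCoeff O.1 P ^ 2) (fun _ _ => sq_nonneg _)
      (Finset.mem_univ 0)).trans (sum_realCoeff_sq_le O.2)
  have herr : ∀ ρs, predictionError D O (meanLearner (τ / 20) (trainingData O ρs)) ≤
      (τ / 20 * m ρs - a) ^ 2 + 2 / 3 * (B ^ 2 - a ^ 2) := fun ρs =>
    predictionError_meanLearner_le hD O (τ / 20) (trainingData O ρs)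
  by_cases hcase : a ^ 2 ≤ (1 - τ) * B ^ 2
  · have hall : ∀ ρs : Fin N → QState n,
        predictionError D O (meanLearner (τ / 20) (trainingData O ρs)) ≤ rhs := by
      intro ρs
      refine (herr ρs).trans (le_trans ?_ hrhs)
      have h1 : (m ρs) ^ 2 ≤ B ^ 2 := sq_le_sq' (abs_le.mp (hmB ρs)).1 (abs_le.mp (hmB ρs)).2
      have h2 : -(m ρs * a) ≤ B ^ 2 := by
        have : |m ρs * a| ≤ B * B := by
          rw [abs_mul]; exact mul_le_mul (hmB ρs) haB (abs_nonneg _) hB0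
        have := (abs_le.mp this).1
        nlinarith
      have e : (τ / 20 * m ρs - a) ^ 2 + 2 / 3 * (B ^ 2 - a ^ 2) =
          τ ^ 2 / 400 * m ρs ^ 2 + τ / 10 * -(m ρs * a) + 1 / 3 * a ^ 2 + 2 / 3 * B ^ 2 := by ring
      rw [e, hgain]
      have h3 : τ ^ 2 / 400 * m ρs ^ 2 ≤ τ / 400 * B ^ 2 := by
        refine mul_le_mul ?_ h1 (sq_nonneg _) (by positivity)
        nlinarith
      have h4 : τ / 10 * -(m ρs * a) ≤ τ / 10 * B ^ 2 := by gcongr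
      nlinarith [mul_nonneg hτ0.le (sq_nonneg B)]
    simp [hall]
  · have hcase' := not_le.mp hcase
    have hBpos : 0 < B := by
      rcases hB0.eq_or_lt with h | h
      · rw [← h] at haB
        have : a = 0 := abs_nonpos_iff.mp haB
        rw [this, ← h] at hcase'
        norm_num at hcase'
      · exact h
    have habs : (1 - τ) * B ≤ |a| := by
      refine abs_le_of_sq_le_sq' (b := |a|) ?_ (abs_nonneg a) |>.2
      rw [sq_abs, mul_pow]
      refine le_trans ?_ hcase'.le
      refine mul_le_mul_of_nonneg_right ?_ (sq_nonneg _)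
      nlinarith
    obtain ⟨s, hs1, hs2⟩ : ∃ s : ℝ, |s| = 1 ∧ s * a = |a| := by
      rcases le_total 0 a with h | h
      · exact ⟨1, by simp, by rw [one_mul, abs_of_nonneg h]⟩
      · exact ⟨-1, by simp, by rw [abs_of_nonpos h]; ring⟩
    have hprob := measure_pi_sum_lt_half_le D (g := fun ρ => s * expVal O ρ)
      ((measurable_expVal O).const_mul s) hBpos (fun ρ => by
        rw [abs_mul, hs1, one_mul]; exact abs_expVal_le O ρ)
      (by rw [integral_const_mul, integral_expVal hD, hs2]; exact habs) N
    have hexpN : Real.exp (-N) ≤ δ := by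
      have h1 : Real.log δ = Real.log n - Real.log (n / δ) := by
        rw [Real.log_div (by linarith) hδ.ne']; ring
      have h2 : 0 ≤ Real.log n := Real.log_nonneg (by linarith)
      calc Real.exp (-N) ≤ Real.exp (Real.log δ) := Real.exp_le_exp.mpr (by linarith)
        _ = δ := Real.exp_log hδ
    refine (measure_mono ?_).trans (hprob.trans (ENNReal.ofReal_le_ofReal hexpN))
    intro ρs hρs
    simp only [Set.mem_ofPred_eq] at hρs ⊢
    by_contra hcon
    refine hρs ((herr ρs).trans (le_trans ?_ hrhs))
    rw [not_lt, ← Finset.mul_sum] at hcon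
    have hsm : B / 2 ≤ s * m ρs := by
      simp only [hm]
      rw [mul_div_assoc', le_div_iff₀ hN0]
      linarith
    have hss : s * s = 1 := by rw [← abs_mul_abs_self, hs1, one_mul]
    have h1 : (m ρs) ^ 2 ≤ B ^ 2 := sq_le_sq' (abs_le.mp (hmB ρs)).1 (abs_le.mp (hmB ρs)).2
    have h2 : B / 2 * ((1 - τ) * B) ≤ m ρs * a := by
      have h3 : m ρs * a = (s * m ρs) * (s * a) := by linear_combination -(m ρs * a) * hss
      rw [h3, hs2]
      exact mul_le_mul hsm habs (by nlinarith) (by linarith)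
    have h5 : a ^ 2 ≤ B ^ 2 := by rw [← sq_abs a]; gcongr
    have e : (τ / 20 * m ρs - a) ^ 2 + 2 / 3 * (B ^ 2 - a ^ 2) =
        τ ^ 2 / 400 * m ρs ^ 2 - τ / 10 * (m ρs * a) + 1 / 3 * a ^ 2 + 2 / 3 * B ^ 2 := by ring
    rw [e, hgain]
    have h3 : τ ^ 2 / 400 * m ρs ^ 2 ≤ τ ^ 2 / 400 * B ^ 2 := by gcongr
    have h4 : τ / 10 * (B / 2 * ((1 - τ) * B)) ≤ τ / 10 * (m ρs * a) := by gcongr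
    have h6 : τ ^ 2 * B ^ 2 ≤ τ / 8 * B ^ 2 := by
      refine mul_le_mul_of_nonneg_right ?_ (sq_nonneg _)
      nlinarith
    nlinarith [mul_nonneg hτ0.le (sq_nonneg B)]

/-- The trivial learning rule predicts zero. -/
lemma predictionError_zero_le (O : Observable n) (D : Measure (QState n))
    [IsProbabilityMeasure D] : predictionError D O (modelOfCoeff 0) ≤ specNorm O.1 ^ 2 := by
  have h : predictionError D O (modelOfCoeff 0) = ∫ ρ, expVal O ρ ^ 2 ∂D := by
    simp [predictionError, predict_modelOfCoeff]
  have hb : ∀ ρ : QState n, expVal O ρ ^ 2 ≤ specNorm O.1 ^ 2 := fun ρ =>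
    sq_le_sq' (abs_le.mp (abs_expVal_le O ρ)).1 (abs_le.mp (abs_expVal_le O ρ)).2
  rw [h]
  calc ∫ ρ, expVal O ρ ^ 2 ∂D ≤ ∫ _ρ : QState n, specNorm O.1 ^ 2 ∂D :=
        integral_mono (integrable_of_abs_le ((measurable_expVal O).pow_const 2) _ fun ρ => by
          rw [abs_of_nonneg (sq_nonneg _)]; exact hb ρ) (integrable_const _) hb
    _ = _ := by simp

end MeanLearner

/-! ### Choice of the parameters -/

section Parameters

variable {n : ℕ}

/-- The choice of the influence threshold `σ` that balances the two terms of
`sum_small_coeff_sq_le`, with `v` bounding the number of remaining variables. The exponent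
`r = 2k/(k+1)` enters through `(2 - r) d ≤ (2 - r) k = r`. -/
lemma exists_influence_threshold {B R G x q r : ℝ} {d : ℕ} (hB : 0 < B) (hR0 : 0 ≤ R)
    (hG : 12 ≤ G) (hx0 : 0 < x) (hx1 : x ≤ 1) (hr2 : r ≤ 2) (hrd : (2 - r) * d ≤ r)
    (hq : q ≤ (x / G ^ 2) ^ (d + 2)) :
    ∃ σ v : ℝ, 0 < σ ∧ 1 ≤ v ∧ G * (R * B) ≤ v * σ ∧
      σ * (G * (R * B)) ≤ x * (1 + R ^ r) * B ^ 2 ∧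
      3 * v ^ d * (10 * q * B ^ 2) ≤ x * (1 + R ^ r) * B ^ 2 := by
  have hG0 : 0 < G := by linarith
  set ρ := max 1 R with hρ
  have hρ1 : 1 ≤ ρ := le_max_left _ _
  have hρR : R ≤ ρ := le_max_right _ _
  have hρ0 : 0 < ρ := by linarith
  have hρr : ρ ^ r ≤ 1 + R ^ r := by
    rcases le_total R 1 with h | h
    · rw [hρ, max_eq_left h, Real.one_rpow]
      linarith [Real.rpow_nonneg hR0 r]
    · rw [hρ, max_eq_right h]; linarith
  have hfin : x * ρ ^ r * B ^ 2 ≤ x * (1 + R ^ r) * B ^ 2 := by gcongr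
  have hG2x : 1 ≤ G ^ 2 / x := by rw [one_le_div hx0]; nlinarith
  have hv1 : 1 ≤ ρ ^ (2 - r) := Real.one_le_rpow hρ1 (by linarith)
  refine ⟨x * ρ ^ (r - 1) * B / G, G ^ 2 / x * ρ ^ (2 - r), by positivity,
    one_le_mul_of_one_le_of_one_le hG2x hv1, ?_, ?_, ?_⟩
  · have e1 : ρ ^ (2 - r) * ρ ^ (r - 1) = ρ := by
      rw [← Real.rpow_add hρ0]; norm_num
    calc G * (R * B) ≤ G * (ρ * B) := by gcongr
      _ = G * (ρ ^ (2 - r) * ρ ^ (r - 1) * B) := by rw [e1]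
      _ = _ := by field_simp
  · refine le_trans ?_ hfin
    have e1 : ρ ^ (r - 1) * ρ = ρ ^ r := by
      rw [← Real.rpow_add_one hρ0.ne', sub_add_cancel]
    calc x * ρ ^ (r - 1) * B / G * (G * (R * B)) = x * (ρ ^ (r - 1) * R) * B ^ 2 := by
          field_simp
      _ ≤ x * (ρ ^ (r - 1) * ρ) * B ^ 2 := by gcongr
      _ = _ := by rw [e1]
  · refine le_trans ?_ hfin
    have e1 : (ρ ^ (2 - r)) ^ d ≤ ρ ^ r := by
      rw [← Real.rpow_mul_natCast hρ0.le]
      exact Real.rpow_le_rpow_of_exponent_le hρ1 hrd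
    have e2 : (G ^ 2 / x) ^ d * (x / G ^ 2) ^ (d + 2) = (x / G ^ 2) ^ 2 := by
      rw [pow_add, ← mul_assoc, ← mul_pow]
      have : G ^ 2 / x * (x / G ^ 2) = 1 := by field_simp
      rw [this, one_pow, one_mul]
    have e3 : 30 * (x / G ^ 2) ^ 2 ≤ x := by
      have h3 : x / G ^ 2 ≤ x / 144 := div_le_div_of_nonneg_left hx0.le (by norm_num) (by nlinarith)
      have h4 : 0 ≤ x / G ^ 2 := by positivity
      nlinarith
    calc 3 * (G ^ 2 / x * ρ ^ (2 - r)) ^ d * (10 * q * B ^ 2)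
        = 30 * ((G ^ 2 / x) ^ d * q) * (ρ ^ (2 - r)) ^ d * B ^ 2 := by rw [mul_pow]; ring
      _ ≤ 30 * ((G ^ 2 / x) ^ d * (x / G ^ 2) ^ (d + 2)) * (ρ ^ (2 - r)) ^ d * B ^ 2 := by gcongr
      _ ≤ 30 * ((G ^ 2 / x) ^ d * (x / G ^ 2) ^ (d + 2)) * ρ ^ r * B ^ 2 := by gcongr
      _ = (30 * (x / G ^ 2) ^ 2) * ρ ^ r * B ^ 2 := by rw [e2]
      _ ≤ x * ρ ^ r * B ^ 2 := by gcongr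

/-- The bound on the unselected coefficients in terms of the norm of the truncated observable. -/
lemma sum_unselected_sq_le {O : QubitOp n} (hO : O.IsHermitian) {k d : ℕ} (hk : 1 ≤ k)
    (hdk : d ≤ k) {x q : ℝ} (hx0 : 0 < x) (hx1 : x ≤ 1) (hq0 : 0 ≤ q)
    (hq : q ≤ (x / (12 * 90 ^ k) ^ 2) ^ (d + 2)) {U : Finset (Fin n → Fin 4)}
    (hU : ∀ P ∈ U, pauliWeight P ≤ d)
    (hUa : ∀ P ∈ U, realCoeff O P ^ 2 ≤ 10 * q * specNorm O ^ 2) :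
    ∑ P ∈ U, realCoeff O P ^ 2 ≤
      2 * x * (1 + (specNorm (lowDegree k O) / specNorm O) ^ bhExponent k) * specNorm O ^ 2 := by
  have hB0 : 0 ≤ specNorm O := specNorm_nonneg _
  have hM0 : 0 ≤ specNorm (lowDegree k O) := specNorm_nonneg _
  rcases hB0.eq_or_lt with h0 | hBpos
  · have : ∑ P ∈ U, realCoeff O P ^ 2 ≤ ∑ P, realCoeff O P ^ 2 :=
      Finset.sum_le_sum_of_subset_of_nonneg (Finset.subset_univ _) fun _ _ _ => sq_nonneg _
    have h2 := this.trans (sum_realCoeff_sq_le hO)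
    rw [← h0] at h2 ⊢
    simpa using h2
  have hk' : (1 : ℝ) ≤ k := by exact_mod_cast hk
  have hr2 : bhExponent k ≤ 2 := by
    rw [bhExponent, div_le_iff₀ (by linarith)]; linarith
  have hrd : (2 - bhExponent k) * d ≤ bhExponent k := by
    have h1 : (d : ℝ) ≤ k := by exact_mod_cast hdk
    have h2 : (2 - bhExponent k) * k = bhExponent k := by
      rw [bhExponent]; field_simp; ring
    exact (mul_le_mul_of_nonneg_left h1 (by linarith)).trans h2.le
  have hG12 : (12 : ℝ) ≤ 12 * 90 ^ k := by
    have : (1 : ℝ) ≤ 90 ^ k := one_le_pow₀ (by norm_num)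
    linarith
  obtain ⟨σ, v, hσ0, hv1, hvσ, h1, h2⟩ := exists_influence_threshold hBpos
    (div_nonneg hM0 hB0) hG12 hx0 hx1 hr2 hrd hq
  rw [div_mul_cancel₀ _ hBpos.ne'] at hvσ h1
  have hS : ∑ w, sqrtInfluence (Finset.univ.filter fun P : Fin n → Fin 4 => pauliWeight P ≤ k)
      (realCoeff O) w ≤ 12 * 90 ^ k * specNorm (lowDegree k O) :=
    sum_sqrtInfluence_le (fun P hP => (Finset.mem_filter.mp hP).2)
      fun y hy => abs_sum_pauliMonomial_le hO k hy
  have key := sum_small_coeff_sq_le (U := U) (d := d)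
    (fun P hP => Finset.mem_filter.mpr ⟨Finset.mem_univ P, (hU P hP).trans hdk⟩) hU hUa
    (by positivity) hS hσ0 hv1 hvσ
  linarith

lemma logb_three_halves_le {y : ℝ} (hy : 1 ≤ y) : Real.logb 1.5 y ≤ 3 * Real.log y := by
  have h1 : (1 / 3 : ℝ) ≤ Real.log 1.5 := by
    have := Real.one_sub_inv_le_log_of_pos (by norm_num : (0 : ℝ) < 1.5)
    norm_num at this ⊢
    linarith
  rw [Real.logb, div_le_iff₀ (by linarith)]
  have := Real.log_nonneg hy
  nlinarith

lemma two_thirds_pow_ceil_le {y : ℝ} (hy : 0 < y) :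
    (2 / 3 : ℝ) ^ ⌈Real.logb 1.5 (1 / y)⌉₊ ≤ y := by
  have h1 : 1 / y ≤ (1.5 : ℝ) ^ ⌈Real.logb 1.5 (1 / y)⌉₊ := by
    rw [← Real.rpow_natCast]
    calc 1 / y = (1.5 : ℝ) ^ Real.logb 1.5 (1 / y) :=
          (Real.rpow_logb (by norm_num) (by norm_num) (by positivity)).symm
      _ ≤ _ := Real.rpow_le_rpow_of_exponent_le (by norm_num) (Nat.le_ceil _)
  have h2 : (2 / 3 : ℝ) = (1.5)⁻¹ := by norm_num
  rw [h2, inv_pow]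
  exact inv_le_of_inv_le₀ hy ((one_div y).symm.le.trans h1)

lemma ceil_logb_le {y : ℝ} (hy : 1 ≤ y) :
    (⌈Real.logb 1.5 y⌉₊ : ℝ) ≤ 3 * Real.log y + 1 :=
  (Nat.ceil_lt_add_one (Real.logb_nonneg (by norm_num) hy)).le.trans
    (add_le_add (logb_three_halves_le hy) le_rfl)

lemma log_le_of_le_two_pow {y : ℝ} (hy : 0 < y) {m : ℕ} (h : y ≤ 2 ^ m) : Real.log y ≤ m := by
  have h1 := Real.log_le_log hy h
  rw [Real.log_pow] at h1
  have h2 : Real.log 2 ≤ 1 := by linarith [Real.log_two_lt_d9]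
  have h3 : (0 : ℝ) ≤ m := Nat.cast_nonneg m
  nlinarith

lemma le_two_rpow_of_log_le {y t : ℝ} (hy : 0 < y) (h : 2 * Real.log y ≤ t) (ht : 0 ≤ t) :
    y ≤ (2 : ℝ) ^ t := by
  rw [Real.rpow_def_of_pos (by norm_num), ← Real.log_le_iff_le_exp hy]
  have := Real.log_two_gt_d9
  nlinarith

/-- The learner estimating all coefficients of weight at most `k`. -/
lemma exists_learner_of_dimension_bound {A : ℝ} (hn : 2 ≤ n) {ε ε' δ : ℝ} (hε : 0 < ε)
    (hε1 : ε < 1) (hε' : 0 < ε') (hδ : 0 < δ) (hδ1 : δ ≤ 1) (hA1 : 1 ≤ A)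
    (hA : 1 ≤ A * Real.log (1 / ε)) {N : ℕ}
    (hN : Real.log (n / δ) * (2 : ℝ) ^ (208 * A * (Real.log (1 / ε) * Real.log n)) ≤ N) :
    ∃ learn : (Fin N → QState n × ℝ) → Observable n × ℝ,
      ∀ (O : Observable n) (D : Measure (QState n)) [IsProbabilityMeasure D],
        InvariantUnderHS D → (Measure.pi fun _ : Fin N => D) {ρs : Fin N → QState n |
          ¬ predictionError D O (learn (trainingData O ρs)) ≤
            (ε + ε' * (1 + (specNorm (lowDegree (truncWeight ε) O.1) / specNorm O.1) ^
              bhExponent (truncWeight ε))) * specNorm O.1 ^ 2} ≤ ENNReal.ofReal δ := by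
  have hn0 : (2 : ℝ) ≤ n := by exact_mod_cast hn
  set k := truncWeight ε with hk
  set L := Real.log (1 / ε) with hL
  set b : ℝ := (4 * n) ^ k with hb
  have hb1 : 1 ≤ b := one_le_pow₀ (by linarith)
  set γ := ε ^ 2 / (500 * b) with hγ
  have hγ0 : 0 < γ := by positivity
  set K := (Finset.univ.filter fun P : Fin n → Fin 4 => pauliWeight P ≤ k).card with hK
  have hKb : (K : ℝ) ≤ 3 * b := card_pauliWeight_le (by omega) k
  have hk0 : (0 : ℝ) ≤ k := Nat.cast_nonneg k
  have hlog0 : 0 < Real.log (n / δ) := Real.log_pos (by rw [lt_div_iff₀ hδ]; linarith)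
  have hsize : 2 * (5 + 3 * k) / γ ^ 2 ≤ (2 : ℝ) ^ (208 * A * (L * Real.log n)) := by
    have hln : 1 ≤ 2 * Real.log n := by
      have h1 : Real.log 2 ≤ Real.log n := Real.log_le_log (by norm_num) hn0
      linarith [Real.log_two_gt_d9]
    have hL0 : 0 ≤ L := Real.log_nonneg (by rw [one_le_div hε]; exact hε1.le)
    have hkL : (k : ℝ) ≤ 4 * (A * L) := by
      have h1 : (k : ℝ) ≤ 3 * L + 1 := ceil_logb_le (by rw [one_le_div hε]; exact hε1.le)
      nlinarith
    have e : 2 * (5 + 3 * k) / γ ^ 2 = 500000 * (5 + 3 * k) * b ^ 2 * (1 / ε) ^ 4 := by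
      rw [hγ]; field_simp; norm_num
    rw [e]
    refine le_two_rpow_of_log_le (by positivity) ?_ (by
      have : 0 ≤ Real.log n := by linarith
      positivity)
    have h5 : Real.log (5 + 3 * k) ≤ 5 + 3 * k := by
      have := Real.log_le_sub_one_of_pos (by positivity : (0 : ℝ) < 5 + 3 * k)
      linarith
    have h6 : Real.log 500000 ≤ 19 := by
      exact_mod_cast log_le_of_le_two_pow (by norm_num : (0 : ℝ) < 500000) (m := 19) (by norm_num)
    have h4n : Real.log (4 * n) ≤ 3 * Real.log n := by
      rw [Real.log_mul (by norm_num) (by linarith)]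
      have h1 : Real.log 4 = 2 * Real.log 2 := by
        rw [show (4 : ℝ) = 2 ^ 2 by norm_num, Real.log_pow]; norm_num
      have h2 : Real.log 2 ≤ Real.log n := Real.log_le_log (by norm_num) hn0
      linarith
    rw [Real.log_mul (by positivity) (by positivity), Real.log_mul (by positivity) (by positivity),
      Real.log_mul (by norm_num) (by positivity), Real.log_pow, Real.log_pow, Real.log_pow,
      ← hL]
    push_cast
    have hX : 1 ≤ (A * L) * (2 * Real.log n) := one_le_mul_of_one_le_of_one_le hA hln
    have hk2 : (k : ℝ) ≤ 4 * (A * L) * (2 * Real.log n) := by nlinarith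
    have hk3 : (k : ℝ) * Real.log (4 * n) ≤ 4 * (A * L) * (3 * Real.log n) :=
      mul_le_mul hkL h4n (Real.log_nonneg (by linarith)) (by positivity)
    have hL2 : L ≤ (A * L) * (2 * Real.log n) := by nlinarith
    nlinarith
  refine ⟨sparseLearner k K (ε / 9), fun O D _ hD => ?_⟩
  refine sparseLearner_guarantee hn hδ hδ1 hγ0 (by positivity) k K
    ((mul_le_mul_of_nonneg_left hsize hlog0.le).trans hN) O D hD _ fun U _ _ hU => ?_
  rw [hU le_rfl, Finset.sum_empty, add_zero]
  refine mul_le_mul_of_nonneg_right ?_ (sq_nonneg _)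
  have h1 : (2 / 3 : ℝ) ^ (k + 1) ≤ 2 / 3 * ε := by
    rw [pow_succ, mul_comm]
    exact mul_le_mul_of_nonneg_left (two_thirds_pow_ceil_le hε) (by norm_num)
  have h2 : γ ≤ ε / 9 := by
    rw [hγ, div_le_iff₀ (by positivity)]
    nlinarith
  have h3 : K * (2 * γ / (ε / 9)) ^ 2 ≤ ε / 9 := by
    have e : 2 * γ / (ε / 9) = 9 * ε / (250 * b) := by rw [hγ]; field_simp; norm_num
    rw [e]
    calc (K : ℝ) * (9 * ε / (250 * b)) ^ 2 ≤ 3 * b * (9 * ε / (250 * b)) ^ 2 := by gcongr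
      _ = 243 * ε ^ 2 / 62500 / b := by field_simp; norm_num
      _ ≤ 243 * ε ^ 2 / 62500 := div_le_self (by positivity) hb1
      _ ≤ ε / 9 := by nlinarith
  have h4 : 0 ≤ (specNorm (lowDegree k O.1) / specNorm O.1) ^ bhExponent k :=
    Real.rpow_nonneg (div_nonneg (specNorm_nonneg _) (specNorm_nonneg _)) _
  have h5 : 0 ≤ ε' * (1 + (specNorm (lowDegree k O.1) / specNorm O.1) ^ bhExponent k) := by
    positivity
  linarith

/-- The sample size needed for degree cutoff `d` and sparsity `(G² / x) ^ (d + 2)`, where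
`G = 12 * 90 ^ k`. The logarithm of the sparsity is of order `d k + d log (1 / ε')`, and both
`d = O(log (1 / ε))` and `d = O(log (1 / ε'))` are used. -/
lemma sparse_sample_size {A L L' ε' x : ℝ} {k d : ℕ} (hA1 : 1 ≤ A) (hA : 1 ≤ A * L)
    (hA' : 1 ≤ A * (Real.log L + Real.log (1 / ε'))) (hε' : 0 < ε') (hε'1 : ε' < 1)
    (hL' : L' = Real.log L + Real.log (1 / ε')) (hx : x = ε' / 8) (hk : (k : ℝ) ≤ 3 * L + 1)
    (hdk : d ≤ k) (hd : (d : ℝ) ≤ 3 * Real.log (1 / x) + 1) :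
    2 * (5 + 3 * (d : ℝ)) / (((x / (12 * 90 ^ k) ^ 2) ^ (d + 2)) ^ 2) ^ 2 ≤
      (2 : ℝ) ^ (10000 * A ^ 3 * (L * L')) := by
  rw [← hL'] at hA'
  have hA0 : 0 < A := by linarith
  have hL0 : 0 < L := pos_of_mul_pos_right (by linarith : 0 < A * L) hA0.le
  have hL'0 : 0 < L' := pos_of_mul_pos_right (by linarith : 0 < A * L') hA0.le
  have hx0 : 0 < x := by rw [hx]; positivity
  have hk0 : (0 : ℝ) ≤ k := Nat.cast_nonneg k
  have hd0 : (0 : ℝ) ≤ d := Nat.cast_nonneg d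
  set l' := Real.log (1 / ε') with hl'
  have hl'0 : 0 < l' := Real.log_pos (by rw [one_lt_div hε']; exact hε'1)
  set G : ℝ := 12 * 90 ^ k with hG
  have hG0 : 0 < G := by positivity
  have hLA : L ≤ A * L := le_mul_of_one_le_left hL0.le hA1
  have hL'A : L' ≤ A * L' := le_mul_of_one_le_left hL'0.le hA1
  have hL'A2 : A * L' ≤ A ^ 2 * L' := by
    rw [sq, mul_assoc]; exact le_mul_of_one_le_left (by positivity) hA1
  have hkL : (k : ℝ) ≤ 4 * (A * L) := by linarith
  have hdL : (d : ℝ) ≤ 4 * (A * L) := le_trans (by exact_mod_cast hdk) hkL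
  have hl'L : l' ≤ 2 * A ^ 2 * L' := by
    have h1 : -Real.log L ≤ A := by
      have h2 := Real.log_le_sub_one_of_pos (inv_pos.mpr hL0)
      rw [Real.log_inv] at h2
      have h3 : L⁻¹ ≤ A := by rw [inv_le_iff_one_le_mul₀ hL0]; exact hA
      linarith
    have h3 : A ≤ A ^ 2 * L' := by
      rw [sq, mul_assoc]; exact le_mul_of_one_le_right hA0.le hA'
    linarith
  have hlog8 : Real.log 8 ≤ 3 := by
    exact_mod_cast log_le_of_le_two_pow (by norm_num : (0 : ℝ) < 8) (m := 3) (by norm_num)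
  have hlogx : Real.log (1 / x) = Real.log 8 + l' := by
    rw [hl', ← Real.log_mul (by norm_num) (by positivity)]
    congr 1
    rw [hx]; field_simp
  have hdL' : (d : ℝ) ≤ 16 * A ^ 2 * L' := by
    rw [hlogx] at hd
    linarith
  have e : 2 * (5 + 3 * (d : ℝ)) / (((x / G ^ 2) ^ (d + 2)) ^ 2) ^ 2 =
      2 * (5 + 3 * d) * (G ^ 2 * (1 / x)) ^ (4 * (d + 2)) := by
    have h1 : G ^ 2 * (1 / x) = (x / G ^ 2)⁻¹ := by field_simp
    rw [h1, inv_pow, div_eq_mul_inv, ← pow_mul, ← pow_mul]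
    congr 3
    ring
  have hGlog : Real.log (G ^ 2 * (1 / x)) ≤ 67 * (A * L) + l' := by
    rw [Real.log_mul (by positivity) (by positivity), Real.log_pow, hG,
      Real.log_mul (by norm_num) (by positivity), Real.log_pow, hlogx]
    have h1 : Real.log 12 ≤ 4 := by
      exact_mod_cast log_le_of_le_two_pow (by norm_num : (0 : ℝ) < 12) (m := 4) (by norm_num)
    have h2 : Real.log 90 ≤ 7 := by
      exact_mod_cast log_le_of_le_two_pow (by norm_num : (0 : ℝ) < 90) (m := 7) (by norm_num)
    have h3 : (k : ℝ) * Real.log 90 ≤ k * 7 := mul_le_mul_of_nonneg_left h2 hk0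
    push_cast
    linarith
  rw [e]
  refine le_two_rpow_of_log_le (by positivity) ?_ (by positivity)
  have h5 : Real.log (2 * (5 + 3 * d)) ≤ 6 + 3 * d := by
    rw [Real.log_mul (by norm_num) (by positivity)]
    have h1 := Real.log_le_sub_one_of_pos (by positivity : (0 : ℝ) < 5 + 3 * d)
    have h2 := Real.log_two_lt_d9
    linarith
  rw [Real.log_mul (by positivity) (by positivity), Real.log_pow]
  push_cast
  have t1 : (d : ℝ) + 2 ≤ 18 * A ^ 2 * L' := by linarith
  have t2 : (d : ℝ) + 2 ≤ 6 * (A * L) := by linarith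
  have t3 : ((d : ℝ) + 2) * (67 * (A * L)) ≤ 1206 * (A ^ 3 * (L * L')) :=
    (mul_le_mul_of_nonneg_right t1 (by positivity)).trans (le_of_eq (by ring))
  have t4 : ((d : ℝ) + 2) * l' ≤ 12 * (A ^ 3 * (L * L')) :=
    (mul_le_mul t2 hl'L hl'0.le (by positivity)).trans (le_of_eq (by ring))
  have t6 : ((d : ℝ) + 2) * Real.log (G ^ 2 * (1 / x)) ≤
      ((d : ℝ) + 2) * (67 * (A * L) + l') := mul_le_mul_of_nonneg_left hGlog (by positivity)
  have t7 : 6 + 3 * (d : ℝ) ≤ 18 * (A ^ 3 * (L * L')) := by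
    calc 6 + 3 * (d : ℝ) ≤ 18 * (A * L) := by linarith
      _ ≤ 18 * (A * L) * (A * L') := le_mul_of_one_le_right (by positivity) hA'
      _ ≤ 18 * (A * L) * (A ^ 2 * L') := by gcongr
      _ = _ := by ring
  have t9 : 0 < A ^ 3 * (L * L') := by positivity
  rw [mul_add] at t6
  linarith

/-- With sparsity `K = ⌈1 / q⌉` and accuracy `q²`, the error terms of the sparse learner are at
most `x`, and the squares of the unselected coefficients are at most `10 q`. -/
lemma sparse_parameters {x q : ℝ} (hx0 : 0 < x) (hx1 : x ≤ 1) (hq0 : 0 < q) (hqx : q ≤ x / 144) :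
    0 < (⌈1 / q⌉₊ : ℝ) ∧ q ^ 2 ≤ x ∧ ⌈1 / q⌉₊ * (2 * q ^ 2 / x) ^ 2 ≤ x ∧
      4 + 6 * ⌈1 / q⌉₊ * (2 * q ^ 2 / x) ^ 2 ≤ ⌈1 / q⌉₊ * (10 * q) := by
  have hK1 : 1 / q ≤ (⌈1 / q⌉₊ : ℝ) := Nat.le_ceil _
  have hK2 : (⌈1 / q⌉₊ : ℝ) < 1 / q + 1 := Nat.ceil_lt_add_one (by positivity)
  generalize (⌈1 / q⌉₊ : ℝ) = K at hK1 hK2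
  have hK0 : 0 < K := lt_of_lt_of_le (by positivity) hK1
  have hKq1 : 1 ≤ K * q := by rwa [div_le_iff₀ hq0] at hK1
  have hKq : K * q ≤ 2 := by
    have h2 : (1 / q + 1) * q = 1 + q := by field_simp
    nlinarith
  have hη : (2 * q ^ 2 / x) ^ 2 ≤ q ^ 2 := by
    refine pow_le_pow_left₀ (by positivity) ?_ 2
    rw [div_le_iff₀ hx0]; nlinarith
  have h3 : K * (2 * q ^ 2 / x) ^ 2 ≤ K * q ^ 2 := mul_le_mul_of_nonneg_left hη hK0.le
  have h4 : K * q ^ 2 ≤ 2 * q := by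
    rw [sq, ← mul_assoc]; exact mul_le_mul_of_nonneg_right hKq hq0.le
  refine ⟨hK0, by nlinarith, by linarith, ?_⟩
  have h5 : K * q ^ 2 ≤ K * q := mul_le_mul_of_nonneg_left (by nlinarith) hK0.le
  linarith

/-- The learner estimating only large coefficients. Its degree cutoff `d` may be smaller than `k`,
since weights above `log (1 / ε')` contribute less than `ε'`; this keeps the sample size within
`2 ^ O(d k)` despite the exponential constant of the influence bound. -/
lemma exists_learner_of_sparsity_bound {A : ℝ} (hn : 2 ≤ n) {ε ε' δ : ℝ} (hε : 0 < ε)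
    (hε1 : ε < 1) (hε' : 0 < ε') (hε'1 : ε' < 1) (hδ : 0 < δ) (hδ1 : δ ≤ 1) (hA1 : 1 ≤ A)
    (hA : 1 ≤ A * Real.log (1 / ε))
    (hA' : 1 ≤ A * (Real.log (Real.log (1 / ε)) + Real.log (1 / ε'))) {N : ℕ}
    (hN : Real.log (n / δ) * (2 : ℝ) ^ (10000 * A ^ 3 * (Real.log (1 / ε) *
      (Real.log (Real.log (1 / ε)) + Real.log (1 / ε')))) ≤ N) :
    ∃ learn : (Fin N → QState n × ℝ) → Observable n × ℝ,
      ∀ (O : Observable n) (D : Measure (QState n)) [IsProbabilityMeasure D],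
        InvariantUnderHS D → (Measure.pi fun _ : Fin N => D) {ρs : Fin N → QState n |
          ¬ predictionError D O (learn (trainingData O ρs)) ≤
            (ε + ε' * (1 + (specNorm (lowDegree (truncWeight ε) O.1) / specNorm O.1) ^
              bhExponent (truncWeight ε))) * specNorm O.1 ^ 2} ≤ ENNReal.ofReal δ := by
  have hn0 : (2 : ℝ) ≤ n := by exact_mod_cast hn
  have hlog0 : 0 < Real.log (n / δ) := Real.log_pos (by rw [lt_div_iff₀ hδ]; linarith)
  obtain ⟨x, hx⟩ : ∃ x, x = ε' / 8 := ⟨_, rfl⟩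
  have hx0 : 0 < x := by rw [hx]; positivity
  have hx1 : x ≤ 1 := by rw [hx]; linarith
  obtain ⟨k, hk⟩ : ∃ k, k = truncWeight ε := ⟨_, rfl⟩
  obtain ⟨d, hd⟩ : ∃ d, d = min k ⌈Real.logb 1.5 (1 / x)⌉₊ := ⟨_, rfl⟩
  obtain ⟨q, hq⟩ : ∃ q : ℝ, q = (x / (12 * 90 ^ k) ^ 2) ^ (d + 2) := ⟨_, rfl⟩
  rw [← hk]
  have hdk : d ≤ k := hd ▸ min_le_left _ _
  have hq0 : 0 < q := by rw [hq]; positivity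
  have hqx : q ≤ x / 144 := by
    have hG : (1 : ℝ) ≤ 90 ^ k := one_le_pow₀ (by norm_num)
    have hxG : x / (12 * 90 ^ k) ^ 2 ≤ x / 144 :=
      div_le_div_of_nonneg_left hx0.le (by norm_num) (by nlinarith)
    calc q ≤ (x / (12 * 90 ^ k) ^ 2) ^ 1 := by
          rw [hq]
          exact pow_le_pow_of_le_one (by positivity) (by linarith) (by omega)
      _ ≤ x / 144 := by rwa [pow_one]
  obtain ⟨hK0, hγx, hKη, hKU⟩ := sparse_parameters hx0 hx1 hq0 hqx
  have hk1 : 1 ≤ k := by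
    rw [hk]
    refine Nat.one_le_iff_ne_zero.mpr (Nat.pos_iff_ne_zero.mp (Nat.ceil_pos.mpr ?_))
    exact Real.logb_pos (by norm_num) (by rw [one_lt_div hε]; exact hε1)
  have hsize : 2 * (5 + 3 * (d : ℝ)) / (q ^ 2) ^ 2 ≤
      (2 : ℝ) ^ (10000 * A ^ 3 * (Real.log (1 / ε) *
        (Real.log (Real.log (1 / ε)) + Real.log (1 / ε')))) := by
    rw [hq]
    refine sparse_sample_size hA1 hA hA' hε' hε'1 rfl hx ?_ hdk ?_
    · rw [hk]
      exact ceil_logb_le (by rw [one_le_div hε]; exact hε1.le)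
    · refine le_trans ?_ (ceil_logb_le (by rw [one_le_div hx0]; exact hx1))
      exact_mod_cast hd ▸ min_le_right _ _
  have hpow : (2 / 3 : ℝ) ^ (d + 1) ≤ ε + x := by
    have h2 : (2 / 3 : ℝ) ^ (d + 1) ≤ (2 / 3) ^ d :=
      pow_le_pow_of_le_one (by norm_num) (by norm_num) (Nat.le_succ d)
    refine h2.trans ?_
    rcases min_choice k ⌈Real.logb 1.5 (1 / x)⌉₊ with h | h
    · rw [hd, h, hk]
      have : (2 / 3 : ℝ) ^ truncWeight ε ≤ ε := two_thirds_pow_ceil_le hε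
      linarith
    · rw [hd, h]
      have := two_thirds_pow_ceil_le hx0
      linarith
  refine ⟨sparseLearner d ⌈1 / q⌉₊ x, fun O D _ hD => ?_⟩
  refine sparseLearner_guarantee hn hδ hδ1 (by positivity : 0 < q ^ 2) hx0 d ⌈1 / q⌉₊
    ((mul_le_mul_of_nonneg_left hsize hlog0.le).trans hN) O D hD _ fun U hU hUa _ => ?_
  have hsum := sum_unselected_sq_le O.2 hk1 hdk hx0 hx1 hq0.le hq.le hU fun P hP => by
    refine le_of_mul_le_mul_left ((hUa P hP).trans ?_) hK0
    rw [← mul_assoc]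
    exact mul_le_mul_of_nonneg_right hKU (sq_nonneg _)
  refine (add_le_add (mul_le_mul_of_nonneg_right
    (by linarith : _ ≤ ε + 4 * x) (sq_nonneg _)) hsum).trans ?_
  rw [← add_mul]
  refine mul_le_mul_of_nonneg_right ?_ (sq_nonneg _)
  have hW0 : 0 ≤ (specNorm (lowDegree k O.1) / specNorm O.1) ^ bhExponent k :=
    Real.rpow_nonneg (div_nonneg (specNorm_nonneg _) (specNorm_nonneg _)) _
  have h6 : ε' = 8 * x := by rw [hx]; ring
  rw [h6]
  nlinarith

end Parameters

/-- For `ε' < 1 - ε` the exponent of the sample size is bounded below. -/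
lemma one_sub_div_four_le_log_log {ε ε' : ℝ} (hε : 0 < ε) (hε' : 0 < ε')
    (h : ε' < 1 - ε) :
    (1 - ε) / 4 ≤ Real.log (Real.log (1 / ε)) + Real.log (1 / ε') := by
  set s := √ε with hs
  have hs0 : 0 < s := Real.sqrt_pos.mpr hε
  have hs2 : s ^ 2 = ε := Real.sq_sqrt hε.le
  have hs1 : s < 1 := by nlinarith
  have hL : 2 * (1 - s) ≤ Real.log (1 / ε) := by
    have h1 := Real.log_le_sub_one_of_pos hs0
    rw [one_div, Real.log_inv, ← hs2, Real.log_pow]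
    push_cast
    linarith
  have hL0 : 0 < Real.log (1 / ε) := by linarith
  rw [← Real.log_mul hL0.ne' (by positivity)]
  -- `log (1 / ε) ≥ 2 (1 - √ε)` and `ε' < (1 - √ε) (1 + √ε)`
  have h1 : 2 / (1 + s) ≤ Real.log (1 / ε) * (1 / ε') := by
    rw [mul_one_div, div_le_div_iff₀ (by linarith) hε']
    nlinarith
  have h2 : (1 - s) / 2 ≤ Real.log (2 / (1 + s)) := by
    have h3 := Real.one_sub_inv_le_log_of_pos (by positivity : 0 < 2 / (1 + s))
    rw [inv_div] at h3
    linarith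
  have h3 := Real.log_le_log (by positivity) h1
  nlinarith

theorem mainTheorem3 :
    ∃ C : ℝ, 0 < C ∧
      ∀ (n : ℕ) (ε ε' δ : ℝ), 2 ≤ n → 0 < ε → ε < 1 → 0 < ε' → 0 < δ →
      ∀ N : ℕ,
        Real.log ((n : ℝ) / δ) *
          min ((2 : ℝ) ^ (C * (Real.log (1 / ε) *
                (Real.log (Real.log (1 / ε)) + Real.log (1 / ε')))))
              ((2 : ℝ) ^ (C * (Real.log (1 / ε) * Real.log (n : ℝ)))) ≤ (N : ℝ) →
      ∃ learn : (Fin N → QState n × ℝ) → Observable n × ℝ,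
        ∀ (O : Observable n) (D : Measure (QState n)) [IsProbabilityMeasure D],
          InvariantUnderHS D →
          (Measure.pi fun _ : Fin N => D)
            {ρs : Fin N → QState n |
              ¬ predictionError D O (learn (trainingData O ρs)) ≤
                (ε + ε' * (1 + (specNorm (lowDegree (truncWeight ε) O.1) / specNorm O.1) ^
                    bhExponent (truncWeight ε))) * specNorm O.1 ^ 2} ≤
            ENNReal.ofReal δ := by
  have hc0 := meanGain_pos
  have hc1 := meanGain_le
  set A : ℝ := 4 / meanGain with hA
  have hA1 : 1 ≤ A := by rw [hA, one_le_div hc0]; linarith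
  have hAc : A * meanGain = 4 := by rw [hA]; field_simp
  refine ⟨10000 * A ^ 3, by positivity, fun n ε ε' δ hn hε hε1 hε' hδ N hN => ?_⟩
  have hn0 : (2 : ℝ) ≤ n := by exact_mod_cast hn
  have hW0 : ∀ O : Observable n, 0 ≤ (specNorm (lowDegree (truncWeight ε) O.1) / specNorm O.1) ^
      bhExponent (truncWeight ε) := fun O =>
    Real.rpow_nonneg (div_nonneg (specNorm_nonneg _) (specNorm_nonneg _)) _
  -- a failure probability `δ ≥ 1` is no restriction
  rcases le_total 1 δ with hδ1 | hδ1
  · refine ⟨fun _ => modelOfCoeff 0, fun O D _ _ => prob_le_one.trans ?_⟩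
    rw [← ENNReal.ofReal_one]
    exact ENNReal.ofReal_le_ofReal hδ1
  -- if `ε + ε' ≥ 1`, predicting zero suffices
  rcases le_or_gt (1 - ε) ε' with hεε | hεε
  · refine ⟨fun _ => modelOfCoeff 0, fun O D _ _ => ?_⟩
    have h1 : predictionError D O (modelOfCoeff 0) ≤
        (ε + ε' * (1 + (specNorm (lowDegree (truncWeight ε) O.1) / specNorm O.1) ^
          bhExponent (truncWeight ε))) * specNorm O.1 ^ 2 := by
      refine (predictionError_zero_le O D).trans (le_mul_of_one_le_left (sq_nonneg _) ?_)
      nlinarith [mul_nonneg hε'.le (hW0 O)]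
    simp [h1]
  have hlog0 : 0 < Real.log (n / δ) := Real.log_pos (by rw [lt_div_iff₀ hδ]; linarith)
  have hLε : 1 - ε ≤ Real.log (1 / ε) := by
    rw [one_div, Real.log_inv]
    linarith [Real.log_le_sub_one_of_pos hε]
  have hL' := one_sub_div_four_le_log_log hε hε' hεε
  have hln : 0 ≤ Real.log n := Real.log_nonneg (by linarith)
  rcases le_or_gt (1 - meanGain) ε with hlarge | hsmall
  · -- accuracy close to the trivial one
    have hmin : 1 ≤ min ((2 : ℝ) ^ (10000 * A ^ 3 * (Real.log (1 / ε) *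
                (Real.log (Real.log (1 / ε)) + Real.log (1 / ε')))))
              ((2 : ℝ) ^ (10000 * A ^ 3 * (Real.log (1 / ε) * Real.log (n : ℝ)))) := by
      have h1 : 0 ≤ Real.log (1 / ε) := by linarith
      have h2 : 0 ≤ Real.log (Real.log (1 / ε)) + Real.log (1 / ε') := by linarith
      exact le_min (Real.one_le_rpow (by norm_num) (by positivity))
        (Real.one_le_rpow (by norm_num) (by positivity))
    have hN' : Real.log (n / δ) ≤ N := (le_mul_of_one_le_right hlog0.le hmin).trans hN
    refine ⟨meanLearner (Real.exp (-8) / 20), fun O D _ hD =>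
      meanLearner_guarantee hn hδ hδ1 hN' O D hD _ (mul_le_mul_of_nonneg_right ?_ (sq_nonneg _))⟩
    have := mul_nonneg hε'.le (hW0 O)
    linarith
  · have hAL : 1 ≤ A * Real.log (1 / ε) := by nlinarith
    have hAL' : 1 ≤ A * (Real.log (Real.log (1 / ε)) + Real.log (1 / ε')) := by nlinarith
    rcases min_choice ((2 : ℝ) ^ (10000 * A ^ 3 * (Real.log (1 / ε) *
                (Real.log (Real.log (1 / ε)) + Real.log (1 / ε')))))
              ((2 : ℝ) ^ (10000 * A ^ 3 * (Real.log (1 / ε) * Real.log (n : ℝ)))) with h | h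
    · rw [h] at hN
      exact exists_learner_of_sparsity_bound hn hε hε1 hε' (by linarith) hδ hδ1 hA1 hAL hAL' hN
    · rw [h] at hN
      refine exists_learner_of_dimension_bound hn hε hε1 hε' hδ hδ1 hA1 hAL (le_trans ?_ hN)
      refine mul_le_mul_of_nonneg_left ?_ hlog0.le
      refine Real.rpow_le_rpow_of_exponent_le (by norm_num) ?_
      refine mul_le_mul_of_nonneg_right ?_ (mul_nonneg (by linarith) hln)
      have : A ≤ A ^ 3 := le_self_pow₀ hA1 (by norm_num)
      linarith
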